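/- **Conventions.** A *cube complex* is a cell complex built from unit cubes $[0,1]^d$ (of arbitrary finite dimensions $d$) glued along their faces by isometries, with the weak topology; cubes need not be embedded, and neither finite dimension nor local finiteness is required. Products of cube complexes are taken with the product cell structure and its weak topology. A *height function* on a cube complex $X$ is a continuous map $h\colon X\to\mathbb R$ which is affine on each cube and maps each edge onto an interval $[n,n+1]$ with $n\in\mathbb Z$; a product $X_1\times X_2\times X_3$ carries the height function $h(x_1,x_2,x_3)=h_1(x_1)+h_2(x_2)+h_3(x_3)$, and $[X]_0=h^{-1}(0)$. A *monotone line* in $X$ is a $1$-dimensional subcomplex $L\subset X$ such that $h|_L\colon L\to\mathbb R$ is a homeomorphism, and $X$ is *admissible* if every vertex of $X$ lies on a monotone line. The *sliced cell structure* on $X$ is obtained by subdividing each cube along the level sets $h^{-1}(n)$, $n\in\mathbb Z$; with it, $[X]_0$ is a subcomplex of $X$. Cube complexes with height functions are given the sliced cell structure. For a closed edge path $p$ in a simply connected cell complex $Y$, the *filling area* of $p$ is the minimal number of $2$-cells crossed by a nullhomotopy of $p$ in the $2$-skeleton of $Y$: the minimal number of insertions or deletions of boundary loops of $2$-cells in a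 sequence of such moves, together with insertions and deletions of backtracks $e\bar e$ (which are not counted), that transforms $p$ into a constant path. The *Dehn function* $\delta_Y\colon\mathbb N\to\mathbb N\cup\{\infty\}$ is $$\delta_Y(n)=\sup\{\text{filling area of }p \mid p\text{ a closed edge path in }Y\text{ traversing at most }n\text{ edges}\}.$$ We write $f\preceq g$ if there is a constant $C$ such that $f(n)\le C\,g(Cn+C)+Cn+C$ for all $n\in\mathbb N$. **Theorem.** Let $\alpha\ge 2$ be a real number and let $X_1,X_2,X_3$ be simply connected cube complexes with height functions such that each $X_i$ is admissible and has finite-valued Dehn function $\delta_{X_i}\preceq n^\alpha$. Then the level set $[X_1\times X_2\times X_3]_0$ is simply connected, and its Dehn function, with respect to the sliced cell structure, is $\preceq n^\alpha$. -/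

import Mathlib

open scoped unitInterval ENNReal

universe u v u₁ v₁ u₂ v₂ u₃ v₃

/-! ### Cube complexes -/

/-- Reflect the unit interval if `b` is `true`, do nothing otherwise. -/
def flipIf (b : Bool) (t : I) : I := if b then unitInterval.symm t else t

set_option linter.checkUnivs false in
/-- A cube complex: a set of points `Pt` that is the union of the images of unit cubes
`[0,1]^(Dir c)`, one for each `c : Cube`, glued along their faces by isometries of cubes.

* `charMap c` is the characteristic map of the closed cube `c`, and `Dir c` is the finite set of its
  coordinate directions, so that the dimension of `c` is the cardinality of `Dir c`;
* every point lies in exactly one open cube, and has exactly one preimage in it;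
* the restriction of `charMap c` to the codimension one face `x i = 0` or `x i = 1` is the
  characteristic map of a cube `d`, precomposed with an isometry of cubes (a bijection `τ` between
  the coordinates of `d` and those of the face, and a reflection in some of the coordinates).

Closed cubes need not be embedded, and there is no condition of finite dimension or of local
finiteness. The topology is the weak topology, see below. -/
structure CubeComplex where
  /-- The points. -/
  Pt : Type u
  /-- The cubes, of all dimensions. -/
  Cube : Type v
  /-- The coordinate directions of a cube. -/
  Dir : Cube → Type
  finite_dir : ∀ c, Finite (Dir c)
  /-- The characteristic maps. -/
  charMap : ∀ c, (Dir c → I) → Pt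
  exists_open : ∀ p, ∃ c, ∃ x : Dir c → I, (∀ i, 0 < x i ∧ x i < 1) ∧ charMap c x = p
  open_disjoint : ∀ c d, ∀ x : Dir c → I, ∀ y : Dir d → I, (∀ i, 0 < x i ∧ x i < 1) →
    (∀ i, 0 < y i ∧ y i < 1) → charMap c x = charMap d y → c = d
  open_injective : ∀ c, ∀ x y : Dir c → I, (∀ i, 0 < x i ∧ x i < 1) →
    (∀ i, 0 < y i ∧ y i < 1) → charMap c x = charMap c y → x = y
  exists_face : ∀ c, ∀ i : Dir c, ∀ ε : Bool, ∃ d, ∃ τ : Dir d → Dir c, ∃ f : Dir d → Bool,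
    Function.Injective τ ∧ Set.range τ = {i}ᶜ ∧
    ∀ x : Dir c → I, x i = (if ε then 1 else 0) →
      charMap c x = charMap d (fun k => flipIf (f k) (x (τ k)))

namespace CubeComplex

/-- The weak topology: a set is open (closed) if and only if its preimage in every closed cube is
open (closed). -/
instance (K : CubeComplex.{u, v}) : TopologicalSpace K.Pt :=
  ⨆ c : K.Cube, TopologicalSpace.coinduced (K.charMap c) inferInstance

/-- The product cube complex; its cubes are the products of cubes. -/
def prod (K : CubeComplex.{u₁, v₁}) (L : CubeComplex.{u₂, v₂}) :
    CubeComplex.{max u₁ u₂, max v₁ v₂} where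
  Pt := K.Pt × L.Pt
  Cube := K.Cube × L.Cube
  Dir c := K.Dir c.1 ⊕ L.Dir c.2
  finite_dir c := by
    have := K.finite_dir c.1
    have := L.finite_dir c.2
    infer_instance
  charMap c x := (K.charMap c.1 (fun i => x (Sum.inl i)), L.charMap c.2 (fun i => x (Sum.inr i)))
  exists_open := by
    rintro ⟨p, q⟩
    obtain ⟨c, x, hx, rfl⟩ := K.exists_open p
    obtain ⟨d, y, hy, rfl⟩ := L.exists_open q
    refine ⟨(c, d), Sum.elim x y, ?_, rfl⟩
    rintro (i | i)
    · exact hx i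
    · exact hy i
  open_disjoint := by
    rintro ⟨c, c'⟩ ⟨d, d'⟩ x y hx hy h
    rw [Prod.mk.injEq] at h
    rw [Prod.mk.injEq]
    exact ⟨K.open_disjoint c d _ _ (fun i => hx _) (fun i => hy _) h.1,
      L.open_disjoint c' d' _ _ (fun i => hx _) (fun i => hy _) h.2⟩
  open_injective := by
    rintro ⟨c, c'⟩ x y hx hy h
    rw [Prod.mk.injEq] at h
    have h1 := K.open_injective c _ _ (fun i => hx _) (fun i => hy _) h.1
    have h2 := L.open_injective c' _ _ (fun i => hx _) (fun i => hy _) h.2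
    funext i
    rcases i with i | i
    · exact congrFun h1 i
    · exact congrFun h2 i
  exists_face := by
    rintro ⟨c, c'⟩ (i | i) ε
    · obtain ⟨d, τ, f, hτ, hr, h⟩ := K.exists_face c i ε
      refine ⟨(d, c'), Sum.map τ id, Sum.elim f (fun _ => false),
        hτ.sumMap Function.injective_id, ?_, ?_⟩
      · ext (j | j)
        · have := Set.ext_iff.1 hr j
          simpa using this
        · simp
      · intro x hx
        rw [Prod.mk.injEq]
        exact ⟨h _ hx, rfl⟩
    · obtain ⟨d, τ, f, hτ, hr, h⟩ := L.exists_face c' i ε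
      refine ⟨(c, d), Sum.map id τ, Sum.elim (fun _ => false) f,
        Function.injective_id.sumMap hτ, ?_, ?_⟩
      · ext (j | j)
        · simp
        · have := Set.ext_iff.1 hr j
          simpa using this
      · intro x hx
        rw [Prod.mk.injEq]
        exact ⟨rfl, h _ hx⟩

/-! ### Height functions, monotone lines, level sets -/

/-- A height function: continuous, affine on every cube, and mapping every edge onto an interval
`[n, n + 1]` with `n` an integer. -/
structure IsHeightFunction (K : CubeComplex.{u, v}) (h : K.Pt → ℝ) : Prop where
  continuous : Continuous h
  affine : ∀ c, ∃ A : (K.Dir c → ℝ) →ᵃ[ℝ] ℝ, ∀ x : K.Dir c → I,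
    h (K.charMap c x) = A (fun i => (x i : ℝ))
  edge : ∀ c, Nat.card (K.Dir c) = 1 →
    ∃ n : ℤ, h '' Set.range (K.charMap c) = Set.Icc (n : ℝ) (n + 1)

/-- The height function `h (x, y) = h x + k y` on a product. -/
def prodHeight {K : CubeComplex.{u₁, v₁}} {L : CubeComplex.{u₂, v₂}} (h : K.Pt → ℝ)
    (k : L.Pt → ℝ) : (K.prod L).Pt → ℝ :=
  fun p => h p.1 + k p.2

/-- A monotone line: a subcomplex consisting of vertices and edges which `h` maps
homeomorphically onto the real line. -/
def IsMonotoneLine (K : CubeComplex.{u, v}) (h : K.Pt → ℝ) (L : Set K.Pt) : Prop :=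
  (∃ 𝒞 : Set K.Cube, (∀ c ∈ 𝒞, Nat.card (K.Dir c) ≤ 1) ∧
    L = ⋃ c ∈ 𝒞, Set.range (K.charMap c)) ∧
  IsHomeomorph (L.domRestrict h)

/-- The vertices are the points of the cubes of dimension zero. -/
def IsVertex (K : CubeComplex.{u, v}) (p : K.Pt) : Prop :=
  ∃ c, Nat.card (K.Dir c) = 0 ∧ p ∈ Set.range (K.charMap c)

/-- Every vertex lies on a monotone line. -/
def Admissible (K : CubeComplex.{u, v}) (h : K.Pt → ℝ) : Prop :=
  ∀ p, K.IsVertex p → ∃ L, K.IsMonotoneLine h L ∧ p ∈ L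

/-- The zero level set. It carries the subspace topology. -/
def zeroLevel (K : CubeComplex.{u, v}) (h : K.Pt → ℝ) : Set K.Pt := {p | h p = 0}

end CubeComplex

/-! ### Edge paths, filling area, Dehn functions -/

/-- The two-dimensional cell data that filling areas depend on. A directed edge is recorded as a
parametrized arc in the ambient set of points `P`; a 2-cell is recorded by its boundary, a closed
path of directed edges. -/
structure TwoSkeleton (P : Type u) where
  /-- The directed edges. -/
  edges : Set (I → P)
  /-- The boundary loops of the 2-cells. -/
  faces : Set (List (I → P))

namespace TwoSkeleton

variable {P : Type u}

/-- The same edge with the opposite direction. -/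
def rev (e : I → P) : I → P := fun t => e (unitInterval.symm t)

/-- `p` is an edge path from `a` to `b`. -/
def IsEdgePath (S : TwoSkeleton P) : P → List (I → P) → P → Prop
  | a, [], b => a = b
  | a, e :: p, b => e ∈ S.edges ∧ e 0 = a ∧ IsEdgePath S (e 1) p b

/-- `S.Homotopic a b p q n`: there is a combinatorial homotopy, relative to the endpoints `a` and
`b`, between the edge paths `p` and `q`, which crosses `n` 2-cells. It consists of elementary
moves, which insert or delete a backtrack (at no cost) or the boundary loop of a 2-cell (which
costs one). -/
inductive Homotopic (S : TwoSkeleton P) (a b : P) :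
    List (I → P) → List (I → P) → ℕ → Prop
  | refl (p : List (I → P)) (hp : S.IsEdgePath a p b) : Homotopic S a b p p 0
  | backtrack (p q : List (I → P)) (e : I → P) (h : S.IsEdgePath a (p ++ e :: rev e :: q) b) :
      Homotopic S a b (p ++ q) (p ++ e :: rev e :: q) 0
  | face (p r q : List (I → P)) (hr : r ∈ S.faces) (h : S.IsEdgePath a (p ++ r ++ q) b) :
      Homotopic S a b (p ++ q) (p ++ r ++ q) 1
  | symm {p q : List (I → P)} {n : ℕ} : Homotopic S a b p q n → Homotopic S a b q p n
  | trans {p q r : List (I → P)} {m n : ℕ} :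
      Homotopic S a b p q m → Homotopic S a b q r n → Homotopic S a b p r (m + n)

/-- The filling area of a closed edge path `p` based at `a`: the minimal number of 2-cells crossed
by a nullhomotopy of `p`, and `⊤` if there is none. -/
noncomputable def fillingArea (S : TwoSkeleton P) (a : P) (p : List (I → P)) : ℕ∞ :=
  ⨅ (n : ℕ) (_ : S.Homotopic a a p [] n), (n : ℕ∞)

/-- The Dehn function: the supremum of the filling areas of the closed edge paths of length at most
`n`, where the length is the number of edges traversed. -/
noncomputable def dehn (S : TwoSkeleton P) (n : ℕ) : ℕ∞ :=
  ⨆ (a : P) (p : List (I → P)) (_ : S.IsEdgePath a p a ∧ p.length ≤ n), S.fillingArea a p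

end TwoSkeleton

/-- The relation `f ≼ g`: there is a constant `C` with `f n ≤ C * g (C * n + C) + C * n + C` for
all `n`. -/
def DehnLE (f : ℕ → ℕ∞) (g : ℕ → ℝ≥0∞) : Prop :=
  ∃ C : ℕ, ∀ n : ℕ, ((f n : ℕ∞) : ℝ≥0∞) ≤ C * g (C * n + C) + C * n + C

/-! ### The sliced cell structure -/

namespace CubeComplex

/-- The affinely parametrized segment in a unit cube from the corner `a` to the corner `b`. Corners
are written as functions to `Bool`, with `false` for the coordinate `0` and `true` for `1`. -/
def seg {ι : Type} (a b : ι → Bool) (t : I) : ι → I := fun i =>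
  match a i, b i with
  | false, false => 0
  | true, true => 1
  | false, true => t
  | true, false => unitInterval.symm t

/-- Slicing a cube `c` along the integer levels of the height function leaves the vertices as they
are. Two corners `a` and `b` of `c` span an edge of the sliced structure if and only if they span an
edge of `c`, or they are the ends of the horizontal diagonal of a square face of `c`. -/
def SlicedAdj (K : CubeComplex.{u, v}) (h : K.Pt → ℝ) (c : K.Cube) (a b : K.Dir c → Bool) : Prop :=
  {i | a i ≠ b i}.ncard = 1 ∨
  ({i | a i ≠ b i}.ncard = 2 ∧ h (K.charMap c (seg a b 0)) = h (K.charMap c (seg a b 1)))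

/-- The 2-skeleton of the sliced cell structure. Its 2-cells are triangles: a horizontal diagonal
cuts a square into two transverse triangles, and the two intermediate integer levels of a 3-cube
meet it in two horizontal triangles. In every cube, these are precisely the triangles with three
corners of the cube as vertices, all of whose sides are edges of the sliced structure. -/
def sliced (K : CubeComplex.{u, v}) (h : K.Pt → ℝ) : TwoSkeleton K.Pt where
  edges := {e | ∃ c, ∃ a b : K.Dir c → Bool, K.SlicedAdj h c a b ∧
    e = fun t => K.charMap c (seg a b t)}
  faces := {r | ∃ c, ∃ a b d : K.Dir c → Bool,
    K.SlicedAdj h c a b ∧ K.SlicedAdj h c b d ∧ K.SlicedAdj h c d a ∧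
    r = [fun t => K.charMap c (seg a b t), fun t => K.charMap c (seg b d t),
      fun t => K.charMap c (seg d a t)]}

/-- The 2-skeleton of the zero level set, as a subcomplex of the sliced cell structure. As the
height is affine on a triangle, the triangle lies in the level set if its sides do. -/
def slicedZeroLevel (K : CubeComplex.{u, v}) (h : K.Pt → ℝ) : TwoSkeleton K.Pt where
  edges := {e | e ∈ (K.sliced h).edges ∧ ∀ t, e t ∈ K.zeroLevel h}
  faces := {r | r ∈ (K.sliced h).faces ∧ ∀ e ∈ r, ∀ t, e t ∈ K.zeroLevel h}

end CubeComplex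

/-!
## Why the theorem is true

Admissibility provides lines: sections `l` of the height, running through edges of the complex
(`Admissible.exists_isLine`). As a consequence vertices have integral heights, and on every cube
the height is an integer plus a sum of coordinates with signs (`IsHeightFunction.integralHeight`).

If `l` is a line in the third factor, then `(x, y) ↦ (x, y, l (-(h₁ x + h₂ y)))` embeds the whole
product of the first two factors, with its sliced structure, into the zero level; this rests on
`IsLine.isMorphism_lineGraph`. There are such charts for lines in each of the factors, and
homotopies in a product of two complexes can be transported to the zero level without a change of
area. In a product of two complexes everything is easy: an edge path is homotopic, with quadratic
area, to its projection to one factor followed by its projection to the other one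
(`homotopicLE_traces`), so that two paths with homotopic projections are homotopic
(`homotopicLE_of_traces`). Moreover a line is a tree, hence the path on a line which compensates
the height of another path (its shadow) is determined by its ends up to backtracks
(`homotopicLE_shadow`).

An edge path `γ` in the zero level has a normal form: its projection to the first two factors,
compensated along a line in the third factor, followed by a correction in the third factor,
compensated along a line in the first factor. Single edges can be brought into normal form since
each of them lies in a chart. The normal forms of two paths can be combined at quadratic cost
(`homotopicLE_normalForm_append`), because a path in the third factor can be exchanged with a path
in the first two factors, one factor at a time (`homotopicLE_exchange_prod`); here three factors
are needed, as one of them has to be free to compensate the height. Cutting a path into halves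
recursively gives normal forms with quadratic area (`homotopicLE_normalForm`). If `γ` is closed,
then both parts of its normal form are closed paths in charts, and are filled by fillings of the
projections of `γ` to the factors (`homotopicLE_nil_of_traces`). As `2 ≤ α`, this proves the
estimate of the Dehn function, and it shows that all closed edge paths in the zero level are
combinatorially contractible.

It remains to pass from edge paths to the topology of the zero level. Fix a base vertex. For a
point `q` of the zero level, in a cube `c`, there is a class of paths from the base vertex to `q`,
given by an edge path to a corner of `c` in the zero level, followed by a straight segment in `c`.
It depends only on `q`, because closed edge paths are contractible and cubes meet the zero level
in convex sets (`IsClass.unique`). Every point has an open star which can be contracted to the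
point along straight segments (`continuousOn_track`), and the classes are compatible with paths in
a star; by compactness of the unit interval, they are compatible with all paths (`IsClass.trans`).
Therefore any two paths with the same ends are homotopic. Connectedness of the zero level follows
from that of the factors by means of the charts (`exists_isEdgePath_zeroLevel`).
-/

/-! ### Calculus of combinatorial homotopies -/

namespace TwoSkeleton

variable {P : Type u} {Q : Type v}

@[simp] lemma rev_rev (e : I → P) : rev (rev e) = e := by
  funext t; simp [rev]

@[simp] lemma rev_zero (e : I → P) : rev e 0 = e 1 := by simp [rev]

@[simp] lemma rev_one (e : I → P) : rev e 1 = e 0 := by simp [rev]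

/-- The edge path `p` traversed backwards. -/
def revPath (p : List (I → P)) : List (I → P) := (p.map rev).reverse

@[simp] lemma revPath_nil : revPath ([] : List (I → P)) = [] := rfl

@[simp] lemma revPath_cons (e : I → P) (p : List (I → P)) :
    revPath (e :: p) = revPath p ++ [rev e] := by simp [revPath]

@[simp] lemma revPath_append (p q : List (I → P)) :
    revPath (p ++ q) = revPath q ++ revPath p := by simp [revPath]

@[simp] lemma revPath_revPath (p : List (I → P)) : revPath (revPath p) = p := by
  induction p with
  | nil => rfl
  | cons e p ih => simp [ih]

@[simp] lemma length_revPath (p : List (I → P)) : (revPath p).length = p.length := by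
  simp [revPath]

/-- The edges of `S` may be traversed in both directions, and the boundary loops of the 2-cells
are closed. -/
structure Proper (S : TwoSkeleton P) : Prop where
  rev_mem : ∀ e ∈ S.edges, rev e ∈ S.edges
  closed : ∀ r ∈ S.faces, ∀ a b, S.IsEdgePath a r b → a = b

variable {S : TwoSkeleton P} {T : TwoSkeleton Q} {a b c d : P}

lemma isEdgePath_append {p q : List (I → P)} :
    S.IsEdgePath a (p ++ q) b ↔ ∃ c, S.IsEdgePath a p c ∧ S.IsEdgePath c q b := by
  induction p generalizing a with
  | nil => simp [IsEdgePath]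
  | cons e p ih => simp [IsEdgePath, ih, and_assoc]

lemma IsEdgePath.append {p q : List (I → P)} (hp : S.IsEdgePath a p b)
    (hq : S.IsEdgePath b q c) : S.IsEdgePath a (p ++ q) c :=
  isEdgePath_append.2 ⟨b, hp, hq⟩

lemma isEdgePath_singleton {e : I → P} (he : e ∈ S.edges) : S.IsEdgePath (e 0) [e] (e 1) :=
  ⟨he, rfl, rfl⟩

lemma isEdgePath_singleton' {e : I → P} (he : e ∈ S.edges) (h0 : e 0 = a) (h1 : e 1 = b) :
    S.IsEdgePath a [e] b :=
  ⟨he, h0, h1⟩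

lemma IsEdgePath.revPath (hS : S.Proper) {p : List (I → P)} (h : S.IsEdgePath a p b) :
    S.IsEdgePath b (revPath p) a := by
  induction p generalizing a with
  | nil => exact Eq.symm h
  | cons e p ih =>
    rw [revPath_cons]
    exact (ih h.2.2).append ⟨hS.rev_mem e h.1, by simp, (rev_one e).trans h.2.1⟩

lemma IsEdgePath.map {φ : P → Q} (he : ∀ e ∈ S.edges, φ ∘ e ∈ T.edges) {p : List (I → P)}
    (h : S.IsEdgePath a p b) : T.IsEdgePath (φ a) (p.map (φ ∘ ·)) (φ b) := by
  induction p generalizing a with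
  | nil => exact congrArg φ h
  | cons e p ih => exact ⟨he e h.1, congrArg φ h.2.1, ih h.2.2⟩

lemma IsEdgePath.forall_edges {p : List (I → P)} (h : S.IsEdgePath a p b) :
    ∀ e ∈ p, e ∈ S.edges := by
  induction p generalizing a with
  | nil => simp
  | cons e p ih =>
    intro e' he'
    rcases List.mem_cons.1 he' with rfl | he'
    · exact h.1
    · exact ih h.2.2 e' he'

lemma Homotopic.isEdgePath (hS : S.Proper) {p q : List (I → P)} {n : ℕ}
    (h : S.Homotopic a b p q n) : S.IsEdgePath a p b ∧ S.IsEdgePath a q b := by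
  induction h with
  | refl p hp => exact ⟨hp, hp⟩
  | backtrack p q e h =>
    refine ⟨?_, h⟩
    obtain ⟨c, h1, he, h2, -, -, h3⟩ := isEdgePath_append.1 h
    rw [rev_one, h2] at h3
    exact h1.append h3
  | face p r q hr h =>
    refine ⟨?_, h⟩
    obtain ⟨c, h1, h3⟩ := isEdgePath_append.1 h
    obtain ⟨d, h1, h2⟩ := isEdgePath_append.1 h1
    rw [← hS.closed r hr _ _ h2] at h3
    exact h1.append h3
  | symm _ ih => exact ⟨ih.2, ih.1⟩
  | trans _ _ ih1 ih2 => exact ⟨ih1.1, ih2.2⟩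

lemma Homotopic.append_right {p q : List (I → P)} {n : ℕ}
    (h : S.Homotopic a b p q n) {r : List (I → P)} (hr : S.IsEdgePath b r c) :
    S.Homotopic a c (p ++ r) (q ++ r) n := by
  induction h with
  | refl p hp => exact .refl _ (hp.append hr)
  | backtrack p q e h =>
    have := h.append hr
    simp only [List.append_assoc, List.cons_append] at this ⊢
    exact .backtrack p (q ++ r) e this
  | face p s q hs h =>
    have := h.append hr
    rw [List.append_assoc] at this
    rw [List.append_assoc, List.append_assoc]
    exact .face p s (q ++ r) hs this
  | symm _ ih => exact .symm ih
  | trans _ _ ih1 ih2 => exact .trans ih1 ih2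

lemma Homotopic.append_left {p q : List (I → P)} {n : ℕ}
    (h : S.Homotopic b c p q n) {r : List (I → P)} (hr : S.IsEdgePath a r b) :
    S.Homotopic a c (r ++ p) (r ++ q) n := by
  induction h with
  | refl p hp => exact .refl _ (hr.append hp)
  | backtrack p q e h =>
    have := hr.append h
    rw [← List.append_assoc] at this ⊢
    rw [← List.append_assoc]
    exact .backtrack (r ++ p) q e this
  | face p s q hs h =>
    have := hr.append h
    rw [← List.append_assoc, ← List.append_assoc] at this ⊢
    rw [← List.append_assoc]
    exact .face (r ++ p) s q hs this
  | symm _ ih => exact .symm ih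
  | trans _ _ ih1 ih2 => exact .trans ih1 ih2

/-- There is a combinatorial homotopy between the edge paths `p` and `q` from `a` to `b` which
crosses at most `n` 2-cells. -/
def HomotopicLE (S : TwoSkeleton P) (a b : P) (p q : List (I → P)) (n : ℕ) : Prop :=
  ∃ m ≤ n, S.Homotopic a b p q m

namespace HomotopicLE

variable {p q r p' q' : List (I → P)} {m n : ℕ}

lemma refl (h : S.IsEdgePath a p b) : S.HomotopicLE a b p p n :=
  ⟨0, Nat.zero_le _, .refl p h⟩

lemma symm (h : S.HomotopicLE a b p q n) : S.HomotopicLE a b q p n :=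
  let ⟨m, hm, h⟩ := h; ⟨m, hm, h.symm⟩

lemma trans (h : S.HomotopicLE a b p q m) (h' : S.HomotopicLE a b q r n) :
    S.HomotopicLE a b p r (m + n) :=
  let ⟨_, hm, h⟩ := h; let ⟨_, hn, h'⟩ := h'; ⟨_, add_le_add hm hn, h.trans h'⟩

lemma mono (h : S.HomotopicLE a b p q m) (hmn : m ≤ n) : S.HomotopicLE a b p q n :=
  let ⟨k, hk, h⟩ := h; ⟨k, hk.trans hmn, h⟩

lemma trans_le {k : ℕ} (h : S.HomotopicLE a b p q m) (h' : S.HomotopicLE a b q r n)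
    (hk : m + n ≤ k) : S.HomotopicLE a b p r k :=
  (h.trans h').mono hk

lemma left (hS : S.Proper) (h : S.HomotopicLE a b p q n) : S.IsEdgePath a p b :=
  let ⟨_, _, h⟩ := h; (h.isEdgePath hS).1

lemma right (hS : S.Proper) (h : S.HomotopicLE a b p q n) : S.IsEdgePath a q b :=
  let ⟨_, _, h⟩ := h; (h.isEdgePath hS).2

lemma append_right (h : S.HomotopicLE a b p q n) (hr : S.IsEdgePath b r c) :
    S.HomotopicLE a c (p ++ r) (q ++ r) n :=
  let ⟨m, hm, h⟩ := h; ⟨m, hm, h.append_right hr⟩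

lemma append_left (h : S.HomotopicLE b c p q n) (hr : S.IsEdgePath a r b) :
    S.HomotopicLE a c (r ++ p) (r ++ q) n :=
  let ⟨m, hm, h⟩ := h; ⟨m, hm, h.append_left hr⟩

lemma append (hS : S.Proper) (h : S.HomotopicLE a b p q m) (h' : S.HomotopicLE b c p' q' n) :
    S.HomotopicLE a c (p ++ p') (q ++ q') (m + n) :=
  (h.append_right (h'.left hS)).trans (h'.append_left (h.right hS))

/-- A homotopy inside a path. -/
lemma congr_mid (hp : S.IsEdgePath a p b) (h : S.HomotopicLE b c q q' n)
    (hr : S.IsEdgePath c r d) :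
    S.HomotopicLE a d (p ++ (q ++ r)) (p ++ (q' ++ r)) n :=
  (h.append_right hr).append_left hp

end HomotopicLE

lemma homotopicLE_append_revPath (hS : S.Proper) {p : List (I → P)} (h : S.IsEdgePath a p b) :
    S.HomotopicLE a a (p ++ revPath p) [] 0 := by
  induction p generalizing a with
  | nil => exact .refl rfl
  | cons e p ih =>
    have h1 := (isEdgePath_singleton' h.1 h.2.1 rfl).append (h.2.2.append (h.2.2.revPath hS))
    have h2 := (ih h.2.2).congr_mid (isEdgePath_singleton' h.1 h.2.1 rfl)
      (isEdgePath_singleton' (hS.rev_mem e h.1) (rev_zero e) ((rev_one e).trans h.2.1))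
    have h3 : S.HomotopicLE a a [e, rev e] [] 0 :=
      ⟨0, le_rfl, .symm (.backtrack [] [] e
        ⟨h.1, h.2.1, hS.rev_mem e h.1, rev_zero e, (rev_one e).trans h.2.1⟩)⟩
    rw [revPath_cons]
    simpa using h2.trans h3

lemma homotopicLE_revPath_append (hS : S.Proper) {p : List (I → P)} (h : S.IsEdgePath a p b) :
    S.HomotopicLE b b (revPath p ++ p) [] 0 := by
  simpa using homotopicLE_append_revPath hS (h.revPath hS)

lemma HomotopicLE.revPath (hS : S.Proper) {p q : List (I → P)} {n : ℕ}
    (h : S.HomotopicLE a b p q n) : S.HomotopicLE b a (revPath p) (revPath q) n := by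
  have hp := h.left hS
  have hq := h.right hS
  have h1 : S.HomotopicLE b a (TwoSkeleton.revPath p)
      (TwoSkeleton.revPath p ++ (q ++ TwoSkeleton.revPath q)) 0 := by
    simpa using ((homotopicLE_append_revPath hS hq).append_left (hp.revPath hS)).symm
  have h2 := (h.symm.congr_mid (hp.revPath hS) (hq.revPath hS))
  have h3 : S.HomotopicLE b a
      (TwoSkeleton.revPath p ++ (p ++ TwoSkeleton.revPath q)) (TwoSkeleton.revPath q) 0 := by
    simpa using (homotopicLE_revPath_append hS hp).append_right (hq.revPath hS)
  exact (h1.trans (h2.trans h3)).mono (by omega)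

/-- Two sides of a triangle are homotopic to the third one. -/
lemma homotopicLE_of_triangle (hS : S.Proper) {e f g : I → P} (h : [e, f, rev g] ∈ S.faces)
    (h1 : e ∈ S.edges) (h2 : f ∈ S.edges) (h3 : g ∈ S.edges) (hea : e 0 = a) (hef : e 1 = f 0)
    (hfb : f 1 = b) (hgb : g 1 = b) : S.HomotopicLE a b [e, f] [g] 1 := by
  have hr := hS.rev_mem g h3
  have h4 : S.Homotopic a b [e, f] [e, f, rev g, g] 0 := by
    have := Homotopic.backtrack (S := S) (a := a) (b := b) [e, f] [] (rev g)
      ⟨h1, hea, h2, hef.symm, hr, by rw [rev_zero, hgb, hfb], by simpa using h3, by simp, by simpa⟩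
    simpa using this
  have h5 : S.Homotopic a b ([] ++ [g]) ([] ++ [e, f, rev g] ++ [g]) 1 :=
    .face [] [e, f, rev g] [g] h
      ⟨h1, hea, h2, hef.symm, hr, by rw [rev_zero, hgb, hfb], h3, by simp, hgb⟩
  exact ⟨0 + 1, le_rfl, h4.trans h5.symm⟩

/-- The maps which send edges to edges and boundary loops of 2-cells to boundary loops of
2-cells. -/
structure IsMorphism (S : TwoSkeleton P) (T : TwoSkeleton Q) (φ : P → Q) : Prop where
  edges : ∀ e ∈ S.edges, φ ∘ e ∈ T.edges
  faces : ∀ r ∈ S.faces, r.map (φ ∘ ·) ∈ T.faces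

lemma IsMorphism.comp {R : Type*} {U : TwoSkeleton R} {φ : P → Q} {ψ : Q → R}
    (hψ : T.IsMorphism U ψ) (hφ : S.IsMorphism T φ) : S.IsMorphism U (ψ ∘ φ) where
  edges e he := hψ.edges _ (hφ.edges e he)
  faces r hr := by
    have := hψ.faces _ (hφ.faces r hr)
    rwa [List.map_map] at this

lemma Homotopic.map {φ : P → Q} (hφ : S.IsMorphism T φ) {p q : List (I → P)} {n : ℕ}
    (h : S.Homotopic a b p q n) :
    T.Homotopic (φ a) (φ b) (p.map (φ ∘ ·)) (q.map (φ ∘ ·)) n := by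
  induction h with
  | refl p hp => exact .refl _ (hp.map hφ.edges)
  | backtrack p q e h =>
    have := h.map hφ.edges
    rw [List.map_append, List.map_cons, List.map_cons] at this
    rw [List.map_append, List.map_append]
    exact .backtrack _ _ (φ ∘ e) this
  | face p s q hs h =>
    have := h.map hφ.edges
    simp only [List.map_append] at this ⊢
    exact .face _ _ _ (hφ.faces s hs) this
  | symm _ ih => exact .symm ih
  | trans _ _ ih1 ih2 => exact .trans ih1 ih2

lemma HomotopicLE.map {φ : P → Q} (hφ : S.IsMorphism T φ) {p q : List (I → P)} {n : ℕ}
    (h : S.HomotopicLE a b p q n) :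
    T.HomotopicLE (φ a) (φ b) (p.map (φ ∘ ·)) (q.map (φ ∘ ·)) n :=
  let ⟨m, hm, h⟩ := h; ⟨m, hm, h.map hφ⟩

/-! ### Traces of edge paths under maps which collapse edges -/

open Classical in
/-- The image of an edge path under a map which sends every edge to an edge or to a point: the
edges which become constant are deleted. -/
noncomputable def trace (φ : P → Q) (p : List (I → P)) : List (I → Q) :=
  (p.map (φ ∘ ·)).filter fun e => decide (∃ t, e t ≠ e 0)

@[simp] lemma trace_append (φ : P → Q) (p q : List (I → P)) :
    trace φ (p ++ q) = trace φ p ++ trace φ q := by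
  simp [trace]

lemma length_trace_le (φ : P → Q) (p : List (I → P)) : (trace φ p).length ≤ p.length := by
  rw [trace]
  exact (List.length_filter_le _ _).trans (List.length_map _).le

lemma trace_singleton_of_const {φ : P → Q} {e : I → P} (h : ∀ t, φ (e t) = φ (e 0)) :
    trace φ [e] = [] := by
  simp [trace, h]

lemma trace_singleton_of_ne {φ : P → Q} {e : I → P} {t : I} (h : φ (e t) ≠ φ (e 0)) :
    trace φ [e] = [φ ∘ e] := by
  classical
  rw [trace, List.map_singleton, List.filter_singleton,
    decide_eq_true (p := ∃ s, (φ ∘ e) s ≠ (φ ∘ e) 0) ⟨t, h⟩]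
  rfl

lemma trace_cons (φ : P → Q) (e : I → P) (p : List (I → P)) :
    trace φ (e :: p) = trace φ [e] ++ trace φ p :=
  trace_append φ [e] p

/-- No edge of `S` is a constant map. -/
def Nonconst (S : TwoSkeleton P) : Prop := ∀ e ∈ S.edges, ∃ t, e t ≠ e 0

lemma trace_eq_map (hT : T.Nonconst) {φ : P → Q} {p : List (I → P)}
    (h : ∀ e ∈ p, φ ∘ e ∈ T.edges) : trace φ p = p.map (φ ∘ ·) := by
  rw [trace, List.filter_eq_self]
  intro e' he'
  obtain ⟨e, he, rfl⟩ := List.mem_map.1 he'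
  simpa using hT _ (h e he)

lemma trace_eq_nil {φ : P → Q} {p : List (I → P)}
    (h : ∀ e ∈ p, ∀ t, φ (e t) = φ (e 0)) : trace φ p = [] := by
  rw [trace, List.filter_eq_nil_iff]
  intro e' he'
  obtain ⟨e, he, rfl⟩ := List.mem_map.1 he'
  simpa using h e he

lemma trace_map {R : Type*} (φ : P → Q) (ψ : R → P) (p : List (I → R)) :
    trace φ (p.map (ψ ∘ ·)) = trace (φ ∘ ψ) p := by
  simp only [trace, List.map_map]; rfl

lemma trace_singleton_isEdgePath {φ : P → Q} {e : I → P}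
    (h : φ ∘ e ∈ T.edges ∨ ∀ t, φ (e t) = φ (e 0)) :
    T.IsEdgePath (φ (e 0)) (trace φ [e]) (φ (e 1)) := by
  by_cases hc : ∀ t, φ (e t) = φ (e 0)
  · rw [trace_singleton_of_const hc]
    exact (hc 1).symm
  · obtain ⟨t, ht⟩ := not_forall.1 hc
    rw [trace_singleton_of_ne ht]
    exact isEdgePath_singleton (h.resolve_right hc)

lemma IsEdgePath.trace {φ : P → Q}
    (he : ∀ e ∈ S.edges, φ ∘ e ∈ T.edges ∨ ∀ t, φ (e t) = φ (e 0)) {p : List (I → P)}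
    (h : S.IsEdgePath a p b) : T.IsEdgePath (φ a) (trace φ p) (φ b) := by
  induction p generalizing a with
  | nil => exact congrArg φ h
  | cons e p ih =>
    rw [trace_cons, ← h.2.1]
    exact (trace_singleton_isEdgePath (he e h.1)).append (ih h.2.2)

end TwoSkeleton

/-! ### Corners and straight segments in a unit cube -/

lemma flipIf_flipIf (b c : Bool) (t : I) : flipIf b (flipIf c t) = flipIf (b ^^ c) t := by
  cases b <;> cases c <;> simp [flipIf]

@[simp] lemma flipIf_self (b : Bool) (t : I) : flipIf b (flipIf b t) = t := by
  cases b <;> simp [flipIf]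

@[simp] lemma flipIf_false (t : I) : flipIf false t = t := rfl

lemma flipIf_mem_Ioo (b : Bool) (t : I) : (0 < flipIf b t ∧ flipIf b t < 1) ↔ 0 < t ∧ t < 1 := by
  cases b
  · simp
  · simp only [flipIf, if_true, ← Subtype.coe_lt_coe, unitInterval.coe_symm_eq, Set.Icc.coe_zero,
      Set.Icc.coe_one]
    constructor <;> rintro ⟨h1, h2⟩ <;> constructor <;> linarith

lemma coe_flipIf (b : Bool) (t : I) : (flipIf b t : ℝ) = if b then 1 - (t : ℝ) else t := by
  cases b <;> simp [flipIf]

/-- The straight segment from `s` to `s'` in the unit interval. -/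
def unitLerp (s s' t : I) : I :=
  ⟨(1 - t) * s + t * s', by
    have := t.2; have := s.2; have := s'.2
    simp only [Set.mem_Icc] at *
    constructor
    · have : 0 ≤ (1 - (t : ℝ)) * s := mul_nonneg (by linarith) (by linarith)
      have : 0 ≤ (t : ℝ) * s' := mul_nonneg (by linarith) (by linarith)
      linarith
    · nlinarith⟩

lemma coe_unitLerp (s s' t : I) : (unitLerp s s' t : ℝ) = (1 - t) * s + t * s' := rfl

lemma continuous_unitLerp : Continuous fun p : I × I × I => unitLerp p.1 p.2.1 p.2.2 := by
  refine Continuous.subtype_mk ?_ _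
  fun_prop

lemma flipIf_unitLerp (b : Bool) (s s' t : I) :
    flipIf b (unitLerp s s' t) = unitLerp (flipIf b s) (flipIf b s') t := by
  apply Subtype.ext
  cases b
  · rfl
  · simp only [coe_flipIf, coe_unitLerp, if_true]; ring

@[simp] lemma unitLerp_self (s t : I) : unitLerp s s t = s := by
  apply Subtype.ext; rw [coe_unitLerp]; ring

section Lerp

variable {ι κ : Type}

/-- The straight segment from `x` to `y` in a unit cube. -/
def lerp (x y : ι → I) (t : I) : ι → I := fun i => unitLerp (x i) (y i) t

@[simp] lemma lerp_self (x : ι → I) (t : I) : lerp x x t = x := by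
  funext i; simp [lerp]

@[simp] lemma lerp_zero (x y : ι → I) : lerp x y 0 = x := by
  funext i; apply Subtype.ext; simp [lerp, coe_unitLerp]

@[simp] lemma lerp_one (x y : ι → I) : lerp x y 1 = y := by
  funext i; apply Subtype.ext; simp [lerp, coe_unitLerp]

lemma continuous_lerp :
    Continuous fun p : (ι → I) × (ι → I) × I => lerp p.1 p.2.1 p.2.2 := by
  refine continuous_pi fun i => ?_
  have h : Continuous fun p : (ι → I) × (ι → I) × I => (p.1 i, p.2.1 i, p.2.2) := by fun_prop
  exact continuous_unitLerp.comp h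

/-- The corner of the unit cube with coordinates `a`. -/
def corner (a : ι → Bool) : ι → I := fun i => if a i then 1 else 0

lemma corner_apply (a : ι → Bool) (i : ι) : corner a i = if a i then 1 else 0 := rfl

lemma flipIf_corner (b : Bool) (a : ι → Bool) (i : ι) :
    flipIf b (corner a i) = if (b ^^ a i) then 1 else 0 := by
  cases b <;> cases h : a i <;> simp [corner, flipIf, h]

lemma seg_eq_lerp (a b : ι → Bool) (t : I) :
    CubeComplex.seg a b t = lerp (corner a) (corner b) t := by
  funext i
  apply Subtype.ext
  cases ha : a i <;> cases hb : b i <;>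
    simp [CubeComplex.seg, lerp, corner, coe_unitLerp, ha, hb]

@[simp] lemma seg_zero (a b : ι → Bool) : CubeComplex.seg a b 0 = corner a := by
  rw [seg_eq_lerp, lerp_zero]

@[simp] lemma seg_one (a b : ι → Bool) : CubeComplex.seg a b 1 = corner b := by
  rw [seg_eq_lerp, lerp_one]

lemma seg_symm (a b : ι → Bool) (t : I) :
    CubeComplex.seg a b (unitInterval.symm t) = CubeComplex.seg b a t := by
  funext i
  cases ha : a i <;> cases hb : b i <;> simp [CubeComplex.seg, ha, hb]

end Lerp

namespace CubeComplex

open TwoSkeleton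

variable {K : CubeComplex.{u, v}}

/-! ### Faces of cubes -/

/-- The face of the cube `c` which contains the point `x` in its interior, written as a cube `cell`
of the complex, glued to the face by the injection `dir` of its coordinates into those of `c` and
the reflections `flip`. -/
structure Carrier (K : CubeComplex.{u, v}) (c : K.Cube) (x : K.Dir c → I) where
  cell : K.Cube
  dir : K.Dir cell → K.Dir c
  flip : K.Dir cell → Bool
  dir_injective : Function.Injective dir
  mem_range_dir : ∀ i, i ∈ Set.range dir ↔ 0 < x i ∧ x i < 1
  charMap_eq : ∀ y : K.Dir c → I, (∀ i, ¬(0 < x i ∧ x i < 1) → y i = x i) →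
    K.charMap c y = K.charMap cell fun k => flipIf (flip k) (y (dir k))

/-- Every point of a cube lies in the interior of a face of the cube. The face is found by passing
to a face of codimension one as long as some coordinate is `0` or `1`. -/
theorem nonempty_carrier (c : K.Cube) (x : K.Dir c → I) : Nonempty (K.Carrier c x) := by
  induction hn : Nat.card (K.Dir c) using Nat.strong_induction_on generalizing c with
  | _ n ih =>
    subst hn
    have := K.finite_dir c
    by_cases h : ∀ i, 0 < x i ∧ x i < 1
    · exact ⟨⟨c, id, fun _ => false, Function.injective_id, by simpa using h, fun y _ => rfl⟩⟩
    · obtain ⟨i, hi⟩ := not_forall.1 h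
      obtain ⟨ε, hε⟩ : ∃ ε : Bool, x i = if ε then 1 else 0 := by
        by_cases h0 : x i = 0
        · exact ⟨false, by simpa using h0⟩
        · refine ⟨true, ?_⟩
          have h1 := not_and.1 hi (unitInterval.pos_iff_ne_zero.2 h0)
          simpa using le_antisymm unitInterval.le_one' (not_lt.1 h1)
      obtain ⟨d, τ, f, hτ, hr, hd⟩ := K.exists_face c i ε
      have hcard : Nat.card (K.Dir d) < Nat.card (K.Dir c) := by
        have hns : ¬ Function.Surjective τ := fun hs => by
          have : i ∈ Set.range τ := hs i
          rw [hr] at this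
          exact this rfl
        have := Fintype.ofFinite (K.Dir c)
        have := Finite.of_injective τ hτ
        have := Fintype.ofFinite (K.Dir d)
        rw [Nat.card_eq_fintype_card, Nat.card_eq_fintype_card]
        exact Fintype.card_lt_of_injective_not_surjective τ hτ hns
      obtain ⟨C⟩ := ih _ hcard d (fun k => flipIf (f k) (x (τ k))) rfl
      refine ⟨⟨C.cell, τ ∘ C.dir, fun k => C.flip k ^^ f (C.dir k), hτ.comp C.dir_injective, ?_,
        ?_⟩⟩
      · intro j
        by_cases hj : j = i
        · subst hj
          refine iff_of_false ?_ hi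
          rintro ⟨k, hk⟩
          have : j ∈ Set.range τ := ⟨_, hk⟩
          rw [hr] at this
          exact this rfl
        · have : j ∈ Set.range τ := by rw [hr]; exact hj
          obtain ⟨k, rfl⟩ := this
          rw [← flipIf_mem_Ioo (f k), ← C.mem_range_dir k]
          constructor
          · rintro ⟨l, hl⟩
            exact ⟨l, hτ hl⟩
          · rintro ⟨l, rfl⟩
            exact ⟨l, rfl⟩
      · intro y hy
        rw [hd y (by rw [hy i hi, hε]), C.charMap_eq]
        · simp only [flipIf_flipIf]; rfl
        · intro k hk
          rw [flipIf_mem_Ioo] at hk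
          rw [hy _ hk]

namespace Carrier

variable {c : K.Cube} {x : K.Dir c → I} (C : K.Carrier c x)

/-- The coordinates in the cell `C.cell` of a point of the face. -/
def pull (y : K.Dir c → I) : K.Dir C.cell → I := fun k => flipIf (C.flip k) (y (C.dir k))

open Classical in
/-- The point of the face with given coordinates in the cell `C.cell`. -/
noncomputable def push (z : K.Dir C.cell → I) : K.Dir c → I := fun i =>
  if h : ∃ k, C.dir k = i then flipIf (C.flip h.choose) (z h.choose) else x i

lemma push_dir (z : K.Dir C.cell → I) (k : K.Dir C.cell) :
    C.push z (C.dir k) = flipIf (C.flip k) (z k) := by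
  have h : ∃ k', C.dir k' = C.dir k := ⟨k, rfl⟩
  rw [push, dif_pos h, C.dir_injective h.choose_spec]

lemma push_of_not (z : K.Dir C.cell → I) {i : K.Dir c} (hi : ¬(0 < x i ∧ x i < 1)) :
    C.push z i = x i := by
  rw [push, dif_neg]
  rwa [← C.mem_range_dir i] at hi

@[simp] lemma pull_push (z : K.Dir C.cell → I) : C.pull (C.push z) = z := by
  funext k
  rw [pull, push_dir, flipIf_self]

lemma push_pull {y : K.Dir c → I} (hy : ∀ i, ¬(0 < x i ∧ x i < 1) → y i = x i) :
    C.push (C.pull y) = y := by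
  funext i
  by_cases hi : 0 < x i ∧ x i < 1
  · obtain ⟨k, rfl⟩ := (C.mem_range_dir i).2 hi
    rw [push_dir, pull, flipIf_self]
  · rw [push_of_not _ _ hi, hy i hi]

lemma charMap_push (z : K.Dir C.cell → I) : K.charMap c (C.push z) = K.charMap C.cell z := by
  rw [C.charMap_eq _ fun i hi => C.push_of_not z hi]
  exact congrArg _ (C.pull_push z)

lemma charMap_pull {y : K.Dir c → I} (hy : ∀ i, ¬(0 < x i ∧ x i < 1) → y i = x i) :
    K.charMap C.cell (C.pull y) = K.charMap c y := (C.charMap_eq y hy).symm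

lemma pull_mem_Ioo (k : K.Dir C.cell) : 0 < C.pull x k ∧ C.pull x k < 1 := by
  rw [pull, flipIf_mem_Ioo]
  exact (C.mem_range_dir _).1 ⟨k, rfl⟩

lemma push_lerp (z w : K.Dir C.cell → I) (t : I) :
    C.push (lerp z w t) = lerp (C.push z) (C.push w) t := by
  funext i
  by_cases hi : 0 < x i ∧ x i < 1
  · obtain ⟨k, rfl⟩ := (C.mem_range_dir i).2 hi
    simp only [push_dir, lerp, flipIf_unitLerp]
  · simp only [lerp, push_of_not _ _ hi, unitLerp_self]

/-- A face of a cube with a corner of its cell: the corresponding corner of the cube. -/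
lemma exists_push_corner (a : K.Dir C.cell → Bool) : ∃ b, C.push (corner a) = corner b := by
  classical
  refine ⟨fun i => if C.push (corner a) i = 1 then true else false, funext fun i => ?_⟩
  have : C.push (corner a) i = 1 ∨ C.push (corner a) i = 0 := by
    by_cases hi : 0 < x i ∧ x i < 1
    · obtain ⟨k, rfl⟩ := (C.mem_range_dir i).2 hi
      rw [push_dir, flipIf_corner]
      split_ifs <;> simp
    · rw [push_of_not _ _ hi]
      by_cases h0 : x i = 0
      · exact .inr h0
      · have h1 := not_and.1 hi (unitInterval.pos_iff_ne_zero.2 h0)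
        exact .inl (le_antisymm unitInterval.le_one' (not_lt.1 h1))
  rcases this with h | h <;> simp [corner, h]

end Carrier

lemma IsVertex.eq_zero_or_one {c : K.Cube} {x : K.Dir c → I} (h : K.IsVertex (K.charMap c x))
    (i : K.Dir c) : x i = 0 ∨ x i = 1 := by
  obtain ⟨d, hd, y, hy⟩ := h
  obtain ⟨C⟩ := K.nonempty_carrier c x
  have := K.finite_dir d
  have hempty : IsEmpty (K.Dir d) := Finite.card_eq_zero_iff.1 hd
  rw [← C.charMap_pull (fun _ _ => rfl)] at hy
  have := K.open_disjoint _ _ _ _ (fun i => hempty.elim i) C.pull_mem_Ioo hy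
  subst this
  by_contra hi
  rw [not_or] at hi
  have h1 := (C.mem_range_dir i).2 ⟨unitInterval.pos_iff_ne_zero.2 hi.1,
    unitInterval.lt_one_iff_ne_one.2 hi.2⟩
  exact hempty.elim h1.choose

lemma isVertex_corner (c : K.Cube) (a : K.Dir c → Bool) : K.IsVertex (K.charMap c (corner a)) := by
  obtain ⟨C⟩ := K.nonempty_carrier c (corner a)
  have : IsEmpty (K.Dir C.cell) := ⟨fun k => by
    have := (C.mem_range_dir _).1 ⟨k, rfl⟩
    rw [corner_apply] at this
    split_ifs at this <;> simp at this⟩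
  exact ⟨C.cell, Nat.card_of_isEmpty, _, C.charMap_pull fun _ _ => rfl⟩

lemma IsVertex.exists_corner {p : K.Pt} (h : K.IsVertex p) :
    ∃ c, ∃ a : K.Dir c → Bool, K.charMap c (corner a) = p := by
  obtain ⟨c, hc, x, rfl⟩ := h
  have := K.finite_dir c
  have hempty : IsEmpty (K.Dir c) := Finite.card_eq_zero_iff.1 hc
  exact ⟨c, fun _ => false, congrArg _ (Subsingleton.elim _ _)⟩

lemma isClosed_iff {A : Set K.Pt} : IsClosed A ↔ ∀ c, IsClosed (K.charMap c ⁻¹' A) := by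
  rw [isClosed_iSup_iff]
  exact forall_congr' fun c => isClosed_coinduced

lemma isOpen_iff {A : Set K.Pt} : IsOpen A ↔ ∀ c, IsOpen (K.charMap c ⁻¹' A) := by
  rw [isOpen_iSup_iff]
  exact forall_congr' fun c => isOpen_coinduced

lemma continuous_charMap (c : K.Cube) : Continuous (K.charMap c) := by
  rw [continuous_def]
  exact fun A hA => isOpen_iff.1 hA c

/-- The vertices form a closed discrete set. -/
lemma isClosed_of_isVertex {A : Set K.Pt} (hA : ∀ p ∈ A, K.IsVertex p) : IsClosed A := by
  refine isClosed_iff.2 fun c => Set.Finite.isClosed ?_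
  have := K.finite_dir c
  have hfin : {x : K.Dir c → I | ∀ i, x i ∈ ({0, 1} : Set I)}.Finite :=
    Set.Finite.pi' fun _ => Set.toFinite _
  exact hfin.subset fun x hx i => by simpa using (hA _ hx).eq_zero_or_one i

/-! ### Height functions which are affine with slopes `±1` -/

/-- On every cube, `h` is the sum of an integer and of the coordinates with signs `±1`. -/
def IntegralHeight (K : CubeComplex.{u, v}) (h : K.Pt → ℝ) : Prop :=
  ∀ c, ∃ n : ℤ, ∃ ρ : K.Dir c → ℤ, (∀ i, ρ i = 1 ∨ ρ i = -1) ∧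
    ∀ x : K.Dir c → I, h (K.charMap c x) = n + ∑ᶠ i, (ρ i : ℝ) * x i

/-- A map `l` whose image is a monotone line, parametrized by the height. -/
structure IsLine (K : CubeComplex.{u, v}) (h : K.Pt → ℝ) (l : ℝ → K.Pt) : Prop where
  height : ∀ s, h (l s) = s
  exists_edge : ∀ n : ℤ, ∃ e, Nat.card (K.Dir e) = 1 ∧ ∃ ρ : Bool,
    ∀ t : I, l (n + t) = K.charMap e fun _ => flipIf ρ t

variable {h : K.Pt → ℝ}

lemma IsHeightFunction.exists_edge_eq (hh : K.IsHeightFunction h) {c : K.Cube}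
    (hc : Nat.card (K.Dir c) = 1) :
    ∃ n : ℤ, ∃ ρ : Bool, ∀ t : I, h (K.charMap c fun _ => flipIf ρ t) = n + t := by
  obtain ⟨n, hn⟩ := hh.edge c hc
  obtain ⟨A, hA⟩ := hh.affine c
  have := K.finite_dir c
  have : Subsingleton (K.Dir c) := (Finite.card_le_one_iff_subsingleton.1 hc.le)
  have hne : Nonempty (K.Dir c) := (Nat.card_pos_iff.1 (by omega : 0 < Nat.card (K.Dir c))).1
  have hform : ∀ t : I, h (K.charMap c fun _ => t) =
      (1 - t) * h (K.charMap c fun _ => 0) + t * h (K.charMap c fun _ => 1) := by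
    intro t
    rw [hA, hA, hA]
    have : (fun _ : K.Dir c => (t : ℝ)) =
        AffineMap.lineMap (fun _ => ((0 : I) : ℝ)) (fun _ => ((1 : I) : ℝ)) (t : ℝ) := by
      funext i; simp [AffineMap.lineMap_apply]
    rw [this, AffineMap.apply_lineMap, AffineMap.lineMap_apply]
    simp only [vsub_eq_sub, smul_eq_mul, vadd_eq_add]; ring
  have hall : ∀ x : K.Dir c → I, ∃ t : I, x = fun _ => t :=
    fun x => ⟨x hne.some, funext fun i => congrArg x (Subsingleton.elim _ _)⟩
  have hmem : ∀ t : I, h (K.charMap c fun _ => t) ∈ Set.Icc (n : ℝ) (n + 1) := fun t => by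
    rw [← hn]; exact ⟨_, ⟨_, rfl⟩, rfl⟩
  have h0 := hmem 0
  have h1 := hmem 1
  have hsurj : ∀ s ∈ Set.Icc (n : ℝ) (n + 1), ∃ t : I, h (K.charMap c fun _ => t) = s := by
    intro s hs
    rw [← hn] at hs
    obtain ⟨_, ⟨x, rfl⟩, rfl⟩ := hs
    obtain ⟨t, rfl⟩ := hall x
    exact ⟨t, rfl⟩
  obtain ⟨t, ht⟩ := hsurj n ⟨le_rfl, by linarith⟩
  obtain ⟨s, hs⟩ := hsurj (n + 1) ⟨by linarith, le_rfl⟩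
  rw [hform] at ht hs
  have ht' := t.2
  have hs' := s.2
  simp only [Set.mem_Icc] at h0 h1 ht' hs'
  set α := h (K.charMap c fun _ => 0)
  set β := h (K.charMap c fun _ => 1)
  rcases le_total α β with hαβ | hαβ
  · refine ⟨n, false, fun r => ?_⟩
    have e1 : α = n := by nlinarith
    have e2 : β = n + 1 := by nlinarith
    simp only [flipIf_false]
    rw [hform, e1, e2]; ring
  · refine ⟨n, true, fun r => ?_⟩
    have e1 : β = n := by nlinarith
    have e2 : α = n + 1 := by nlinarith
    rw [hform, e1, e2, coe_flipIf]; simp only [if_true]; ring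

/-- The inverse of the height on a monotone line traverses one edge between any two consecutive
integers. -/
theorem IsMonotoneLine.exists_isLine (hh : K.IsHeightFunction h) {L : Set K.Pt}
    (hL : K.IsMonotoneLine h L) :
    ∃ l, K.IsLine h l ∧ ∀ p ∈ L, l (h p) = p := by
  obtain ⟨⟨𝒞, hdim, hunion⟩, hhomeo⟩ := hL
  let e := hhomeo.homeomorph
  let l : ℝ → K.Pt := fun s => (e.symm s).1
  have hcont : Continuous l := continuous_subtype_val.comp e.symm.continuous
  have hheight : ∀ s, h (l s) = s := fun s => e.apply_symm_apply s
  have hinv : ∀ p ∈ L, l (h p) = p := fun p hp => congrArg Subtype.val (e.symm_apply_apply ⟨p, hp⟩)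
  have hmem : ∀ s, l s ∈ L := fun s => (e.symm s).2
  refine ⟨l, ⟨hheight, fun n => ?_⟩, hinv⟩
  by_cases hex : ∃ c ∈ 𝒞, Nat.card (K.Dir c) = 1 ∧ ∃ ρ : Bool,
    ∀ t : I, h (K.charMap c fun _ => flipIf ρ t) = n + t
  · obtain ⟨c, hc, hc1, ρ, hρ⟩ := hex
    refine ⟨c, hc1, ρ, fun t => ?_⟩
    rw [← hρ, hinv]
    rw [hunion]
    exact Set.mem_biUnion hc ⟨_, rfl⟩
  -- Otherwise the line would consist of vertices above `(n, n + 1)`, which form a discrete set.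
  · exfalso
    have hvert : ∀ p ∈ l '' Set.Ioo (n : ℝ) (n + 1), K.IsVertex p := by
      rintro _ ⟨s, hs, rfl⟩
      have := hmem s
      rw [hunion] at this
      obtain ⟨c, hc, x, hx⟩ := Set.mem_iUnion₂.1 this
      rcases Nat.le_one_iff_eq_zero_or_eq_one.1 (hdim c hc) with h0 | h1
      · exact ⟨c, h0, x, hx⟩
      · exfalso
        obtain ⟨m, ρ, hm⟩ := hh.exists_edge_eq h1
        have := K.finite_dir c
        have : Subsingleton (K.Dir c) := (Finite.card_le_one_iff_subsingleton.1 h1.le)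
        have hne : Nonempty (K.Dir c) := (Nat.card_pos_iff.1 (by omega : 0 < Nat.card (K.Dir c))).1
        have hx' : x = fun _ => flipIf ρ (flipIf ρ (x hne.some)) :=
          funext fun i => by rw [flipIf_self]; exact congrArg x (Subsingleton.elim _ _)
        have h2 := hheight s
        rw [← hx, hx', hm] at h2
        have h3 := (flipIf ρ (x hne.some)).2
        simp only [Set.mem_Icc, Set.mem_Ioo] at h3 hs
        have h4 : (m : ℝ) < n + 1 := by linarith
        have h5 : (n : ℝ) < m + 1 := by linarith
        have h6 : m = n := by
          have h4' : m < n + 1 := by exact_mod_cast h4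
          have h5' : n < m + 1 := by exact_mod_cast h5
          omega
        subst h6
        exact hex ⟨c, hc, h1, ρ, hm⟩
    have hcl := (isClosed_of_isVertex hvert).preimage hcont
    rw [Set.preimage_image_eq _ (Function.LeftInverse.injective hheight)] at hcl
    have h1 := hcl.closure_eq
    rw [closure_Ioo (by linarith : (n : ℝ) ≠ n + 1)] at h1
    have h2 : (n : ℝ) ∈ Set.Ioo (n : ℝ) (n + 1) := by
      rw [← h1]; exact ⟨le_rfl, by linarith⟩
    exact lt_irrefl _ h2.1

theorem Admissible.exists_isLine (hh : K.IsHeightFunction h) (ha : K.Admissible h) {p : K.Pt}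
    (hp : K.IsVertex p) : ∃ l, K.IsLine h l ∧ l (h p) = p := by
  obtain ⟨L, hL, hpL⟩ := ha p hp
  obtain ⟨l, hl, h1⟩ := hL.exists_isLine hh
  exact ⟨l, hl, h1 p hpL⟩

/-- The points of non-integral height on a line lie in open edges, so that they are not vertices. -/
lemma IsLine.exists_int {l : ℝ → K.Pt} (hl : K.IsLine h l) {p : K.Pt} (hp : K.IsVertex p)
    (hlp : l (h p) = p) : ∃ n : ℤ, h p = n := by
  obtain ⟨e, he, ρ, hρ⟩ := hl.exists_edge ⌊h p⌋
  have hne : Nonempty (K.Dir e) := (Nat.card_pos_iff.1 (by omega : 0 < Nat.card (K.Dir e))).1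
  let t : I := ⟨Int.fract (h p), Int.fract_nonneg _, (Int.fract_lt_one _).le⟩
  have ht := hρ t
  rw [show ((⌊h p⌋ : ℝ) + t) = h p from Int.floor_add_fract _, hlp] at ht
  rw [ht] at hp
  have h01 := hp.eq_zero_or_one hne.some
  have ht1 : (t : ℝ) < 1 := Int.fract_lt_one _
  have h2 : ¬ (0 < t ∧ t < 1) := by
    rw [← flipIf_mem_Ioo ρ]
    rcases h01 with h01 | h01 <;> rw [h01] <;> simp
  have h3 : t = 0 := by
    by_contra h0
    exact h2 ⟨unitInterval.pos_iff_ne_zero.2 h0, ht1⟩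
  refine ⟨⌊h p⌋, ?_⟩
  have h4 : Int.fract (h p) = 0 := congrArg Subtype.val h3
  have h5 := Int.floor_add_fract (h p)
  rw [h4, add_zero] at h5
  exact h5.symm

/-- In an admissible complex the heights of the vertices are integers, because every vertex lies on
a line. Along the edges of a cube the height has slope `±1`, and it is affine on the cube. -/
theorem IsHeightFunction.integralHeight (hh : K.IsHeightFunction h) (ha : K.Admissible h) :
    K.IntegralHeight h := by
  classical
  intro c
  obtain ⟨A, hA⟩ := hh.affine c
  have := K.finite_dir c
  have := Fintype.ofFinite (K.Dir c)
  have hv := isVertex_corner c fun _ => false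
  obtain ⟨l, hl, hlp⟩ := ha.exists_isLine hh hv
  obtain ⟨n, hn⟩ := hl.exists_int hv hlp
  -- the slope in the direction `i`, read off the edge of `c` in this direction
  have hslope : ∀ i, ∃ ρ : ℤ, (ρ = 1 ∨ ρ = -1) ∧
      A.linear (fun j => if i = j then 1 else 0) = ρ := by
    intro i
    let y : I → K.Dir c → I := fun s j => if i = j then s else 0
    let half : I := ⟨1 / 2, by norm_num, by norm_num⟩
    have hhalf : 0 < half ∧ half < 1 := by
      constructor <;> rw [← Subtype.coe_lt_coe] <;> norm_num [half]
    obtain ⟨C⟩ := K.nonempty_carrier c (y half)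
    have hcard : Nat.card (K.Dir C.cell) = 1 := by
      rw [Nat.card_congr (Equiv.ofInjective _ C.dir_injective), Nat.card_eq_one_iff_unique]
      have : Set.range C.dir = {i} := by
        ext j
        rw [C.mem_range_dir, Set.mem_singleton_iff]
        by_cases hj : i = j
        · simp [y, hj, hhalf]
        · simp [y, hj, Ne.symm hj]
      rw [this]
      exact ⟨inferInstance, inferInstance⟩
    obtain ⟨m, ρ, hm⟩ := hh.exists_edge_eq hcard
    have hne : Nonempty (K.Dir C.cell) :=
      (Nat.card_pos_iff.1 (by omega : 0 < Nat.card (K.Dir C.cell))).1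
    have hsub : Subsingleton (K.Dir C.cell) := by
      have := K.finite_dir C.cell
      exact Finite.card_le_one_iff_subsingleton.1 hcard.le
    obtain ⟨k⟩ := hne
    have hdir : C.dir k = i := by
      by_contra hj
      have := (C.mem_range_dir _).1 ⟨k, rfl⟩
      simp [y, Ne.symm hj] at this
    have hy : ∀ s, h (K.charMap c (y s)) = m + flipIf ρ (flipIf (C.flip k) s) := by
      intro s
      rw [C.charMap_eq, ← hm]
      · congr 2
        funext k'
        rw [Subsingleton.elim k' k, hdir, flipIf_self]
        simp [y]
      · intro j hj
        have : i ≠ j := by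
          rintro rfl
          simp [y, hhalf] at hj
        simp [y, this]
    have h0 := hy 0
    have h1 := hy 1
    have hlin : A.linear (fun j => if i = j then 1 else 0) =
        h (K.charMap c (y 1)) - h (K.charMap c (y 0)) := by
      rw [hA, hA, ← vsub_eq_sub, ← A.linearMap_vsub]
      congr 1
      funext j
      by_cases hj : i = j <;> simp [y, hj]
    rw [hlin, h0, h1, coe_flipIf, coe_flipIf, coe_flipIf, coe_flipIf]
    refine ⟨if (ρ ^^ C.flip k) then -1 else 1, ?_, ?_⟩
    · split_ifs <;> simp
    · cases ρ <;> cases C.flip k <;> simp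
  choose ρ hρ1 hρ2 using hslope
  refine ⟨n, ρ, hρ1, fun x => ?_⟩
  rw [finsum_eq_sum_of_fintype, ← hn, hA, hA, A.decomp, Pi.add_apply, Pi.add_apply]
  simp only [corner, Bool.false_eq_true, if_false, Set.Icc.coe_zero]
  rw [A.linear.pi_apply_eq_sum_univ (fun i => (x i : ℝ)),
    show (fun _ : K.Dir c => (0 : ℝ)) = 0 from rfl, A.linear.map_zero, zero_add, add_comm]
  congr 1
  refine Finset.sum_congr rfl fun i _ => ?_
  rw [hρ2, smul_eq_mul, mul_comm]

end CubeComplex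

namespace CubeComplex

open TwoSkeleton

variable {K : CubeComplex.{u, v}} {h : K.Pt → ℝ} {L : CubeComplex.{u₁, v₁}} {k : L.Pt → ℝ}

namespace IntegralHeight

lemma height_lerp (hK : K.IntegralHeight h) (c : K.Cube) (x y : K.Dir c → I) (t : I) :
    h (K.charMap c (lerp x y t)) =
      (1 - t) * h (K.charMap c x) + t * h (K.charMap c y) := by
  obtain ⟨n, ρ, -, hρ⟩ := hK c
  have := K.finite_dir c
  have := Fintype.ofFinite (K.Dir c)
  simp only [hρ, finsum_eq_sum_of_fintype, lerp, coe_unitLerp]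
  rw [mul_add, mul_add, Finset.mul_sum, Finset.mul_sum,
    show ∀ A B C D : ℝ, A + B + (C + D) = (A + C) + (B + D) by intros; ring,
    ← Finset.sum_add_distrib]
  congr 1
  · ring
  · exact Finset.sum_congr rfl fun i _ => by ring

lemma height_seg (hK : K.IntegralHeight h) (c : K.Cube) (a b : K.Dir c → Bool) (t : I) :
    h (K.charMap c (seg a b t)) =
      (1 - t) * h (K.charMap c (corner a)) + t * h (K.charMap c (corner b)) := by
  rw [seg_eq_lerp, hK.height_lerp]

lemma exists_int (hK : K.IntegralHeight h) (c : K.Cube) (a : K.Dir c → Bool) :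
    ∃ n : ℤ, h (K.charMap c (corner a)) = n := by
  obtain ⟨n, ρ, -, hρ⟩ := hK c
  have := K.finite_dir c
  have := Fintype.ofFinite (K.Dir c)
  refine ⟨n + ∑ i, ρ i * (if a i then 1 else 0), ?_⟩
  rw [hρ, finsum_eq_sum_of_fintype]
  push_cast
  congr 1
  refine Finset.sum_congr rfl fun i _ => ?_
  rw [corner_apply]
  split_ifs <;> simp

lemma _root_.CubeComplex.IsVertex.exists_height_eq (hK : K.IntegralHeight h) {p : K.Pt}
    (hp : K.IsVertex p) : ∃ n : ℤ, h p = n := by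
  obtain ⟨c, a, rfl⟩ := hp.exists_corner
  exact hK.exists_int c a

/-- Adjacent corners of a cube have heights which differ by one. -/
lemma step (hK : K.IntegralHeight h) {c : K.Cube} {a b : K.Dir c → Bool}
    (hab : {i | a i ≠ b i}.ncard = 1) :
    h (K.charMap c (corner b)) = h (K.charMap c (corner a)) + 1 ∨
      h (K.charMap c (corner a)) = h (K.charMap c (corner b)) + 1 := by
  obtain ⟨n, ρ, hρ1, hρ⟩ := hK c
  have := K.finite_dir c
  have := Fintype.ofFinite (K.Dir c)
  obtain ⟨i, hi⟩ := Set.ncard_eq_one.1 hab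
  have hne : a i ≠ b i := by
    have : i ∈ ({i} : Set (K.Dir c)) := rfl
    rwa [← hi] at this
  have hdiff : h (K.charMap c (corner b)) - h (K.charMap c (corner a)) =
      (ρ i : ℝ) * (corner b i - corner a i) := by
    rw [hρ, hρ, finsum_eq_sum_of_fintype, finsum_eq_sum_of_fintype, add_sub_add_left_eq_sub,
      ← Finset.sum_sub_distrib, Finset.sum_eq_single i]
    · ring
    · intro j _ hj
      have : a j = b j := by
        by_contra hj'
        have : j ∈ {i | a i ≠ b i} := hj'
        rw [hi] at this
        exact hj this
      simp [corner, this]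
    · simp
  have : ((ρ i : ℝ) * (corner b i - corner a i) = 1) ∨
      ((ρ i : ℝ) * (corner b i - corner a i) = -1) := by
    rcases hρ1 i with h1 | h1 <;> rw [h1] <;> cases ha : a i <;> cases hb : b i <;>
      simp_all [corner]
  rcases this with h1 | h1
  · left; linarith
  · right; linarith

theorem prod (hK : K.IntegralHeight h) (hL : L.IntegralHeight k) :
    (K.prod L).IntegralHeight (prodHeight h k) := by
  rintro ⟨c, d⟩
  obtain ⟨n, ρ, hρ1, hρ⟩ := hK c
  obtain ⟨m, τ, hτ1, hτ⟩ := hL d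
  have := K.finite_dir c
  have := Fintype.ofFinite (K.Dir c)
  have := L.finite_dir d
  have := Fintype.ofFinite (L.Dir d)
  refine ⟨n + m, Sum.elim ρ τ, ?_, fun x => ?_⟩
  · rintro (i | i)
    · exact hρ1 i
    · exact hτ1 i
  · change h (K.charMap c _) + k (L.charMap d _) = _
    change _ = _ + ∑ᶠ i : K.Dir c ⊕ L.Dir d, _
    rw [hρ, hτ, finsum_eq_sum_of_fintype, finsum_eq_sum_of_fintype, finsum_eq_sum_of_fintype,
      Fintype.sum_sum_type]
    simp only [Sum.elim_inl, Sum.elim_inr]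
    push_cast
    ring

end IntegralHeight

/-! ### The sliced 2-skeleton -/

/-- The directed edge from the corner `a` to the corner `b`. -/
def edge (K : CubeComplex.{u, v}) (c : K.Cube) (a b : K.Dir c → Bool) : I → K.Pt :=
  fun t => K.charMap c (seg a b t)

@[simp] lemma edge_zero (c : K.Cube) (a b : K.Dir c → Bool) :
    K.edge c a b 0 = K.charMap c (corner a) := by simp [edge]

@[simp] lemma edge_one (c : K.Cube) (a b : K.Dir c → Bool) :
    K.edge c a b 1 = K.charMap c (corner b) := by simp [edge]

@[simp] lemma rev_edge (c : K.Cube) (a b : K.Dir c → Bool) :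
    rev (K.edge c a b) = K.edge c b a := by
  funext t
  simp only [rev, edge, seg_symm]

lemma slicedAdj_iff {c : K.Cube} {a b : K.Dir c → Bool} : K.SlicedAdj h c a b ↔
    {i | a i ≠ b i}.ncard = 1 ∨ ({i | a i ≠ b i}.ncard = 2 ∧
      h (K.charMap c (corner a)) = h (K.charMap c (corner b))) := by
  rw [SlicedAdj, seg_zero, seg_one]

lemma SlicedAdj.symm {c : K.Cube} {a b : K.Dir c → Bool} (hab : K.SlicedAdj h c a b) :
    K.SlicedAdj h c b a := by
  rw [slicedAdj_iff] at hab ⊢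
  simp only [ne_comm (a := b _)]
  rcases hab with h1 | ⟨h1, h2⟩
  · exact .inl h1
  · exact .inr ⟨h1, h2.symm⟩

lemma SlicedAdj.exists_ne {c : K.Cube} {a b : K.Dir c → Bool} (hab : K.SlicedAdj h c a b) :
    ∃ i, a i ≠ b i := by
  have : {i | a i ≠ b i}.ncard ≠ 0 := by
    rcases hab with h1 | ⟨h1, -⟩ <;> omega
  obtain ⟨i, hi⟩ := Set.nonempty_of_ncard_ne_zero this
  exact ⟨i, hi⟩

lemma mem_sliced_edges {e : I → K.Pt} : e ∈ (K.sliced h).edges ↔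
    ∃ c, ∃ a b : K.Dir c → Bool, K.SlicedAdj h c a b ∧ e = K.edge c a b := Iff.rfl

lemma edge_mem_sliced {c : K.Cube} {a b : K.Dir c → Bool} (hab : K.SlicedAdj h c a b) :
    K.edge c a b ∈ (K.sliced h).edges := ⟨c, a, b, hab, rfl⟩

lemma proper_sliced : (K.sliced h).Proper where
  rev_mem := by
    rintro _ ⟨c, a, b, hab, rfl⟩
    exact ⟨c, b, a, hab.symm, rev_edge c a b⟩
  closed := by
    rintro _ ⟨c, a, b, d, -, -, -, rfl⟩ p q ⟨-, h1, -, -, -, -, h2⟩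
    simp only [seg_zero] at h1
    rw [← h1, ← (show _ = q from h2)]
    simp

lemma proper_slicedZeroLevel : (K.slicedZeroLevel h).Proper where
  rev_mem := by
    rintro e ⟨he, h0⟩
    exact ⟨proper_sliced.rev_mem e he, fun t => h0 _⟩
  closed := by
    rintro r ⟨hr, -⟩ p q hpq
    refine proper_sliced.closed r hr p q ?_
    have : ∀ (r : List (I → K.Pt)) p, (K.slicedZeroLevel h).IsEdgePath p r q →
        (K.sliced h).IsEdgePath p r q := by
      intro r
      induction r with
      | nil => exact fun p hp => hp
      | cons e r ih => exact fun p hp => ⟨hp.1.1, hp.2.1, ih _ hp.2.2⟩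
    exact this r p hpq

/-- The edges of the sliced structure are non-constant: their interior lies in an open cube, where
the characteristic map is injective. -/
lemma nonconst_sliced : (K.sliced h).Nonconst := by
  rintro _ ⟨c, a, b, hab, rfl⟩
  obtain ⟨i, hi⟩ := hab.exists_ne
  by_contra! hcon
  let t₁ : I := ⟨1 / 2, by norm_num, by norm_num⟩
  let t₂ : I := ⟨1 / 3, by norm_num, by norm_num⟩
  have ht₁ : 0 < t₁ ∧ t₁ < 1 := by
    constructor <;> rw [← Subtype.coe_lt_coe] <;> norm_num [t₁]
  have ht₂ : 0 < t₂ ∧ t₂ < 1 := by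
    constructor <;> rw [← Subtype.coe_lt_coe] <;> norm_num [t₂]
  have hseg : ∀ t : I, (0 < t ∧ t < 1) → ∀ j,
      (0 < seg a b t j ∧ seg a b t j < 1) ↔ a j ≠ b j := by
    intro t ht j
    have := flipIf_mem_Ioo true t
    simp only [flipIf, if_true] at this
    cases ha : a j <;> cases hb : b j <;> simp [seg, ha, hb, ht, this]
  have hagree : ∀ j, ¬(0 < seg a b t₁ j ∧ seg a b t₁ j < 1) → seg a b t₂ j = seg a b t₁ j := by
    intro j hj
    rw [hseg t₁ ht₁, not_not] at hj
    cases hb : b j <;> simp [seg, hj, hb]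
  obtain ⟨C⟩ := K.nonempty_carrier c (seg a b t₁)
  have h1 : K.charMap C.cell (C.pull (seg a b t₁)) = K.charMap C.cell (C.pull (seg a b t₂)) := by
    rw [C.charMap_pull hagree, C.charMap_pull fun _ _ => rfl, hcon t₁, hcon t₂]
  have h2 := K.open_injective _ _ _ C.pull_mem_Ioo (fun l => by
    rw [Carrier.pull, flipIf_mem_Ioo, hseg t₂ ht₂, ← hseg t₁ ht₁, ← C.mem_range_dir]
    exact ⟨l, rfl⟩) h1
  obtain ⟨l, rfl⟩ := (C.mem_range_dir i).2 ((hseg t₁ ht₁ i).2 hi)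
  have h3 := congrArg (flipIf (C.flip l)) (congrFun h2 l)
  simp only [Carrier.pull, flipIf_self] at h3
  have h4 := congrArg (Subtype.val) h3
  revert hi h4
  generalize C.dir l = i
  intro hi h4
  cases ha : a i <;> cases hb : b i <;> simp [seg, ha, hb, t₁, t₂] at hi h4

lemma IsVertex.of_mem_edges {e : I → K.Pt} (he : e ∈ (K.sliced h).edges) : K.IsVertex (e 0) := by
  obtain ⟨c, a, b, -, rfl⟩ := he
  simpa using isVertex_corner c a

lemma IsVertex.of_mem_edges' {e : I → K.Pt} (he : e ∈ (K.sliced h).edges) : K.IsVertex (e 1) := by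
  simpa using IsVertex.of_mem_edges (proper_sliced.rev_mem e he)

lemma IsVertex.of_isEdgePath {p q : K.Pt} {r : List (I → K.Pt)}
    (hr : (K.sliced h).IsEdgePath p r q) (hp : K.IsVertex p) : K.IsVertex q := by
  induction r generalizing p with
  | nil => exact (show p = q from hr) ▸ hp
  | cons e r ih => exact ih hr.2.2 (IsVertex.of_mem_edges' hr.1)

lemma SlicedAdj.height (hK : K.IntegralHeight h) {c : K.Cube} {a b : K.Dir c → Bool}
    (hab : K.SlicedAdj h c a b) :
    h (K.charMap c (corner b)) = h (K.charMap c (corner a)) ∨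
    h (K.charMap c (corner b)) = h (K.charMap c (corner a)) + 1 ∨
      h (K.charMap c (corner a)) = h (K.charMap c (corner b)) + 1 := by
  rcases slicedAdj_iff.1 hab with h1 | h1
  · exact .inr (hK.step h1)
  · exact .inl h1.2.symm

/-- A triangle of the sliced structure, as a homotopy between two of its sides and the third. -/
lemma homotopicLE_sliced_triangle {c : K.Cube} {a b d : K.Dir c → Bool}
    (hab : K.SlicedAdj h c a b) (hbd : K.SlicedAdj h c b d) (had : K.SlicedAdj h c a d) :
    (K.sliced h).HomotopicLE (K.charMap c (corner a)) (K.charMap c (corner d))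
      [K.edge c a b, K.edge c b d] [K.edge c a d] 1 := by
  refine homotopicLE_of_triangle proper_sliced ?_ (edge_mem_sliced hab) (edge_mem_sliced hbd)
    (edge_mem_sliced had) (by simp) (by simp) (by simp) (by simp)
  exact ⟨c, a, b, d, hab, hbd, had.symm, by rw [rev_edge]; rfl⟩

end CubeComplex

namespace CubeComplex

open TwoSkeleton

variable {K : CubeComplex.{u, v}} {h : K.Pt → ℝ} {L : CubeComplex.{u₁, v₁}} {k : L.Pt → ℝ}
  {M : CubeComplex.{u₂, v₂}} {m : M.Pt → ℝ}

/-! ### Maps between sliced 2-skeleta -/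

/-- A criterion for being a morphism: above every interval `[n, n + 1]`, the map sends the part of
every cube to a cube, and the edges in this part to edges. -/
lemma isMorphism_of_slabs (hK : K.IntegralHeight h) {φ : K.Pt → M.Pt}
    (hφ : ∀ (c : K.Cube) (n : ℤ), ∃ (c' : M.Cube) (β : (K.Dir c → Bool) → (M.Dir c' → Bool)),
      ∀ a b, (h (K.charMap c (corner a)) = n ∨ h (K.charMap c (corner a)) = n + 1) →
        (h (K.charMap c (corner b)) = n ∨ h (K.charMap c (corner b)) = n + 1) →
        K.SlicedAdj h c a b →
        M.SlicedAdj m c' (β a) (β b) ∧ φ ∘ K.edge c a b = M.edge c' (β a) (β b)) :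
    (K.sliced h).IsMorphism (M.sliced m) φ where
  edges := by
    rintro _ ⟨c, a, b, hab, rfl⟩
    obtain ⟨n, hn⟩ := hK.exists_int c a
    obtain ⟨n', hn'⟩ := hK.exists_int c b
    obtain ⟨c', β, hβ⟩ := hφ c (min n n')
    have h1 : (n' = n ∨ n' = n + 1 ∨ n = n' + 1) := by
      have := hab.height hK
      rw [hn, hn'] at this
      exact_mod_cast this
    obtain ⟨h2, h3⟩ := hβ a b
      (by rw [hn]; norm_cast; omega) (by rw [hn']; norm_cast; omega) hab
    exact ⟨c', _, _, h2, h3⟩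
  faces := by
    rintro _ ⟨c, a, b, d, hab, hbd, hda, rfl⟩
    obtain ⟨n₁, hn₁⟩ := hK.exists_int c a
    obtain ⟨n₂, hn₂⟩ := hK.exists_int c b
    obtain ⟨n₃, hn₃⟩ := hK.exists_int c d
    obtain ⟨c', β, hβ⟩ := hφ c (min n₁ (min n₂ n₃))
    have h1 : (n₂ = n₁ ∨ n₂ = n₁ + 1 ∨ n₁ = n₂ + 1) := by
      have := hab.height hK
      rw [hn₁, hn₂] at this
      exact_mod_cast this
    have h2 : (n₃ = n₂ ∨ n₃ = n₂ + 1 ∨ n₂ = n₃ + 1) := by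
      have := hbd.height hK
      rw [hn₂, hn₃] at this
      exact_mod_cast this
    have h3 : (n₁ = n₃ ∨ n₁ = n₃ + 1 ∨ n₃ = n₁ + 1) := by
      have := hda.height hK
      rw [hn₁, hn₃] at this
      exact_mod_cast this
    have ha := (by rw [hn₁]; norm_cast; omega :
      h (K.charMap c (corner a)) = (min n₁ (min n₂ n₃) : ℤ) ∨
      h (K.charMap c (corner a)) = (min n₁ (min n₂ n₃) : ℤ) + 1)
    have hb := (by rw [hn₂]; norm_cast; omega :
      h (K.charMap c (corner b)) = (min n₁ (min n₂ n₃) : ℤ) ∨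
      h (K.charMap c (corner b)) = (min n₁ (min n₂ n₃) : ℤ) + 1)
    have hd := (by rw [hn₃]; norm_cast; omega :
      h (K.charMap c (corner d)) = (min n₁ (min n₂ n₃) : ℤ) ∨
      h (K.charMap c (corner d)) = (min n₁ (min n₂ n₃) : ℤ) + 1)
    refine ⟨c', β a, β b, β d, (hβ a b ha hb hab).1, (hβ b d hb hd hbd).1, (hβ d a hd ha hda).1, ?_⟩
    change [φ ∘ K.edge c a b, φ ∘ K.edge c b d, φ ∘ K.edge c d a] = _
    rw [(hβ a b ha hb hab).2, (hβ b d hb hd hbd).2, (hβ d a hd ha hda).2]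
    rfl

lemma _root_.TwoSkeleton.IsMorphism.to_zeroLevel {P : Type*} {S : TwoSkeleton P} {φ : P → M.Pt}
    (hφ : S.IsMorphism (M.sliced m) φ) (h0 : ∀ p, m (φ p) = 0) :
    S.IsMorphism (M.slicedZeroLevel m) φ where
  edges e he := ⟨hφ.edges e he, fun _ => h0 _⟩
  faces r hr := ⟨hφ.faces r hr, by
    intro e he t
    obtain ⟨e, -, rfl⟩ := List.mem_map.1 he
    exact h0 _⟩

lemma ncard_comp_equiv {ι κ : Type} (τ : κ ≃ ι) (a b : ι → Bool) :
    {i | a (τ i) ≠ b (τ i)}.ncard = {i | a i ≠ b i}.ncard := by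
  have : {i | a i ≠ b i} = τ '' {i | a (τ i) ≠ b (τ i)} := by
    ext i
    constructor
    · intro hi
      exact ⟨τ.symm i, by simpa using hi, by simp⟩
    · rintro ⟨j, hj, rfl⟩
      exact hj
  rw [this, Set.ncard_image_of_injective _ τ.injective]

/-- A map which sends every cube isometrically to a cube is a morphism. -/
lemma isMorphism_of_equiv (hK : K.IntegralHeight h) {φ : K.Pt → M.Pt} (h0 : ∀ p, m (φ p) = h p)
    (hφ : ∀ c, ∃ (c' : M.Cube) (τ : M.Dir c' ≃ K.Dir c), ∀ x,
      φ (K.charMap c x) = M.charMap c' fun i => x (τ i)) :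
    (K.sliced h).IsMorphism (M.sliced m) φ := by
  refine isMorphism_of_slabs hK fun c _ => ?_
  obtain ⟨c', τ, hτ⟩ := hφ c
  refine ⟨c', fun a i => a (τ i), fun a b _ _ hab => ⟨?_, ?_⟩⟩
  · have hcorner : ∀ a : K.Dir c → Bool, m (M.charMap c' (corner fun i => a (τ i))) =
        h (K.charMap c (corner a)) := fun a => by
      rw [← h0, hτ]; rfl
    rw [slicedAdj_iff] at hab ⊢
    rwa [ncard_comp_equiv, hcorner, hcorner]
  · funext t
    exact hτ _

/-! ### Edges of a product -/

lemma ncard_sum {ι κ : Type} [Finite ι] [Finite κ] (a b : ι ⊕ κ → Bool) :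
    {i | a i ≠ b i}.ncard = {i | a (.inl i) ≠ b (.inl i)}.ncard +
      {i | a (.inr i) ≠ b (.inr i)}.ncard := by
  have : {i | a i ≠ b i} = Sum.inl '' {i | a (.inl i) ≠ b (.inl i)} ∪
      Sum.inr '' {i | a (.inr i) ≠ b (.inr i)} := by
    ext (i | i) <;> simp
  rw [this, Set.ncard_union_eq, Set.ncard_image_of_injective _ Sum.inl_injective,
    Set.ncard_image_of_injective _ Sum.inr_injective]
  rw [Set.disjoint_left]
  rintro _ ⟨i, -, rfl⟩ ⟨j, -, hj⟩
  cases hj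

lemma ncard_ne_self {ι : Type} (a : ι → Bool) : {i | a i ≠ a i}.ncard = 0 := by simp

lemma ncard_ne_eq_zero {ι : Type} [Finite ι] {a b : ι → Bool} (hab : {i | a i ≠ b i}.ncard = 0) :
    a = b := by
  rw [Set.ncard_eq_zero] at hab
  funext i
  by_contra hi
  have : i ∈ {i | a i ≠ b i} := hi
  rw [hab] at this
  exact this

lemma slicedAdj_prod_iff {c : K.Cube} {d : L.Cube} {a b : K.Dir c → Bool} {a' b' : L.Dir d → Bool} :
    (K.prod L).SlicedAdj (prodHeight h k) (c, d) (Sum.elim a a') (Sum.elim b b') ↔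
      {i | a i ≠ b i}.ncard + {i | a' i ≠ b' i}.ncard = 1 ∨
      ({i | a i ≠ b i}.ncard + {i | a' i ≠ b' i}.ncard = 2 ∧
        h (K.charMap c (corner a)) + k (L.charMap d (corner a')) =
        h (K.charMap c (corner b)) + k (L.charMap d (corner b'))) := by
  have := K.finite_dir c
  have := L.finite_dir d
  refine slicedAdj_iff.trans ?_
  change ({i : K.Dir c ⊕ L.Dir d | Sum.elim a a' i ≠ Sum.elim b b' i}.ncard = 1 ∨
    ({i : K.Dir c ⊕ L.Dir d | Sum.elim a a' i ≠ Sum.elim b b' i}.ncard = 2 ∧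
      h (K.charMap c (corner a)) + k (L.charMap d (corner a')) =
        h (K.charMap c (corner b)) + k (L.charMap d (corner b')))) ↔ _
  rw [ncard_sum]
  rfl

lemma edge_prod (c : K.Cube) (d : L.Cube) (a b : K.Dir c → Bool) (a' b' : L.Dir d → Bool) :
    (K.prod L).edge (c, d) (Sum.elim a a') (Sum.elim b b') =
      fun t => (K.edge c a b t, L.edge d a' b' t) := rfl

@[simp] lemma seg_self {ι : Type} (a : ι → Bool) (t : I) : seg a a t = corner a := by
  rw [seg_eq_lerp, lerp_self]

/-- The inclusion of the first factor of a product at the point `y` of the second one. -/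
def mkLeft (y : L.Pt) (x : K.Pt) : (K.prod L).Pt := (x, y)

/-- The inclusion of the second factor of a product at the point `x` of the first one. -/
def mkRight (x : K.Pt) (y : L.Pt) : (K.prod L).Pt := (x, y)

lemma isMorphism_mkLeft (hK : K.IntegralHeight h) {y : L.Pt} (hy : L.IsVertex y) :
    (K.sliced h).IsMorphism ((K.prod L).sliced (prodHeight h k)) (mkLeft y) := by
  obtain ⟨d, w, rfl⟩ := hy.exists_corner
  refine isMorphism_of_slabs hK fun c _ => ⟨(c, d), fun a => Sum.elim a w, fun a b _ _ hab => ?_⟩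
  constructor
  · rw [slicedAdj_prod_iff, ncard_ne_self]
    simpa using slicedAdj_iff.1 hab
  · rw [edge_prod]
    funext t
    simp only [edge, seg_self]
    rfl

lemma isMorphism_mkRight (hL : L.IntegralHeight k) {x : K.Pt} (hx : K.IsVertex x) :
    (L.sliced k).IsMorphism ((K.prod L).sliced (prodHeight h k)) (mkRight x) := by
  obtain ⟨c, w, rfl⟩ := hx.exists_corner
  refine isMorphism_of_slabs hL fun d _ => ⟨(c, d), fun a => Sum.elim w a, fun a b _ _ hab => ?_⟩
  constructor
  · rw [slicedAdj_prod_iff, ncard_ne_self]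
    simpa using slicedAdj_iff.1 hab
  · rw [edge_prod]
    funext t
    simp only [edge, seg_self]
    rfl

/-- The projection of a product to its first factor. -/
def prFst (p : (K.prod L).Pt) : K.Pt := p.1

/-- The projection of a product to its second factor. -/
def prSnd (p : (K.prod L).Pt) : L.Pt := p.2

/-- An edge of a product is an edge of one of the factors, or the diagonal of a product of two
edges. -/
lemma mem_sliced_prod_edges {e : I → (K.prod L).Pt}
    (he : e ∈ ((K.prod L).sliced (prodHeight h k)).edges) :
    (prFst ∘ e ∈ (K.sliced h).edges ∧ ∀ t, prSnd (e t) = prSnd (e 0)) ∨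
    (prSnd ∘ e ∈ (L.sliced k).edges ∧ ∀ t, prFst (e t) = prFst (e 0)) ∨
    (∃ (c : K.Cube) (d : L.Cube) (a b : K.Dir c → Bool) (a' b' : L.Dir d → Bool),
      {i | a i ≠ b i}.ncard = 1 ∧ {i | a' i ≠ b' i}.ncard = 1 ∧
      (K.prod L).SlicedAdj (prodHeight h k) (c, d) (Sum.elim a a') (Sum.elim b b') ∧
      e = (K.prod L).edge (c, d) (Sum.elim a a') (Sum.elim b b')) := by
  obtain ⟨⟨c, d⟩, a, b, hab, rfl⟩ := he
  obtain ⟨a, a', rfl⟩ : ∃ (a₁ : K.Dir c → Bool) (a₂ : L.Dir d → Bool), a = Sum.elim a₁ a₂ :=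
    ⟨_, _, (Sum.elim_comp_inl_inr a).symm⟩
  obtain ⟨b, b', rfl⟩ : ∃ (b₁ : K.Dir c → Bool) (b₂ : L.Dir d → Bool), b = Sum.elim b₁ b₂ :=
    ⟨_, _, (Sum.elim_comp_inl_inr b).symm⟩
  have := K.finite_dir c
  have := L.finite_dir d
  have hadj := hab
  replace hab := slicedAdj_prod_iff.1 hab
  change ((K.edge c a b) ∈ _ ∧ ∀ t, L.edge d a' b' t = L.edge d a' b' 0) ∨
    ((L.edge d a' b') ∈ _ ∧ ∀ t, K.edge c a b t = K.edge c a b 0) ∨ _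
  by_cases h1 : {i | a' i ≠ b' i}.ncard = 0
  · obtain rfl := ncard_ne_eq_zero h1
    refine .inl ⟨⟨c, a, b, ?_, rfl⟩, fun t => by simp [edge]⟩
    rw [slicedAdj_iff]
    simpa using hab
  by_cases h2 : {i | a i ≠ b i}.ncard = 0
  · obtain rfl := ncard_ne_eq_zero h2
    refine .inr (.inl ⟨⟨d, a', b', ?_, rfl⟩, fun t => by simp [edge]⟩)
    rw [slicedAdj_iff]
    simpa using hab
  · have h3 : {i | a i ≠ b i}.ncard = 1 ∧ {i | a' i ≠ b' i}.ncard = 1 := by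
      rcases hab with hab | ⟨hab, -⟩ <;> omega
    exact .inr (.inr ⟨c, d, a, b, a', b', h3.1, h3.2, hadj, rfl⟩)

lemma mem_edges_fst {e : I → (K.prod L).Pt}
    (he : e ∈ ((K.prod L).sliced (prodHeight h k)).edges) :
    prFst ∘ e ∈ (K.sliced h).edges ∨ ∀ t, prFst (e t) = prFst (e 0) := by
  rcases mem_sliced_prod_edges he with h1 | h1 | ⟨c, d, a, b, a', b', h1, -, -, rfl⟩
  · exact .inl h1.1
  · exact .inr h1.2
  · exact .inl ⟨c, a, b, .inl h1, rfl⟩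

lemma mem_edges_snd {e : I → (K.prod L).Pt}
    (he : e ∈ ((K.prod L).sliced (prodHeight h k)).edges) :
    prSnd ∘ e ∈ (L.sliced k).edges ∨ ∀ t, prSnd (e t) = prSnd (e 0) := by
  rcases mem_sliced_prod_edges he with h1 | h1 | ⟨c, d, a, b, a', b', -, h1, -, rfl⟩
  · exact .inr h1.2
  · exact .inl h1.1
  · exact .inl ⟨d, a', b', .inl h1, rfl⟩

lemma IsVertex.fst {p : (K.prod L).Pt} (hp : (K.prod L).IsVertex p) : K.IsVertex (prFst p) := by
  obtain ⟨c, a, rfl⟩ := hp.exists_corner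
  exact isVertex_corner c.1 fun i => a (.inl i)

lemma IsVertex.snd {p : (K.prod L).Pt} (hp : (K.prod L).IsVertex p) : L.IsVertex (prSnd p) := by
  obtain ⟨c, a, rfl⟩ := hp.exists_corner
  exact isVertex_corner c.2 fun i => a (.inr i)

lemma IsVertex.prodMk {x : K.Pt} {y : L.Pt} (hx : K.IsVertex x) (hy : L.IsVertex y) :
    (K.prod L).IsVertex (x, y) := by
  obtain ⟨c, a, rfl⟩ := hx.exists_corner
  obtain ⟨d, b, rfl⟩ := hy.exists_corner
  exact isVertex_corner (K := K.prod L) (c, d) (Sum.elim a b)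

/-! ### The graph of a line over a complex -/

/-- The section of a product `K × L` over `K`, at total height `C`, which moves along the line `l`
in `L` in order to compensate the height. -/
def lineGraph (h : K.Pt → ℝ) (l : ℝ → L.Pt) (C : ℤ) (p : K.Pt) : (K.prod L).Pt :=
  (p, l (C - h p))

lemma IsLine.prodHeight_lineGraph {l : ℝ → L.Pt} (hl : L.IsLine k l) (C : ℤ) (p : K.Pt) :
    prodHeight h k (lineGraph h l C p) = C := by
  simp [prodHeight, lineGraph, hl.height]

/-- The graph of a line is a subcomplex of the product. Over the part of a cube `c` which lies
between the heights `n` and `n + 1`, the line stays in one edge `e`, and the graph is a horizontal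
part of `c × e`. An edge over which the height changes goes to a diagonal of a square in `c × e`.
-/
theorem IsLine.isMorphism_lineGraph (hK : K.IntegralHeight h) {l : ℝ → L.Pt} (hl : L.IsLine k l)
    (C : ℤ) :
    (K.sliced h).IsMorphism ((K.prod L).sliced (prodHeight h k)) (lineGraph h l C) := by
  classical
  refine isMorphism_of_slabs hK fun c n => ?_
  obtain ⟨e, he, ρ, hρ⟩ := hl.exists_edge (C - n - 1)
  -- the end of the edge `e` which lies below a corner of height `n` or `n + 1`
  let β : (K.Dir c → Bool) → Bool := fun a => decide (h (K.charMap c (corner a)) = n)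
  have hβ : ∀ a, (h (K.charMap c (corner a)) = n ∨ h (K.charMap c (corner a)) = n + 1) →
      h (K.charMap c (corner a)) = n + 1 - if β a then 1 else 0 := by
    intro a ha
    rcases ha with ha | ha <;> simp [β, ha]
  refine ⟨(c, e), fun a => Sum.elim a fun _ => ρ ^^ β a, fun a b ha hb hab => ?_⟩
  have hcurve : lineGraph h l C ∘ K.edge c a b =
      (K.prod L).edge (c, e) (Sum.elim a fun _ => ρ ^^ β a) (Sum.elim b fun _ => ρ ^^ β b) := by
    rw [edge_prod]
    funext t
    refine Prod.ext rfl ?_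
    change l (C - h (K.charMap c (seg a b t))) = L.charMap e _
    rw [hK.height_seg, hβ a ha, hβ b hb]
    let s := unitLerp (if β a then 1 else 0) (if β b then 1 else 0) t
    have hs := hρ s
    have h1 : (((C - n - 1 : ℤ) : ℝ) + s) = C - ((1 - (t : ℝ)) * (n + 1 - if β a then 1 else 0) +
        t * (n + 1 - if β b then 1 else 0)) := by
      rw [coe_unitLerp]
      push_cast
      split_ifs <;> push_cast <;> ring
    rw [h1] at hs
    rw [hs]
    congr 1
    funext i
    rw [flipIf_unitLerp, seg_eq_lerp, lerp]
    congr 1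
    · cases ρ <;> cases β a <;> simp [flipIf, corner]
    · cases ρ <;> cases β b <;> simp [flipIf, corner]
  refine ⟨?_, hcurve⟩
  have htot : h (K.charMap c (corner a)) + k (L.charMap e (corner fun _ => ρ ^^ β a)) =
      h (K.charMap c (corner b)) + k (L.charMap e (corner fun _ => ρ ^^ β b)) := by
    have h0 := congrArg (prodHeight h k) (congrFun hcurve 0)
    have h1 := congrArg (prodHeight h k) (congrFun hcurve 1)
    simp only [Function.comp_apply, hl.prodHeight_lineGraph] at h0 h1
    have h2 := h0.symm.trans h1
    change h (K.edge c a b 0) + k (L.edge e (fun _ => ρ ^^ β a) (fun _ => ρ ^^ β b) 0) =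
      h (K.edge c a b 1) + k (L.edge e (fun _ => ρ ^^ β a) (fun _ => ρ ^^ β b) 1) at h2
    simpa only [edge_zero, edge_one] using h2
  have hcard : {i : L.Dir e | (ρ ^^ β a) ≠ (ρ ^^ β b)}.ncard = if β a = β b then 0 else 1 := by
    split_ifs with hab'
    · simp [hab']
    · rw [← he, ← Set.ncard_univ]
      congr 1
      ext i
      simpa using hab'
  rw [slicedAdj_prod_iff, hcard]
  rcases slicedAdj_iff.1 hab with h1 | ⟨h1, h2⟩
  · have h3 : β a ≠ β b := by
      intro h4
      have h5 := hK.step h1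
      rw [hβ a ha, hβ b hb, h4] at h5
      rcases h5 with h5 | h5 <;> linarith
    rw [h1, if_neg h3]
    exact .inr ⟨rfl, htot⟩
  · have h3 : β a = β b := by simp only [β, h2]
    rw [h1, if_pos h3]
    exact .inr ⟨rfl, htot⟩

end CubeComplex

namespace CubeComplex

open TwoSkeleton

variable {K : CubeComplex.{u, v}} {h : K.Pt → ℝ} {L : CubeComplex.{u₁, v₁}} {k : L.Pt → ℝ}
  {M : CubeComplex.{u₂, v₂}} {m : M.Pt → ℝ}

/-! ### Edge paths in a product of two complexes -/

/-- The path `p × y` in a product. -/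
def hpath (p : List (I → K.Pt)) (y : L.Pt) : List (I → (K.prod L).Pt) :=
  p.map (mkLeft y ∘ ·)

/-- The path `x × q` in a product. -/
def vpath (x : K.Pt) (q : List (I → L.Pt)) : List (I → (K.prod L).Pt) :=
  q.map (mkRight x ∘ ·)

@[simp] lemma hpath_nil (y : L.Pt) : hpath (K := K) [] y = [] := rfl

@[simp] lemma vpath_nil (x : K.Pt) : vpath (L := L) x [] = [] := rfl

@[simp] lemma hpath_append (p p' : List (I → K.Pt)) (y : L.Pt) :
    hpath (p ++ p') y = hpath p y ++ hpath p' y := List.map_append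

@[simp] lemma vpath_append (x : K.Pt) (q q' : List (I → L.Pt)) :
    vpath x (q ++ q') = vpath x q ++ vpath x q' := List.map_append

@[simp] lemma length_hpath (p : List (I → K.Pt)) (y : L.Pt) : (hpath p y).length = p.length :=
  List.length_map _

@[simp] lemma length_vpath (x : K.Pt) (q : List (I → L.Pt)) : (vpath x q).length = q.length :=
  List.length_map _

lemma isEdgePath_hpath (hK : K.IntegralHeight h) {y : L.Pt} (hy : L.IsVertex y)
    {p : List (I → K.Pt)} {x x' : K.Pt} (hp : (K.sliced h).IsEdgePath x p x') :
    ((K.prod L).sliced (prodHeight h k)).IsEdgePath (x, y) (hpath p y) (x', y) :=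
  hp.map (isMorphism_mkLeft hK hy).edges

lemma isEdgePath_vpath (hL : L.IntegralHeight k) {x : K.Pt} (hx : K.IsVertex x)
    {q : List (I → L.Pt)} {y y' : L.Pt} (hq : (L.sliced k).IsEdgePath y q y') :
    ((K.prod L).sliced (prodHeight h k)).IsEdgePath (x, y) (vpath x q) (x, y') :=
  hq.map (isMorphism_mkRight hL hx).edges

lemma homotopicLE_hpath (hK : K.IntegralHeight h) {y : L.Pt} (hy : L.IsVertex y)
    {p p' : List (I → K.Pt)} {x x' : K.Pt} {n : ℕ} (hp : (K.sliced h).HomotopicLE x x' p p' n) :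
    ((K.prod L).sliced (prodHeight h k)).HomotopicLE (x, y) (x', y) (hpath p y) (hpath p' y) n :=
  hp.map (isMorphism_mkLeft hK hy)

lemma homotopicLE_vpath (hL : L.IntegralHeight k) {x : K.Pt} (hx : K.IsVertex x)
    {q q' : List (I → L.Pt)} {y y' : L.Pt} {n : ℕ} (hq : (L.sliced k).HomotopicLE y y' q q' n) :
    ((K.prod L).sliced (prodHeight h k)).HomotopicLE (x, y) (x, y') (vpath x q) (vpath x q') n :=
  hq.map (isMorphism_mkRight hL hx)

/-- The paths `p × y` and `x' × q` can be interchanged at the cost of `n` triangles. -/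
def Swap (h : K.Pt → ℝ) (k : L.Pt → ℝ) (x x' : K.Pt) (y y' : L.Pt) (p : List (I → K.Pt))
    (q : List (I → L.Pt)) (n : ℕ) : Prop :=
  ((K.prod L).sliced (prodHeight h k)).HomotopicLE (x, y) (x', y')
    (hpath p y ++ vpath x' q) (vpath x q ++ hpath p y') n

section Swap

variable {x x' x'' : K.Pt} {y y' y'' : L.Pt} {p p' : List (I → K.Pt)} {q q' : List (I → L.Pt)}
  {n n' : ℕ}

lemma Swap.append_left (hK : K.IntegralHeight h) (hy : L.IsVertex y) (hy' : L.IsVertex y')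
    (hp : (K.sliced h).IsEdgePath x p x') (hp' : (K.sliced h).IsEdgePath x' p' x'')
    (h1 : Swap h k x x' y y' p q n) (h2 : Swap h k x' x'' y y' p' q n') :
    Swap h k x x'' y y' (p ++ p') q (n + n') := by
  have e1 := HomotopicLE.append_left h2 (isEdgePath_hpath (k := k) hK hy hp)
  have e2 := HomotopicLE.append_right h1 (isEdgePath_hpath (k := k) hK hy' hp')
  rw [Swap, hpath_append, hpath_append]
  simp only [List.append_assoc] at e1 e2 ⊢
  exact (e1.trans e2).mono (by omega)

lemma Swap.append_right (hL : L.IntegralHeight k) (hx : K.IsVertex x) (hx' : K.IsVertex x')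
    (hq : (L.sliced k).IsEdgePath y q y') (hq' : (L.sliced k).IsEdgePath y' q' y'')
    (h1 : Swap h k x x' y y' p q n) (h2 : Swap h k x x' y' y'' p q' n') :
    Swap h k x x' y y'' p (q ++ q') (n + n') := by
  have e1 := HomotopicLE.append_right h1 (isEdgePath_vpath (h := h) hL hx' hq')
  have e2 := HomotopicLE.append_left h2 (isEdgePath_vpath (h := h) hL hx hq)
  rw [Swap, vpath_append, vpath_append]
  simp only [List.append_assoc] at e1 e2 ⊢
  exact (e1.trans e2).mono (by omega)

lemma Swap.congr_left (hK : K.IntegralHeight h) (hL : L.IntegralHeight k) (hx : K.IsVertex x)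
    (hx' : K.IsVertex x') (hy : L.IsVertex y) (hy' : L.IsVertex y')
    (hq : (L.sliced k).IsEdgePath y q y') {a : ℕ} (hp : (K.sliced h).HomotopicLE x x' p p' a)
    (h1 : Swap h k x x' y y' p q n) : Swap h k x x' y y' p' q (n + 2 * a) := by
  have e1 := (homotopicLE_hpath (k := k) hK hy hp).append_right (isEdgePath_vpath hL hx' hq)
  have e2 := (homotopicLE_hpath (k := k) hK hy' hp).append_left (isEdgePath_vpath hL hx hq)
  exact (e1.symm.trans (HomotopicLE.trans h1 e2)).mono (by omega)

lemma Swap.congr_right (hK : K.IntegralHeight h) (hL : L.IntegralHeight k) (hx : K.IsVertex x)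
    (hx' : K.IsVertex x') (hy : L.IsVertex y) (hy' : L.IsVertex y')
    (hp : (K.sliced h).IsEdgePath x p x') {a : ℕ} (hq : (L.sliced k).HomotopicLE y y' q q' a)
    (h1 : Swap h k x x' y y' p q n) : Swap h k x x' y y' p q' (n + 2 * a) := by
  have e1 := (homotopicLE_vpath (h := h) hL hx' hq).append_left (isEdgePath_hpath hK hy hp)
  have e2 := (homotopicLE_vpath (h := h) hL hx hq).append_right (isEdgePath_hpath hK hy' hp)
  exact (e1.symm.trans (HomotopicLE.trans h1 e2)).mono (by omega)

end Swap

lemma hpath_edge (c : K.Cube) (d : L.Cube) (a b : K.Dir c → Bool) (w : L.Dir d → Bool) :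
    hpath [K.edge c a b] (L.charMap d (corner w)) =
      [(K.prod L).edge (c, d) (Sum.elim a w) (Sum.elim b w)] := by
  have : (K.prod L).edge (c, d) (Sum.elim a w) (Sum.elim b w) =
      fun t => (K.edge c a b t, L.charMap d (corner w)) := by
    rw [edge_prod]
    funext t
    exact Prod.ext rfl (congrArg (L.charMap d) (seg_self w t))
  rw [this]
  rfl

lemma vpath_edge (c : K.Cube) (d : L.Cube) (w : K.Dir c → Bool) (a b : L.Dir d → Bool) :
    vpath (K.charMap c (corner w)) [L.edge d a b] =
      [(K.prod L).edge (c, d) (Sum.elim w a) (Sum.elim w b)] := by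
  have : (K.prod L).edge (c, d) (Sum.elim w a) (Sum.elim w b) =
      fun t => (K.charMap c (corner w), L.edge d a b t) := by
    rw [edge_prod]
    funext t
    exact Prod.ext (congrArg (K.charMap c) (seg_self w t)) rfl
  rw [this]
  rfl

/-- A product of two edges is a square, which one of its diagonals cuts into two triangles. -/
lemma swap_of_vertical (hK : K.IntegralHeight h) (hL : L.IntegralHeight k) {c : K.Cube}
    {d : L.Cube} {a b : K.Dir c → Bool} {a' b' : L.Dir d → Bool}
    (hab : {i | a i ≠ b i}.ncard = 1) (hab' : {i | a' i ≠ b' i}.ncard = 1) :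
    Swap h k (K.charMap c (corner a)) (K.charMap c (corner b)) (L.charMap d (corner a'))
      (L.charMap d (corner b')) [K.edge c a b] [L.edge d a' b'] 2 := by
  have hba : {i | b i ≠ a i}.ncard = 1 := by simpa only [ne_comm] using hab
  have hba' : {i | b' i ≠ a' i}.ncard = 1 := by simpa only [ne_comm] using hab'
  -- the sides of the square
  have e1 : (K.prod L).SlicedAdj (prodHeight h k) (c, d) (Sum.elim a a') (Sum.elim b a') :=
    slicedAdj_prod_iff.2 (.inl (by rw [hab, ncard_ne_self]))
  have e2 : (K.prod L).SlicedAdj (prodHeight h k) (c, d) (Sum.elim b a') (Sum.elim b b') :=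
    slicedAdj_prod_iff.2 (.inl (by rw [hab', ncard_ne_self]))
  have e3 : (K.prod L).SlicedAdj (prodHeight h k) (c, d) (Sum.elim a a') (Sum.elim a b') :=
    slicedAdj_prod_iff.2 (.inl (by rw [hab', ncard_ne_self]))
  have e4 : (K.prod L).SlicedAdj (prodHeight h k) (c, d) (Sum.elim a b') (Sum.elim b b') :=
    slicedAdj_prod_iff.2 (.inl (by rw [hab, ncard_ne_self]))
  have key : ((K.prod L).sliced (prodHeight h k)).HomotopicLE
      ((K.prod L).charMap (c, d) (corner (Sum.elim a a')))
      ((K.prod L).charMap (c, d) (corner (Sum.elim b b')))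
      [(K.prod L).edge (c, d) (Sum.elim a a') (Sum.elim b a'),
        (K.prod L).edge (c, d) (Sum.elim b a') (Sum.elim b b')]
      [(K.prod L).edge (c, d) (Sum.elim a a') (Sum.elim a b'),
        (K.prod L).edge (c, d) (Sum.elim a b') (Sum.elim b b')] 2 := by
    by_cases hd : h (K.charMap c (corner a)) + k (L.charMap d (corner a')) =
        h (K.charMap c (corner b)) + k (L.charMap d (corner b'))
    · have e5 : (K.prod L).SlicedAdj (prodHeight h k) (c, d) (Sum.elim a a') (Sum.elim b b') :=
        slicedAdj_prod_iff.2 (.inr ⟨by rw [hab, hab'], hd⟩)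
      exact (homotopicLE_sliced_triangle e1 e2 e5).trans
        (homotopicLE_sliced_triangle e3 e4 e5).symm
    · have e5 : (K.prod L).SlicedAdj (prodHeight h k) (c, d) (Sum.elim b a') (Sum.elim a b') := by
        refine slicedAdj_prod_iff.2 (.inr ⟨by rw [hba, hab'], ?_⟩)
        rcases hK.step hab with h1 | h1 <;> rcases hL.step hab' with h2 | h2 <;>
          first | linarith | (exfalso; apply hd; linarith)
      have t1 := homotopicLE_sliced_triangle e1 e5 e3
      have t2 := homotopicLE_sliced_triangle e5.symm e2 e4
      have p1 := isEdgePath_singleton' (edge_mem_sliced e1) (edge_zero _ _ _) (edge_one _ _ _)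
      have p2 := isEdgePath_singleton' (edge_mem_sliced e2) (edge_zero _ _ _) (edge_one _ _ _)
      have p4 := isEdgePath_singleton' (edge_mem_sliced e4) (edge_zero _ _ _) (edge_one _ _ _)
      have p5 := isEdgePath_singleton' (edge_mem_sliced e5) (edge_zero _ _ _) (edge_one _ _ _)
      have c1 := (homotopicLE_append_revPath proper_sliced p5).congr_mid p1 p2
      have c2 := t2.append_left (p1.append p5)
      have c3 := t1.append_right p4
      rw [revPath_cons, revPath_nil, List.nil_append,
        show rev ((K.prod L).edge (c, d) (Sum.elim b a') (Sum.elim a b')) =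
          (K.prod L).edge (c, d) (Sum.elim a b') (Sum.elim b a') from rev_edge _ _ _] at c1
      exact (c1.symm.trans (c2.trans c3)).mono (by omega)
  rw [Swap, hpath_edge, hpath_edge, vpath_edge, vpath_edge]
  exact key

/-- A horizontal diagonal of a square is homotopic to two sides of the square. -/
lemma exists_vertical_of_slicedAdj {c : K.Cube} {a b : K.Dir c → Bool}
    (hab : K.SlicedAdj h c a b) :
    {i | a i ≠ b i}.ncard = 1 ∨ ∃ d : K.Dir c → Bool, {i | a i ≠ d i}.ncard = 1 ∧
      {i | d i ≠ b i}.ncard = 1 ∧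
      (K.sliced h).HomotopicLE (K.charMap c (corner a)) (K.charMap c (corner b))
        [K.edge c a d, K.edge c d b] [K.edge c a b] 1 := by
  classical
  rcases slicedAdj_iff.1 hab with h1 | ⟨h1, -⟩
  · exact .inl h1
  obtain ⟨i, j, hij, hset⟩ := Set.ncard_eq_two.1 h1
  have hmem : ∀ l, a l ≠ b l ↔ l = i ∨ l = j := fun l => by
    have : l ∈ {i | a i ≠ b i} ↔ l ∈ ({i, j} : Set _) := by rw [hset]
    simpa using this
  have hd1 : {l | a l ≠ Function.update a i (b i) l}.ncard = 1 := by
    rw [Set.ncard_eq_one]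
    refine ⟨i, Set.ext fun l => ?_⟩
    by_cases hl : l = i
    · subst hl; simpa using (hmem l).2 (.inl rfl)
    · simp [hl]
  have hd2 : {l | Function.update a i (b i) l ≠ b l}.ncard = 1 := by
    rw [Set.ncard_eq_one]
    refine ⟨j, Set.ext fun l => ?_⟩
    by_cases hl : l = i
    · subst hl; simpa using hij
    · have := hmem l
      simp only [hl, false_or] at this
      simpa [hl] using this
  exact .inr ⟨_, hd1, hd2, homotopicLE_sliced_triangle (.inl hd1) (.inl hd2) hab⟩

/-- A horizontal diagonal is first replaced by two sides of its square, in each of the factors. This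
leaves at most four products of two edges of the cube structures. -/
lemma swap_edges (hK : K.IntegralHeight h) (hL : L.IntegralHeight k) {e : I → K.Pt}
    {f : I → L.Pt} (he : e ∈ (K.sliced h).edges) (hf : f ∈ (L.sliced k).edges) :
    Swap h k (e 0) (e 1) (f 0) (f 1) [e] [f] 14 := by
  obtain ⟨c, a, b, hab, rfl⟩ := mem_sliced_edges.1 he
  obtain ⟨d, a', b', hab', rfl⟩ := mem_sliced_edges.1 hf
  simp only [edge_zero, edge_one]
  have hE : ∀ {c : K.Cube} {a b : K.Dir c → Bool}, K.SlicedAdj h c a b →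
      (K.sliced h).IsEdgePath (K.charMap c (corner a)) [K.edge c a b] (K.charMap c (corner b)) :=
    fun hab => isEdgePath_singleton' (edge_mem_sliced hab) (edge_zero _ _ _) (edge_one _ _ _)
  have hF : ∀ {d : L.Cube} {a b : L.Dir d → Bool}, L.SlicedAdj k d a b →
      (L.sliced k).IsEdgePath (L.charMap d (corner a)) [L.edge d a b] (L.charMap d (corner b)) :=
    fun hab => isEdgePath_singleton' (edge_mem_sliced hab) (edge_zero _ _ _) (edge_one _ _ _)
  have step1 : ∀ a' b' : L.Dir d → Bool, {i | a' i ≠ b' i}.ncard = 1 →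
      Swap h k (K.charMap c (corner a)) (K.charMap c (corner b)) (L.charMap d (corner a'))
        (L.charMap d (corner b')) [K.edge c a b] [L.edge d a' b'] 6 := by
    intro a' b' hv
    rcases exists_vertical_of_slicedAdj hab with h1 | ⟨w, hw1, hw2, hw⟩
    · exact (swap_of_vertical hK hL h1 hv).mono (by norm_num)
    · have s1 := swap_of_vertical hK hL hw1 hv
      have s2 := swap_of_vertical hK hL hw2 hv
      have s3 := s1.append_left hK (isVertex_corner _ _) (isVertex_corner _ _) (hE (.inl hw1))
        (hE (.inl hw2)) s2
      exact s3.congr_left hK hL (isVertex_corner _ _) (isVertex_corner _ _) (isVertex_corner _ _)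
        (isVertex_corner _ _) (hF (.inl hv)) hw
  rcases exists_vertical_of_slicedAdj hab' with h1 | ⟨w, hw1, hw2, hw⟩
  · exact (step1 _ _ h1).mono (by norm_num)
  · have s3 := (step1 _ _ hw1).append_right hL (isVertex_corner _ _) (isVertex_corner _ _)
      (hF (.inl hw1)) (hF (.inl hw2)) (step1 _ _ hw2)
    exact s3.congr_right hK hL (isVertex_corner _ _) (isVertex_corner _ _) (isVertex_corner _ _)
        (isVertex_corner _ _) (hE hab) hw

/-- Paths in the two factors of a product can be interchanged, with quadratic area. -/
theorem swap_paths (hK : K.IntegralHeight h) (hL : L.IntegralHeight k) {x x' : K.Pt} {y y' : L.Pt}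
    {p : List (I → K.Pt)} {q : List (I → L.Pt)} (hx : K.IsVertex x) (hy : L.IsVertex y)
    (hp : (K.sliced h).IsEdgePath x p x') (hq : (L.sliced k).IsEdgePath y q y') :
    Swap h k x x' y y' p q (14 * p.length * q.length) := by
  induction p generalizing x with
  | nil =>
    obtain rfl : x = x' := hp
    simpa [Swap] using HomotopicLE.refl (isEdgePath_vpath hL hx hq)
  | cons e p ih =>
    obtain ⟨he, rfl, hp⟩ := hp
    have hx1 := IsVertex.of_mem_edges' he
    have hy' := IsVertex.of_isEdgePath hq hy
    have s1 : Swap h k (e 0) (e 1) y y' [e] q (14 * q.length) := by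
      clear ih
      induction q generalizing y with
      | nil =>
        obtain rfl : y = y' := hq
        simpa [Swap] using HomotopicLE.refl (isEdgePath_hpath hK hy (isEdgePath_singleton he))
      | cons f q ih =>
        obtain ⟨hf, rfl, hq⟩ := hq
        have s2 := (swap_edges hK hL he hf).append_right hL hx hx1 (isEdgePath_singleton hf) hq
          (ih (IsVertex.of_mem_edges' hf) hq)
        exact s2.mono (by simp only [List.length_cons]; omega)
    have s2 := s1.append_left hK hy hy' (isEdgePath_singleton he) hp (ih hx1 hp)
    refine s2.mono ?_
    simp only [List.length_cons]
    nlinarith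

/-- An edge of a product is homotopic to its projection to the first factor, followed by its
projection to the second factor. A diagonal is replaced by two sides of a square. -/
lemma homotopicLE_edge_prod {g : I → (K.prod L).Pt}
    (hg : g ∈ ((K.prod L).sliced (prodHeight h k)).edges) :
    ((K.prod L).sliced (prodHeight h k)).HomotopicLE (g 0) (g 1) [g]
      (hpath (trace prFst [g]) (prSnd (g 0)) ++ vpath (prFst (g 1)) (trace prSnd [g])) 1 := by
  have hgp := isEdgePath_singleton hg
  rcases mem_sliced_prod_edges hg with
    ⟨h1, h2⟩ | ⟨h1, h2⟩ | ⟨c, d, a, b, a', b', h1, h2, h3, rfl⟩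
  · obtain ⟨t, ht⟩ := nonconst_sliced _ h1
    rw [trace_singleton_of_const h2, trace_singleton_of_ne ht]
    have : hpath [prFst ∘ g] (prSnd (g 0)) = [g] := by
      simp only [hpath, List.map_cons, List.map_nil]
      congr 1
      funext t
      exact Prod.ext rfl (h2 t).symm
    rw [this]
    exact .refl hgp
  · obtain ⟨t, ht⟩ := nonconst_sliced _ h1
    rw [trace_singleton_of_const h2, trace_singleton_of_ne ht]
    have : vpath (prFst (g 1)) [prSnd ∘ g] = [g] := by
      simp only [vpath, List.map_cons, List.map_nil]
      congr 1
      funext t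
      exact Prod.ext ((h2 1).trans (h2 t).symm) rfl
    rw [this]
    exact .refl hgp
  · have e1 : prFst ∘ (K.prod L).edge (c, d) (Sum.elim a a') (Sum.elim b b') = K.edge c a b := rfl
    have e2 : prSnd ∘ (K.prod L).edge (c, d) (Sum.elim a a') (Sum.elim b b') = L.edge d a' b' := rfl
    obtain ⟨t, ht⟩ := nonconst_sliced (h := h) _ (edge_mem_sliced (.inl h1))
    obtain ⟨s, hs⟩ := nonconst_sliced (h := k) _ (edge_mem_sliced (.inl h2))
    rw [← e1] at ht
    rw [← e2] at hs
    rw [trace_singleton_of_ne ht, trace_singleton_of_ne hs, e1, e2]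
    have e3 : prSnd ((K.prod L).edge (c, d) (Sum.elim a a') (Sum.elim b b') 0) =
      L.charMap d (corner a') := edge_zero d a' b'
    have e4 : prFst ((K.prod L).edge (c, d) (Sum.elim a a') (Sum.elim b b') 1) =
      K.charMap c (corner b) := edge_one c a b
    have e5 : (K.prod L).edge (c, d) (Sum.elim a a') (Sum.elim b b') 0 = _ := edge_zero _ _ _
    have e6 : (K.prod L).edge (c, d) (Sum.elim a a') (Sum.elim b b') 1 = _ := edge_one _ _ _
    rw [e3, e4, hpath_edge, vpath_edge, e5, e6]
    exact (homotopicLE_sliced_triangle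
      (slicedAdj_prod_iff.2 (.inl (by rw [h1, ncard_ne_self])))
      (slicedAdj_prod_iff.2 (.inl (by rw [h2, ncard_ne_self]))) h3).symm

lemma isEdgePath_trace_fst {P : List (I → (K.prod L).Pt)} {p p' : (K.prod L).Pt}
    (hP : ((K.prod L).sliced (prodHeight h k)).IsEdgePath p P p') :
    (K.sliced h).IsEdgePath (prFst p) (trace prFst P) (prFst p') :=
  hP.trace fun _ he => mem_edges_fst he

lemma isEdgePath_trace_snd {P : List (I → (K.prod L).Pt)} {p p' : (K.prod L).Pt}
    (hP : ((K.prod L).sliced (prodHeight h k)).IsEdgePath p P p') :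
    (L.sliced k).IsEdgePath (prSnd p) (trace prSnd P) (prSnd p') :=
  hP.trace fun _ he => mem_edges_snd he

/-- A path in a product can be replaced by its projection to the first factor, followed by its
projection to the second one, with quadratic area. -/
theorem homotopicLE_traces (hK : K.IntegralHeight h) (hL : L.IntegralHeight k)
    {P : List (I → (K.prod L).Pt)} {p p' : (K.prod L).Pt} (hp : (K.prod L).IsVertex p)
    (hP : ((K.prod L).sliced (prodHeight h k)).IsEdgePath p P p') :
    ((K.prod L).sliced (prodHeight h k)).HomotopicLE p p' P
      (hpath (trace prFst P) (prSnd p) ++ vpath (prFst p') (trace prSnd P))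
      (15 * P.length ^ 2) := by
  induction P generalizing p with
  | nil =>
    obtain rfl : p = p' := hP
    exact .refl rfl
  | cons g P ih =>
    obtain ⟨hg, rfl, hP⟩ := hP
    have hp1 := IsVertex.of_mem_edges' hg
    have s1 := homotopicLE_edge_prod hg
    have s2 := s1.append proper_sliced (ih hp1 hP)
    have g1 := isEdgePath_trace_fst (isEdgePath_singleton hg)
    have g2 := isEdgePath_trace_snd (isEdgePath_singleton hg)
    have q1 := isEdgePath_trace_fst hP
    have q2 := isEdgePath_trace_snd hP
    have s3 := (swap_paths hK hL hp1.fst hp.snd q1 g2)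
    have s4 := HomotopicLE.congr_mid (isEdgePath_hpath (k := k) hK hp.snd g1)
      (HomotopicLE.symm s3)
      (isEdgePath_vpath (h := h) hL (hp1.fst.of_isEdgePath q1) q2)
    rw [trace_cons prFst g P, trace_cons prSnd g P, hpath_append, vpath_append]
    have l1 : (trace (prFst (K := K) (L := L)) P).length ≤ P.length := length_trace_le _ _
    have l2 : (trace (prSnd (K := K) (L := L)) [g]).length ≤ 1 := length_trace_le _ _
    have l3 := Nat.mul_le_mul l1 l2
    have s5 := (s4.mono (by linarith :
      14 * (trace prFst P).length * (trace prSnd [g]).length ≤ 14 * P.length))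
    simp only [List.append_assoc] at s2 s5 ⊢
    exact s2.trans_le s5 (by simp only [List.length_cons]; nlinarith)

/-- Paths in a product whose projections are homotopic are homotopic, at the cost of the homotopies
of the projections and of a quadratic term. -/
theorem homotopicLE_of_traces (hK : K.IntegralHeight h) (hL : L.IntegralHeight k)
    {P P' : List (I → (K.prod L).Pt)} {p p' : (K.prod L).Pt} (hp : (K.prod L).IsVertex p)
    (hP : ((K.prod L).sliced (prodHeight h k)).IsEdgePath p P p')
    (hP' : ((K.prod L).sliced (prodHeight h k)).IsEdgePath p P' p') {m n N : ℕ}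
    (h1 : (K.sliced h).HomotopicLE (prFst p) (prFst p') (trace prFst P) (trace prFst P') m)
    (h2 : (L.sliced k).HomotopicLE (prSnd p) (prSnd p') (trace prSnd P) (trace prSnd P') n)
    (hN : 15 * P.length ^ 2 + 15 * P'.length ^ 2 + m + n ≤ N) :
    ((K.prod L).sliced (prodHeight h k)).HomotopicLE p p' P P' N := by
  have e1 := homotopicLE_traces hK hL hp hP
  have e2 := homotopicLE_traces hK hL hp hP'
  have e3 := homotopicLE_hpath (k := k) hK hp.snd h1
  have e4 := homotopicLE_vpath (h := h) hL (hp.of_isEdgePath hP).fst h2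
  exact (e1.trans ((e3.append proper_sliced e4).trans e2.symm)).mono (by linarith)

end CubeComplex

namespace CubeComplex

open TwoSkeleton

variable {K : CubeComplex.{u, v}} {h : K.Pt → ℝ} {L : CubeComplex.{u₁, v₁}} {k : L.Pt → ℝ}
  {M : CubeComplex.{u₂, v₂}} {m : M.Pt → ℝ}

/-! ### Shadows of edge paths on lines -/

/-- The path on the line `l` which compensates the height along the path `q`: while `q` is at the
point `p`, the shadow is at the height `C - h p`. -/
noncomputable def shadow (h : K.Pt → ℝ) (l : ℝ → L.Pt) (C : ℤ) (q : List (I → K.Pt)) :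
    List (I → L.Pt) :=
  trace (fun p => l (C - h p)) q

@[simp] lemma shadow_nil (l : ℝ → L.Pt) (C : ℤ) : shadow h l C [] = [] := rfl

@[simp] lemma shadow_append (l : ℝ → L.Pt) (C : ℤ) (q q' : List (I → K.Pt)) :
    shadow h l C (q ++ q') = shadow h l C q ++ shadow h l C q' := trace_append _ _ _

lemma length_shadow_le (l : ℝ → L.Pt) (C : ℤ) (q : List (I → K.Pt)) :
    (shadow h l C q).length ≤ q.length := length_trace_le _ _

lemma trace_lineGraph_snd (l : ℝ → L.Pt) (C : ℤ) (q : List (I → K.Pt)) :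
    trace prSnd (q.map (lineGraph h l C ∘ ·)) = shadow h l C q := trace_map _ _ _

lemma trace_lineGraph_fst (l : ℝ → L.Pt) (C : ℤ) {q : List (I → K.Pt)} {x x' : K.Pt}
    (hq : (K.sliced h).IsEdgePath x q x') :
    trace prFst (q.map (lineGraph h l C ∘ ·)) = q := by
  rw [trace_map, trace_eq_map (T := K.sliced h) nonconst_sliced]
  · exact List.map_id _
  · exact hq.forall_edges

lemma trace_vpath_snd {q : List (I → L.Pt)} {y y' : L.Pt} (x : K.Pt)
    (hq : (L.sliced k).IsEdgePath y q y') : trace prSnd (vpath x q) = q := by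
  rw [vpath, trace_map, trace_eq_map (T := L.sliced k) nonconst_sliced]
  · exact List.map_id _
  · exact hq.forall_edges

@[simp] lemma trace_vpath_fst (x : K.Pt) (q : List (I → L.Pt)) :
    trace prFst (vpath x q) = [] := by
  rw [vpath, trace_map]
  exact trace_eq_nil fun _ _ _ => rfl

lemma isEdgePath_lineGraph (hK : K.IntegralHeight h) {l : ℝ → L.Pt} (hl : L.IsLine k l) (C : ℤ)
    {q : List (I → K.Pt)} {x x' : K.Pt} (hq : (K.sliced h).IsEdgePath x q x') :
    ((K.prod L).sliced (prodHeight h k)).IsEdgePath (lineGraph h l C x)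
      (q.map (lineGraph h l C ∘ ·)) (lineGraph h l C x') :=
  hq.map (hl.isMorphism_lineGraph hK C).edges

lemma isEdgePath_shadow (hK : K.IntegralHeight h) {l : ℝ → L.Pt} (hl : L.IsLine k l) (C : ℤ)
    {q : List (I → K.Pt)} {x x' : K.Pt} (hq : (K.sliced h).IsEdgePath x q x') :
    (L.sliced k).IsEdgePath (l (C - h x)) (shadow h l C q) (l (C - h x')) := by
  rw [← trace_lineGraph_snd]
  exact isEdgePath_trace_snd (isEdgePath_lineGraph hK hl C hq)

/-- The edge of the line `l` from height `n` to height `n + 1`. -/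
def lineEdge (l : ℝ → L.Pt) (n : ℤ) : I → L.Pt := fun t => l (n + t)

lemma IsLine.lineEdge_mem {l : ℝ → L.Pt} (hl : L.IsLine k l) (n : ℤ) :
    lineEdge l n ∈ (L.sliced k).edges := by
  obtain ⟨e, he, ρ, hρ⟩ := hl.exists_edge n
  refine ⟨e, fun _ => ρ, fun _ => !ρ, .inl ?_, ?_⟩
  · rw [← he, ← Set.ncard_univ]
    congr 1
    ext i
    simp
  · funext t
    rw [lineEdge, hρ]
    congr 1
    funext i
    cases ρ <;> simp [seg, flipIf]

lemma isEdgePath_lineEdge {l : ℝ → L.Pt} (hl : L.IsLine k l) {n n' : ℤ} (hn : n' = n + 1) :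
    (L.sliced k).IsEdgePath (l n) [lineEdge l n] (l n') :=
  isEdgePath_singleton' (hl.lineEdge_mem n) (by simp [lineEdge]) (by simp [lineEdge, hn])

lemma isEdgePath_rev_lineEdge {l : ℝ → L.Pt} (hl : L.IsLine k l) {n n' : ℤ} (hn : n' = n + 1) :
    (L.sliced k).IsEdgePath (l n') [rev (lineEdge l n)] (l n) :=
  (isEdgePath_lineEdge hl hn).revPath proper_sliced

/-- The path along the line `l` from height `0` to height `n`. -/
def linePath (l : ℝ → L.Pt) (n : ℤ) : List (I → L.Pt) :=
  ((List.range n.toNat).map fun i : ℕ => lineEdge l i) ++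
    (List.range (-n).toNat).map fun i : ℕ => rev (lineEdge l (-(i + 1)))

lemma linePath_succ (l : ℝ → L.Pt) (n : ℕ) :
    linePath l (n + 1) = linePath l n ++ [lineEdge l n] := by
  have h1 : ((n : ℤ) + 1).toNat = n + 1 := by omega
  have h3 : (-(n : ℤ)).toNat = 0 := by omega
  simp [linePath, h1, h3, List.range_succ]

lemma linePath_neg_succ (l : ℝ → L.Pt) (n : ℕ) :
    linePath l (-(n + 1)) = linePath l (-n) ++ [rev (lineEdge l (-(n + 1)))] := by
  have h1 : (-((n : ℤ) + 1)).toNat = 0 := by omega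
  have h2 : ((n : ℤ) + 1).toNat = n + 1 := by omega
  have h3 : (-(n : ℤ)).toNat = 0 := by omega
  simp only [linePath, neg_neg, h1, h2, h3, List.range_zero, List.map_nil, List.nil_append,
    List.range_succ, List.map_append, Int.toNat_natCast]
  rfl

lemma isEdgePath_linePath {l : ℝ → L.Pt} (hl : L.IsLine k l) (n : ℤ) :
    (L.sliced k).IsEdgePath (l 0) (linePath l n) (l n) := by
  obtain ⟨n, rfl | rfl⟩ := n.eq_nat_or_neg
  · induction n with
    | zero => simp [linePath, IsEdgePath]
    | succ n ih =>
      rw [Nat.cast_succ, linePath_succ]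
      exact ih.append (isEdgePath_lineEdge hl rfl)
  · induction n with
    | zero => simp [linePath, IsEdgePath]
    | succ n ih =>
      rw [Nat.cast_succ, linePath_neg_succ]
      exact ih.append (isEdgePath_rev_lineEdge hl (by ring))

lemma homotopicLE_linePath {l : ℝ → L.Pt} (hl : L.IsLine k l) {n n' : ℤ} (hn : n' = n + 1) :
    (L.sliced k).HomotopicLE (l 0) (l n') (linePath l n ++ [lineEdge l n]) (linePath l n') 0 := by
  subst hn
  have hpath := (isEdgePath_linePath hl n).append (isEdgePath_lineEdge hl rfl)
  rcases le_or_gt 0 n with h0 | h0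
  · lift n to ℕ using h0
    rw [linePath_succ]
    exact .refl hpath
  · obtain ⟨m, rfl⟩ : ∃ m : ℕ, n = -((m : ℤ) + 1) := ⟨(-n - 1).toNat, by omega⟩
    have := (homotopicLE_revPath_append proper_sliced
      (isEdgePath_lineEdge hl (n := -((m : ℤ) + 1)) rfl)).append_left
        (isEdgePath_linePath hl (-((m : ℤ) + 1) + 1))
    rw [linePath_neg_succ, show -(m : ℤ) = -((m : ℤ) + 1) + 1 by ring, List.append_assoc]
    simpa using this

lemma homotopicLE_linePath_rev {l : ℝ → L.Pt} (hl : L.IsLine k l) {n n' : ℤ} (hn : n' = n + 1) :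
    (L.sliced k).HomotopicLE (l 0) (l n) (linePath l n' ++ [rev (lineEdge l n)])
      (linePath l n) 0 := by
  have h1 := (homotopicLE_linePath hl hn).append_right (isEdgePath_rev_lineEdge hl hn)
  have h2 := (homotopicLE_append_revPath proper_sliced (isEdgePath_lineEdge hl hn)).append_left
    (isEdgePath_linePath hl n)
  rw [← List.append_assoc, List.append_nil] at h2
  exact h1.symm.trans h2

/-- The shadow of an edge is an edge of the line, or empty for a horizontal edge. -/
lemma homotopicLE_linePath_shadow (hK : K.IntegralHeight h) {l : ℝ → L.Pt} (hl : L.IsLine k l)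
    (C : ℤ) {e : I → K.Pt} (he : e ∈ (K.sliced h).edges) {n n' : ℤ} (hn : C - h (e 0) = n)
    (hn' : C - h (e 1) = n') :
    (L.sliced k).HomotopicLE (l 0) (l n') (linePath l n ++ shadow h l C [e]) (linePath l n') 0 := by
  have hadj := he
  obtain ⟨c, a, b, hab, rfl⟩ := mem_sliced_edges.1 he
  have hheight : ∀ t : I, h (K.edge c a b t) = (1 - t) * (C - n) + t * (C - n') := by
    intro t
    rw [edge_zero] at hn
    rw [edge_one] at hn'
    rw [edge, hK.height_seg]
    rw [show h (K.charMap c (corner a)) = C - n by linarith,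
      show h (K.charMap c (corner b)) = C - n' by linarith]
  have hcases : n' = n ∨ n = n' + 1 ∨ n' = n + 1 := by
    have := hab.height hK
    rw [edge_zero] at hn
    rw [edge_one] at hn'
    have h1 : (n' : ℝ) = n ∨ (n : ℝ) = n' + 1 ∨ (n' : ℝ) = n + 1 := by
      rcases this with h1 | h1 | h1
      · left; linarith
      · right; left; linarith
      · right; right; linarith
    exact_mod_cast h1
  have hshadow : ∀ f ∈ (L.sliced k).edges, (fun p => l (C - h p)) ∘ K.edge c a b = f →
      shadow h l C [K.edge c a b] = [f] := by
    intro f hf hf'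
    obtain ⟨t, ht⟩ := nonconst_sliced f hf
    rw [← hf'] at ht ⊢
    exact trace_singleton_of_ne ht
  rcases hcases with rfl | hc | hc
  · have : shadow h l C [K.edge c a b] = [] := by
      refine trace_singleton_of_const fun t => ?_
      rw [hheight, hheight]
      congr 1
      ring
    rw [this, List.append_nil]
    exact .refl (isEdgePath_linePath hl n')
  · rw [hshadow (rev (lineEdge l n')) (proper_sliced.rev_mem _ (hl.lineEdge_mem n'))]
    · exact homotopicLE_linePath_rev hl hc
    · funext t
      simp only [Function.comp_apply, hheight, rev, lineEdge, unitInterval.coe_symm_eq]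
      congr 1
      subst hc
      push_cast
      ring
  · rw [hshadow (lineEdge l n) (hl.lineEdge_mem n)]
    · exact homotopicLE_linePath hl hc
    · funext t
      simp only [Function.comp_apply, hheight, lineEdge]
      congr 1
      subst hc
      push_cast
      ring

/-- The shadow of a path runs along the line between the heights which its ends determine. -/
lemma homotopicLE_linePath_shadow_path (hK : K.IntegralHeight h) {l : ℝ → L.Pt}
    (hl : L.IsLine k l) (C : ℤ) {q : List (I → K.Pt)} {x x' : K.Pt}
    (hq : (K.sliced h).IsEdgePath x q x') {n n' : ℤ} (hn : C - h x = n) (hn' : C - h x' = n') :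
    (L.sliced k).HomotopicLE (l 0) (l n') (linePath l n ++ shadow h l C q) (linePath l n') 0 := by
  induction q generalizing x n with
  | nil =>
    obtain rfl : x = x' := hq
    obtain rfl : n = n' := by exact_mod_cast hn.symm.trans hn'
    simpa using HomotopicLE.refl (isEdgePath_linePath hl n)
  | cons e q ih =>
    obtain ⟨he, rfl, hq⟩ := hq
    obtain ⟨m, hm⟩ := (IsVertex.of_mem_edges' he).exists_height_eq hK
    have hm' : (C : ℝ) - h (e 1) = (C - m : ℤ) := by rw [hm]; push_cast; ring
    have h1 := homotopicLE_linePath_shadow hK hl C he hn hm'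
    have h2 := isEdgePath_shadow hK hl C hq
    rw [hm', hn'] at h2
    have h3 := (h1.append_right h2).trans (ih hq hm')
    rw [← List.singleton_append, shadow_append, ← List.append_assoc]
    exact h3

/-- A line is a tree: two shadows on the line with the same ends differ by backtracks only. -/
theorem homotopicLE_shadow (hK : K.IntegralHeight h) {l : ℝ → L.Pt}
    (hl : L.IsLine k l) (C : ℤ) {q q' : List (I → K.Pt)} {x x' y y' : K.Pt} (hx : K.IsVertex x)
    (hq : (K.sliced h).IsEdgePath x q x') (hq' : (K.sliced h).IsEdgePath y q' y')
    (hxy : h x = h y) (hxy' : h x' = h y') :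
    (L.sliced k).HomotopicLE (l (C - h x)) (l (C - h x')) (shadow h l C q) (shadow h l C q') 0 := by
  obtain ⟨n, hn⟩ := hx.exists_height_eq hK
  obtain ⟨n', hn'⟩ := (hx.of_isEdgePath hq).exists_height_eq hK
  have en : (C : ℝ) - h x = (C - n : ℤ) := by rw [hn]; push_cast; ring
  have en' : (C : ℝ) - h x' = (C - n' : ℤ) := by rw [hn']; push_cast; ring
  have h1 := homotopicLE_linePath_shadow_path hK hl C hq en en'
  have h2 := homotopicLE_linePath_shadow_path hK hl C hq' (hxy ▸ en) (hxy' ▸ en')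
  have h3 := (h1.trans h2.symm).append_left
    ((isEdgePath_linePath hl (C - n)).revPath proper_sliced)
  have h4 := homotopicLE_revPath_append proper_sliced (isEdgePath_linePath hl (C - n))
  have p1 := isEdgePath_shadow hK hl C hq
  have p2 := isEdgePath_shadow hK hl C hq'
  rw [← hxy, ← hxy'] at p2
  rw [en, en'] at p1 p2 ⊢
  have h5 := h4.append_right p1
  have h6 := h4.append_right p2
  simp only [List.append_assoc, List.nil_append] at h3 h5 h6
  exact h5.symm.trans (h3.trans h6)

/-- If the ends of a path have the same height, then its shadow on a line is trivial up to
backtracks. -/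
theorem homotopicLE_shadow_nil (hK : K.IntegralHeight h) {l : ℝ → L.Pt}
    (hl : L.IsLine k l) (C : ℤ) {q : List (I → K.Pt)} {x x' : K.Pt} (hx : K.IsVertex x)
    (hq : (K.sliced h).IsEdgePath x q x') (hxx' : h x = h x') :
    (L.sliced k).HomotopicLE (l (C - h x)) (l (C - h x')) (shadow h l C q) [] 0 :=
  homotopicLE_shadow hK hl C hx hq (show (K.sliced h).IsEdgePath x [] x from rfl) rfl hxx'.symm

/-! ### Exchanging a path in one factor with a compensated path in the other -/

/-- A path `r` in `L`, followed by a path `q` in `K` with compensation along the line `l'`, can be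
replaced by the path `q` with compensation along the line `l`, followed by the path `r` extended by
the shadows of `q` on both lines. Indeed both have the same projections up to backtracks. -/
theorem homotopicLE_exchange (hK : K.IntegralHeight h) (hL : L.IntegralHeight k)
    {l l' : ℝ → L.Pt} (hl : L.IsLine k l) (hl' : L.IsLine k l') (C : ℤ) {q : List (I → K.Pt)}
    {x x' : K.Pt} (hx : K.IsVertex x) (hq : (K.sliced h).IsEdgePath x q x')
    {r : List (I → L.Pt)} (hr : (L.sliced k).IsEdgePath (l (C - h x)) r (l' (C - h x)))
    (hv : L.IsVertex (l (C - h x))) :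
    ((K.prod L).sliced (prodHeight h k)).HomotopicLE (lineGraph h l C x) (lineGraph h l' C x')
      (vpath x r ++ q.map (lineGraph h l' C ∘ ·))
      (q.map (lineGraph h l C ∘ ·) ++
        vpath x' (revPath (shadow h l C q) ++ (r ++ shadow h l' C q)))
      (30 * (r.length + 3 * q.length) ^ 2) := by
  have hx' := hx.of_isEdgePath hq
  have s1 := isEdgePath_shadow hK hl C hq
  have s2 := isEdgePath_shadow hK hl' C hq
  have s3 := (s1.revPath proper_sliced).append (hr.append s2)
  have p1 := (isEdgePath_vpath (h := h) hL hx hr).append (isEdgePath_lineGraph hK hl' C hq)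
  have p2 := (isEdgePath_lineGraph hK hl C hq).append (isEdgePath_vpath (h := h) hL hx' s3)
  refine homotopicLE_of_traces hK hL (hx.prodMk hv) p1 p2 (m := 0) (n := 0) ?_ ?_ ?_
  · rw [trace_append, trace_append, trace_vpath_fst, trace_vpath_fst, trace_lineGraph_fst _ _ hq,
      trace_lineGraph_fst _ _ hq, List.append_nil, List.nil_append]
    exact .refl hq
  · rw [trace_append, trace_append, trace_vpath_snd _ hr, trace_vpath_snd _ s3,
      trace_lineGraph_snd, trace_lineGraph_snd]
    have := (homotopicLE_append_revPath proper_sliced s1).append_right (hr.append s2)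
    simp only [List.append_assoc, List.nil_append] at this ⊢
    exact this.symm
  · have l1 := length_shadow_le (h := h) l C q
    have l2 := length_shadow_le (h := h) l' C q
    simp only [List.length_append, length_vpath, length_revPath, List.length_map, add_zero]
    have e1 : (r.length + q.length) ^ 2 ≤ (r.length + 3 * q.length) ^ 2 :=
      Nat.pow_le_pow_left (by omega) 2
    have e2 : (q.length + ((shadow h l C q).length + (r.length + (shadow h l' C q).length))) ^ 2 ≤
      (r.length + 3 * q.length) ^ 2 := Nat.pow_le_pow_left (by omega) 2
    linarith

/-- The section of a product `K × L` over `L`, at total height `C`, which moves along the line `l`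
in `K`. -/
def lineGraph' (k : L.Pt → ℝ) (l : ℝ → K.Pt) (C : ℤ) (p : L.Pt) : (K.prod L).Pt :=
  (l (C - k p), p)

lemma IsLine.isMorphism_lineGraph' (hK : K.IntegralHeight h) (hL : L.IntegralHeight k)
    {l : ℝ → K.Pt} (hl : K.IsLine h l) (C : ℤ) :
    (L.sliced k).IsMorphism ((K.prod L).sliced (prodHeight h k)) (lineGraph' k l C) := by
  have hswap : ((L.prod K).sliced (prodHeight k h)).IsMorphism
      ((K.prod L).sliced (prodHeight h k)) (fun p => (prSnd p, prFst p)) :=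
    isMorphism_of_equiv (hL.prod hK) (fun p => add_comm _ _)
      fun c => ⟨(c.2, c.1), Equiv.sumComm _ _, fun x => rfl⟩
  exact hswap.comp (hl.isMorphism_lineGraph hL C)

/-- A path in `L` with ends of the same height, compensated along a line in `K`, is homotopic to the
same path without compensation. -/
theorem homotopicLE_lineGraph' (hK : K.IntegralHeight h) (hL : L.IntegralHeight k)
    {l : ℝ → K.Pt} (hl : K.IsLine h l) (C : ℤ) {r : List (I → L.Pt)} {y y' : L.Pt}
    (hy : L.IsVertex y) (hr : (L.sliced k).IsEdgePath y r y') (hyy' : k y = k y')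
    (hv : K.IsVertex (l (C - k y))) :
    ((K.prod L).sliced (prodHeight h k)).HomotopicLE (l (C - k y), y) (l (C - k y), y')
      (vpath (l (C - k y)) r) (r.map (lineGraph' k l C ∘ ·)) (30 * r.length ^ 2) := by
  have hm := hl.isMorphism_lineGraph' hK hL C
  have p2 := hr.map hm.edges
  rw [show lineGraph' k l C y' = (l (C - k y), y') from
    Prod.ext (congrArg (fun s => l (C - s)) hyy'.symm) rfl] at p2
  refine homotopicLE_of_traces hK hL (hv.prodMk hy) (isEdgePath_vpath hL hv hr) p2
    (m := 0) (n := 0) ?_ ?_ ?_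
  · rw [trace_vpath_fst, trace_map]
    have := homotopicLE_shadow_nil hL hl C hy hr hyy'
    rw [← hyy'] at this
    exact this.symm
  · rw [trace_vpath_snd _ hr, trace_map, trace_eq_map (T := L.sliced k) nonconst_sliced]
    · have : r.map ((prSnd ∘ lineGraph' k l C) ∘ ·) = r := List.map_id _
      rw [this]
      exact .refl hr
    · exact hr.forall_edges
  · simp only [length_vpath, List.length_map]
    omega

end CubeComplex

/-! ### Charts of the zero level of a product of three complexes -/

namespace CubeComplex

open TwoSkeleton

variable {X₁ : CubeComplex.{u₁, v₁}} {X₂ : CubeComplex.{u₂, v₂}} {X₃ : CubeComplex.{u₃, v₃}}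
  {h₁ : X₁.Pt → ℝ} {h₂ : X₂.Pt → ℝ} {h₃ : X₃.Pt → ℝ}

/-- Every vertex lies on a line. -/
def HasLines (K : CubeComplex.{u, v}) (h : K.Pt → ℝ) : Prop :=
  ∀ p, K.IsVertex p → ∃ l, K.IsLine h l ∧ l (h p) = p

/-- The part of the zero level above the line `l` in the third factor, parametrized by the first two
factors. -/
def chart₃ (h₁ : X₁.Pt → ℝ) (h₂ : X₂.Pt → ℝ) (l : ℝ → X₃.Pt) (p : (X₁.prod X₂).Pt) :
    ((X₁.prod X₂).prod X₃).Pt :=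
  lineGraph (prodHeight h₁ h₂) l 0 p

/-- The part of the zero level above the line `l` in the second factor, parametrized by the other
two factors. -/
def chart₂ (h₁ : X₁.Pt → ℝ) (h₃ : X₃.Pt → ℝ) (l : ℝ → X₂.Pt) (p : (X₁.prod X₃).Pt) :
    ((X₁.prod X₂).prod X₃).Pt :=
  ((prFst p, l ((0 : ℤ) - prodHeight h₁ h₃ p)), prSnd p)

/-- The part of the zero level above the line `l` in the first factor, parametrized by the other
two factors. -/
def chart₁ (h₂ : X₂.Pt → ℝ) (h₃ : X₃.Pt → ℝ) (l : ℝ → X₁.Pt) (p : (X₂.prod X₃).Pt) :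
    ((X₁.prod X₂).prod X₃).Pt :=
  ((l ((0 : ℤ) - prodHeight h₂ h₃ p), prFst p), prSnd p)

lemma isMorphism_chart₃ (hX₁ : X₁.IntegralHeight h₁) (hX₂ : X₂.IntegralHeight h₂)
    {l : ℝ → X₃.Pt} (hl : X₃.IsLine h₃ l) :
    ((X₁.prod X₂).sliced (prodHeight h₁ h₂)).IsMorphism
      (((X₁.prod X₂).prod X₃).slicedZeroLevel (prodHeight (prodHeight h₁ h₂) h₃))
      (chart₃ h₁ h₂ l) :=
  (hl.isMorphism_lineGraph (hX₁.prod hX₂) 0).to_zeroLevel fun p => by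
    rw [hl.prodHeight_lineGraph, Int.cast_zero]

lemma isMorphism_perm₂ (hX₁ : X₁.IntegralHeight h₁) (hX₂ : X₂.IntegralHeight h₂)
    (hX₃ : X₃.IntegralHeight h₃) :
    (((X₁.prod X₂).prod X₃).sliced (prodHeight (prodHeight h₁ h₂) h₃)).IsMorphism
      (((X₁.prod X₃).prod X₂).sliced (prodHeight (prodHeight h₁ h₃) h₂))
      (fun p => ((p.1.1, p.2), p.1.2)) :=
  isMorphism_of_equiv ((hX₁.prod hX₂).prod hX₃)
    (fun p => by simp only [prodHeight]; ring)
    fun c => ⟨((c.1.1, c.2), c.1.2),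
      (Equiv.sumAssoc _ _ _).trans (((Equiv.refl _).sumCongr (Equiv.sumComm _ _)).trans
        (Equiv.sumAssoc _ _ _).symm), fun x => rfl⟩

lemma isMorphism_chart₂ (hX₁ : X₁.IntegralHeight h₁) (hX₂ : X₂.IntegralHeight h₂)
    (hX₃ : X₃.IntegralHeight h₃) {l : ℝ → X₂.Pt} (hl : X₂.IsLine h₂ l) :
    ((X₁.prod X₃).sliced (prodHeight h₁ h₃)).IsMorphism
      (((X₁.prod X₂).prod X₃).slicedZeroLevel (prodHeight (prodHeight h₁ h₂) h₃))
      (chart₂ h₁ h₃ l) := by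
  refine ((isMorphism_perm₂ hX₁ hX₃ hX₂).comp
    (hl.isMorphism_lineGraph (hX₁.prod hX₃) 0)).to_zeroLevel fun p => ?_
  change h₁ p.1 + h₂ (l ((0 : ℤ) - (h₁ p.1 + h₃ p.2))) + h₃ p.2 = 0
  rw [hl.height, Int.cast_zero]
  ring

lemma isMorphism_perm₁ (hX₁ : X₁.IntegralHeight h₁) (hX₂ : X₂.IntegralHeight h₂)
    (hX₃ : X₃.IntegralHeight h₃) :
    (((X₂.prod X₃).prod X₁).sliced (prodHeight (prodHeight h₂ h₃) h₁)).IsMorphism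
      (((X₁.prod X₂).prod X₃).sliced (prodHeight (prodHeight h₁ h₂) h₃))
      (fun p => ((p.2, p.1.1), p.1.2)) :=
  isMorphism_of_equiv ((hX₂.prod hX₃).prod hX₁)
    (fun p => by simp only [prodHeight]; ring)
    fun c => ⟨((c.2, c.1.1), c.1.2),
      (Equiv.sumAssoc _ _ _).trans (Equiv.sumComm _ _), fun x => rfl⟩

lemma isMorphism_chart₁ (hX₁ : X₁.IntegralHeight h₁) (hX₂ : X₂.IntegralHeight h₂)
    (hX₃ : X₃.IntegralHeight h₃) {l : ℝ → X₁.Pt} (hl : X₁.IsLine h₁ l) :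
    ((X₂.prod X₃).sliced (prodHeight h₂ h₃)).IsMorphism
      (((X₁.prod X₂).prod X₃).slicedZeroLevel (prodHeight (prodHeight h₁ h₂) h₃))
      (chart₁ h₂ h₃ l) := by
  refine ((isMorphism_perm₁ hX₁ hX₂ hX₃).comp
    (hl.isMorphism_lineGraph (hX₂.prod hX₃) 0)).to_zeroLevel fun p => ?_
  change h₁ (l ((0 : ℤ) - (h₂ p.1 + h₃ p.2))) + h₂ p.1 + h₃ p.2 = 0
  rw [hl.height, Int.cast_zero]
  ring

lemma map_comp_congr {P Q Q' R : Type*} {φ : P → Q} {ψ : Q → R} {φ' : P → Q'} {ψ' : Q' → R}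
    (hφ : ∀ x, ψ (φ x) = ψ' (φ' x)) (p : List (I → P)) :
    (p.map (φ ∘ ·)).map (ψ ∘ ·) = (p.map (φ' ∘ ·)).map (ψ' ∘ ·) := by
  rw [List.map_map, List.map_map]
  refine List.map_congr_left fun e _ => funext fun t => hφ _

section Exchange

variable {x x' : X₁.Pt} {y y' : X₂.Pt} {z z' : X₃.Pt} {ν ν' : ℝ → X₁.Pt} {μ : ℝ → X₂.Pt}
  {l l' : ℝ → X₃.Pt} {p : List (I → X₁.Pt)} {q : List (I → X₂.Pt)} {r : List (I → X₃.Pt)}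

lemma chart₁_apply (hνx : ν (h₁ x) = x) (h0 : h₁ x + h₂ y + h₃ z = 0) :
    chart₁ h₂ h₃ ν (y, z) = ((x, y), z) := by
  have : ((0 : ℤ) : ℝ) - (h₂ y + h₃ z) = h₁ x := by push_cast; linarith
  simp only [chart₁, prodHeight, prFst, prSnd, this, hνx]
  rfl

lemma chart₂_apply (hμy : μ (h₂ y) = y) (h0 : h₁ x + h₂ y + h₃ z = 0) :
    chart₂ h₁ h₃ μ (x, z) = ((x, y), z) := by
  have : ((0 : ℤ) : ℝ) - (h₁ x + h₃ z) = h₂ y := by push_cast; linarith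
  simp only [chart₂, prodHeight, prFst, prSnd, this, hμy]
  rfl

/-- A path in the third factor can be compensated in the first or in the second factor. -/
theorem homotopicLE_switch (hX₁ : X₁.IntegralHeight h₁) (hX₂ : X₂.IntegralHeight h₂)
    (hX₃ : X₃.IntegralHeight h₃) (hν : X₁.IsLine h₁ ν) (hμ : X₂.IsLine h₂ μ)
    (hx : X₁.IsVertex x) (hy : X₂.IsVertex y) (hz : X₃.IsVertex z) (hνx : ν (h₁ x) = x)
    (hμy : μ (h₂ y) = y) (hr : (X₃.sliced h₃).IsEdgePath z r z')
    (h0 : h₁ x + h₂ y + h₃ z = 0) (h0' : h₁ x + h₂ y + h₃ z' = 0) :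
    (((X₁.prod X₂).prod X₃).slicedZeroLevel (prodHeight (prodHeight h₁ h₂) h₃)).HomotopicLE
      ((x, y), z) ((x, y), z') ((vpath y r).map (chart₁ h₂ h₃ ν ∘ ·))
      ((vpath x r).map (chart₂ h₁ h₃ μ ∘ ·)) (30 * r.length ^ 2) := by
  obtain ⟨n, hn⟩ := hx.exists_height_eq hX₁
  have hy0 : μ ((-n : ℤ) - h₃ z) = y := by
    rw [← hμy]
    congr 1
    push_cast
    linarith
  have e1 := homotopicLE_lineGraph' hX₂ hX₃ hμ (-n) hz hr (by linarith) (hy0.symm ▸ hy)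
  rw [hy0] at e1
  have e2 := e1.map (isMorphism_chart₁ hX₁ hX₂ hX₃ hν)
  rw [chart₁_apply hνx h0, chart₁_apply hνx h0'] at e2
  refine (congrArg (fun s => HomotopicLE _ _ _ _ s _) ?_).mpr e2
  refine map_comp_congr (fun w => ?_) r
  simp only [chart₁, chart₂, lineGraph', prFst, prSnd, mkRight, prodHeight, hμ.height, hn]
  refine Prod.ext (Prod.ext ?_ ?_) rfl
  · simp only
    rw [← hνx, hn]
    congr 1
    push_cast
    ring
  · simp only
    congr 1
    push_cast
    ring

lemma int_sub_height {K : CubeComplex.{u, v}} {h : K.Pt → ℝ} {c : ℝ} {n : ℤ} (hn : c = n)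
    (w : K.Pt) : ((-n : ℤ) : ℝ) - h w = -(c + h w) := by
  rw [hn]; push_cast; ring

lemma chart₁_lineGraph (hνx : ν (h₁ x) = x) (hl : X₃.IsLine h₃ l) {n : ℤ} (hn : h₁ x = n)
    (w : X₂.Pt) :
    chart₁ h₂ h₃ ν (lineGraph h₂ l (-n) w) = ((x, w), l (-(h₁ x + h₂ w))) := by
  rw [lineGraph, int_sub_height hn]
  exact chart₁_apply hνx (by rw [hl.height]; ring)

lemma map_chart₁_lineGraph (hνx : ν (h₁ x) = x) (hl : X₃.IsLine h₃ l) {n : ℤ} (hn : h₁ x = n)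
    (q : List (I → X₂.Pt)) :
    (q.map (lineGraph h₂ l (-n) ∘ ·)).map (chart₁ h₂ h₃ ν ∘ ·) =
      (vpath x q).map (chart₃ h₁ h₂ l ∘ ·) := by
  refine map_comp_congr (fun w => ?_) q
  rw [chart₁_lineGraph hνx hl hn, chart₃, lineGraph]
  simp only [mkRight, prodHeight, Int.cast_zero, zero_sub]
  rfl

lemma shadow_vpath (l : ℝ → X₃.Pt) {n : ℤ} (hn : h₁ x = n) (q : List (I → X₂.Pt)) :
    shadow (prodHeight h₁ h₂) l 0 (vpath x q) = shadow h₂ l (-n) q := by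
  rw [shadow, vpath, trace_map, shadow]
  congr 1
  funext w
  simp only [Function.comp_apply, int_sub_height hn, prodHeight, mkRight]
  congr 1
  push_cast
  ring

lemma chart₂_lineGraph (hμy : μ (h₂ y) = y) (hl : X₃.IsLine h₃ l) {n : ℤ} (hn : h₂ y = n)
    (w : X₁.Pt) :
    chart₂ h₁ h₃ μ (lineGraph h₁ l (-n) w) = ((w, y), l (-(h₁ w + h₂ y))) := by
  rw [lineGraph, int_sub_height hn, add_comm]
  exact chart₂_apply hμy (by rw [hl.height]; ring)

lemma map_chart₂_lineGraph (hμy : μ (h₂ y) = y) (hl : X₃.IsLine h₃ l) {n : ℤ} (hn : h₂ y = n)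
    (p : List (I → X₁.Pt)) :
    (p.map (lineGraph h₁ l (-n) ∘ ·)).map (chart₂ h₁ h₃ μ ∘ ·) =
      (hpath p y).map (chart₃ h₁ h₂ l ∘ ·) := by
  refine map_comp_congr (fun w => ?_) p
  rw [chart₂_lineGraph hμy hl hn, chart₃, lineGraph]
  simp only [mkLeft, prodHeight, Int.cast_zero, zero_sub]
  rfl

lemma shadow_hpath (l : ℝ → X₃.Pt) {n : ℤ} (hn : h₂ y = n) (p : List (I → X₁.Pt)) :
    shadow (prodHeight h₁ h₂) l 0 (hpath p y) = shadow h₁ l (-n) p := by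
  rw [shadow, hpath, trace_map, shadow]
  congr 1
  funext w
  simp only [Function.comp_apply, int_sub_height hn, prodHeight, mkLeft]
  congr 1
  push_cast
  ring

/-- Exchange of a path in the second factor with one in the third factor. -/
theorem homotopicLE_exchange_snd (hX₁ : X₁.IntegralHeight h₁) (hX₂ : X₂.IntegralHeight h₂)
    (hX₃ : X₃.IntegralHeight h₃) (hν : X₁.IsLine h₁ ν) (hl : X₃.IsLine h₃ l)
    (hl' : X₃.IsLine h₃ l') (hx : X₁.IsVertex x) (hνx : ν (h₁ x) = x) (hy : X₂.IsVertex y)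
    (hq : (X₂.sliced h₂).IsEdgePath y q y')
    (hr : (X₃.sliced h₃).IsEdgePath (l (-(h₁ x + h₂ y))) r (l' (-(h₁ x + h₂ y))))
    (hv : X₃.IsVertex (l (-(h₁ x + h₂ y)))) :
    (((X₁.prod X₂).prod X₃).slicedZeroLevel (prodHeight (prodHeight h₁ h₂) h₃)).HomotopicLE
      ((x, y), l (-(h₁ x + h₂ y))) ((x, y'), l' (-(h₁ x + h₂ y')))
      ((vpath y r).map (chart₁ h₂ h₃ ν ∘ ·) ++ (vpath x q).map (chart₃ h₁ h₂ l' ∘ ·))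
      ((vpath x q).map (chart₃ h₁ h₂ l ∘ ·) ++
        (vpath y' (revPath (shadow (prodHeight h₁ h₂) l 0 (vpath x q)) ++
          (r ++ shadow (prodHeight h₁ h₂) l' 0 (vpath x q)))).map (chart₁ h₂ h₃ ν ∘ ·))
      (30 * (r.length + 3 * q.length) ^ 2) := by
  obtain ⟨n, hn⟩ := hx.exists_height_eq hX₁
  rw [← int_sub_height hn] at hr hv
  have e1 := (homotopicLE_exchange hX₂ hX₃ hl hl' (-n) hy hq hr hv).map
    (isMorphism_chart₁ hX₁ hX₂ hX₃ hν)
  rw [chart₁_lineGraph hνx hl hn, chart₁_lineGraph hνx hl' hn, List.map_append, List.map_append,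
    map_chart₁_lineGraph hνx hl hn, map_chart₁_lineGraph hνx hl' hn, ← shadow_vpath l hn,
    ← shadow_vpath l' hn] at e1
  exact e1

/-- Exchange of a path in the first factor with one in the third factor. -/
theorem homotopicLE_exchange_fst (hX₁ : X₁.IntegralHeight h₁) (hX₂ : X₂.IntegralHeight h₂)
    (hX₃ : X₃.IntegralHeight h₃) (hμ : X₂.IsLine h₂ μ) (hl : X₃.IsLine h₃ l)
    (hl' : X₃.IsLine h₃ l') (hy : X₂.IsVertex y) (hμy : μ (h₂ y) = y) (hx : X₁.IsVertex x)
    (hp : (X₁.sliced h₁).IsEdgePath x p x')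
    (hr : (X₃.sliced h₃).IsEdgePath (l (-(h₁ x + h₂ y))) r (l' (-(h₁ x + h₂ y))))
    (hv : X₃.IsVertex (l (-(h₁ x + h₂ y)))) :
    (((X₁.prod X₂).prod X₃).slicedZeroLevel (prodHeight (prodHeight h₁ h₂) h₃)).HomotopicLE
      ((x, y), l (-(h₁ x + h₂ y))) ((x', y), l' (-(h₁ x' + h₂ y)))
      ((vpath x r).map (chart₂ h₁ h₃ μ ∘ ·) ++ (hpath p y).map (chart₃ h₁ h₂ l' ∘ ·))
      ((hpath p y).map (chart₃ h₁ h₂ l ∘ ·) ++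
        (vpath x' (revPath (shadow (prodHeight h₁ h₂) l 0 (hpath p y)) ++
          (r ++ shadow (prodHeight h₁ h₂) l' 0 (hpath p y)))).map (chart₂ h₁ h₃ μ ∘ ·))
      (30 * (r.length + 3 * p.length) ^ 2) := by
  obtain ⟨n, hn⟩ := hy.exists_height_eq hX₂
  rw [add_comm, ← int_sub_height hn] at hr hv
  have e1 := (homotopicLE_exchange hX₁ hX₃ hl hl' (-n) hx hp hr hv).map
    (isMorphism_chart₂ hX₁ hX₂ hX₃ hμ)
  rw [chart₂_lineGraph hμy hl hn, chart₂_lineGraph hμy hl' hn, List.map_append, List.map_append,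
    map_chart₂_lineGraph hμy hl hn, map_chart₂_lineGraph hμy hl' hn, ← shadow_hpath l hn,
    ← shadow_hpath l' hn] at e1
  exact e1

end Exchange

end CubeComplex

/-! ### Exchange of paths in the zero level -/

namespace CubeComplex

open TwoSkeleton

variable {X₁ : CubeComplex.{u₁, v₁}} {X₂ : CubeComplex.{u₂, v₂}} {X₃ : CubeComplex.{u₃, v₃}}
  {h₁ : X₁.Pt → ℝ} {h₂ : X₂.Pt → ℝ} {h₃ : X₃.Pt → ℝ}

section

variable {x x' : X₁.Pt} {y y' : X₂.Pt} {z z' : X₃.Pt} {ν ν' : ℝ → X₁.Pt} {μ : ℝ → X₂.Pt}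
  {l l' : ℝ → X₃.Pt} {k : List (I → (X₁.prod X₂).Pt)} {r : List (I → X₃.Pt)}

lemma zero_sub_prodHeight (x : X₁.Pt) (y : X₂.Pt) :
    ((0 : ℤ) : ℝ) - prodHeight h₁ h₂ ((x, y) : (X₁.prod X₂).Pt) = -(h₁ x + h₂ y) := by
  simp only [prodHeight, Int.cast_zero, zero_sub]

lemma chart₃_apply (l : ℝ → X₃.Pt) (x : X₁.Pt) (y : X₂.Pt) :
    chart₃ h₁ h₂ l (x, y) = ((x, y), l (-(h₁ x + h₂ y))) := by
  change ((x, y), l (((0 : ℤ) : ℝ) - prodHeight h₁ h₂ ((x, y) : (X₁.prod X₂).Pt))) = _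
  rw [zero_sub_prodHeight]

lemma isEdgePath_shadow_prod (hX₁ : X₁.IntegralHeight h₁) (hX₂ : X₂.IntegralHeight h₂)
    (hl : X₃.IsLine h₃ l)
    (hk : ((X₁.prod X₂).sliced (prodHeight h₁ h₂)).IsEdgePath (x, y) k (x', y')) :
    (X₃.sliced h₃).IsEdgePath (l (-(h₁ x + h₂ y))) (shadow (prodHeight h₁ h₂) l 0 k)
      (l (-(h₁ x' + h₂ y'))) := by
  have := isEdgePath_shadow (hX₁.prod hX₂) hl 0 hk
  rwa [zero_sub_prodHeight, zero_sub_prodHeight] at this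

lemma homotopicLE_shadow_prod (hX₁ : X₁.IntegralHeight h₁) (hX₂ : X₂.IntegralHeight h₂)
    (hl : X₃.IsLine h₃ l) (hx : X₁.IsVertex x) (hy : X₂.IsVertex y)
    (hk : ((X₁.prod X₂).sliced (prodHeight h₁ h₂)).IsEdgePath (x, y) k (x', y'))
    {k' : List (I → (X₁.prod X₂).Pt)}
    (hk' : ((X₁.prod X₂).sliced (prodHeight h₁ h₂)).IsEdgePath (x, y) k' (x', y')) :
    (X₃.sliced h₃).HomotopicLE (l (-(h₁ x + h₂ y))) (l (-(h₁ x' + h₂ y')))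
      (shadow (prodHeight h₁ h₂) l 0 k) (shadow (prodHeight h₁ h₂) l 0 k') 0 := by
  have := homotopicLE_shadow (hX₁.prod hX₂) hl 0 (hx.prodMk hy) hk hk' rfl rfl
  rwa [zero_sub_prodHeight, zero_sub_prodHeight] at this

lemma IsLine.isVertex (hl : X₃.IsLine h₃ l) (n : ℤ) : X₃.IsVertex (l n) := by
  simpa [lineEdge] using IsVertex.of_mem_edges (hl.lineEdge_mem n)

lemma IsLine.isVertex_neg (hX₁ : X₁.IntegralHeight h₁) (hX₂ : X₂.IntegralHeight h₂)
    (hl : X₃.IsLine h₃ l) (hx : X₁.IsVertex x) (hy : X₂.IsVertex y) :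
    X₃.IsVertex (l (-(h₁ x + h₂ y))) := by
  obtain ⟨n, hn⟩ := hx.exists_height_eq hX₁
  obtain ⟨m, hm⟩ := hy.exists_height_eq hX₂
  have := hl.isVertex (-(n + m))
  rw [hn, hm]
  exact_mod_cast this

/-- A homotopy in the third factor, lifted to a chart. -/
lemma homotopicLE_chart₁ (hX₁ : X₁.IntegralHeight h₁) (hX₂ : X₂.IntegralHeight h₂)
    (hX₃ : X₃.IntegralHeight h₃) (hν : X₁.IsLine h₁ ν) (hy : X₂.IsVertex y)
    (hνx : ν (h₁ x) = x) (h0 : h₁ x + h₂ y + h₃ z = 0) (h0' : h₁ x + h₂ y + h₃ z' = 0)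
    {s : List (I → X₃.Pt)} {n : ℕ} (hr : (X₃.sliced h₃).HomotopicLE z z' r s n) :
    (((X₁.prod X₂).prod X₃).slicedZeroLevel (prodHeight (prodHeight h₁ h₂) h₃)).HomotopicLE
      ((x, y), z) ((x, y), z') ((vpath y r).map (chart₁ h₂ h₃ ν ∘ ·))
      ((vpath y s).map (chart₁ h₂ h₃ ν ∘ ·)) n := by
  have := (homotopicLE_vpath (h := h₂) hX₃ hy hr).map (isMorphism_chart₁ hX₁ hX₂ hX₃ hν)
  rwa [chart₁_apply hνx h0, chart₁_apply hνx h0'] at this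

lemma isEdgePath_chart₁ (hX₁ : X₁.IntegralHeight h₁) (hX₂ : X₂.IntegralHeight h₂)
    (hX₃ : X₃.IntegralHeight h₃) (hν : X₁.IsLine h₁ ν) (hy : X₂.IsVertex y)
    (hνx : ν (h₁ x) = x) (h0 : h₁ x + h₂ y + h₃ z = 0) (h0' : h₁ x + h₂ y + h₃ z' = 0)
    (hr : (X₃.sliced h₃).IsEdgePath z r z') :
    (((X₁.prod X₂).prod X₃).slicedZeroLevel (prodHeight (prodHeight h₁ h₂) h₃)).IsEdgePath
      ((x, y), z) ((vpath y r).map (chart₁ h₂ h₃ ν ∘ ·)) ((x, y), z') :=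
  (homotopicLE_chart₁ (n := 0) hX₁ hX₂ hX₃ hν hy hνx h0 h0' (.refl hr)).left
    proper_slicedZeroLevel

lemma homotopicLE_chart₃ (hX₁ : X₁.IntegralHeight h₁) (hX₂ : X₂.IntegralHeight h₂)
    (hl : X₃.IsLine h₃ l) {k' : List (I → (X₁.prod X₂).Pt)} {n : ℕ}
    (hk : ((X₁.prod X₂).sliced (prodHeight h₁ h₂)).HomotopicLE (x, y) (x', y') k k' n) :
    (((X₁.prod X₂).prod X₃).slicedZeroLevel (prodHeight (prodHeight h₁ h₂) h₃)).HomotopicLE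
      ((x, y), l (-(h₁ x + h₂ y))) ((x', y'), l (-(h₁ x' + h₂ y')))
      (k.map (chart₃ h₁ h₂ l ∘ ·)) (k'.map (chart₃ h₁ h₂ l ∘ ·)) n := by
  have := hk.map (isMorphism_chart₃ hX₁ hX₂ hl)
  rwa [chart₃_apply, chart₃_apply] at this

/-- A path `r` in the third factor, followed by a path `k` in the first two factors with
compensation along the line `l'`, can be replaced by the path `k` with compensation along the line
`l`, followed by the path `r` extended by the shadows of `k`. -/
theorem homotopicLE_exchange_prod (hX₁ : X₁.IntegralHeight h₁) (hX₂ : X₂.IntegralHeight h₂)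
    (hX₃ : X₃.IntegralHeight h₃) (hlines : X₂.HasLines h₂) (hν : X₁.IsLine h₁ ν)
    (hν' : X₁.IsLine h₁ ν') (hl : X₃.IsLine h₃ l) (hl' : X₃.IsLine h₃ l') (hx : X₁.IsVertex x)
    (hy : X₂.IsVertex y) (hνx : ν (h₁ x) = x) (hνx' : ν' (h₁ x') = x')
    (hk : ((X₁.prod X₂).sliced (prodHeight h₁ h₂)).IsEdgePath (x, y) k (x', y'))
    (hr : (X₃.sliced h₃).IsEdgePath (l (-(h₁ x + h₂ y))) r (l' (-(h₁ x + h₂ y)))) :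
    (((X₁.prod X₂).prod X₃).slicedZeroLevel (prodHeight (prodHeight h₁ h₂) h₃)).HomotopicLE
      ((x, y), l (-(h₁ x + h₂ y))) ((x', y'), l' (-(h₁ x' + h₂ y')))
      ((vpath y r).map (chart₁ h₂ h₃ ν ∘ ·) ++ k.map (chart₃ h₁ h₂ l' ∘ ·))
      (k.map (chart₃ h₁ h₂ l ∘ ·) ++
        (vpath y' (revPath (shadow (prodHeight h₁ h₂) l 0 k) ++
          (r ++ shadow (prodHeight h₁ h₂) l' 0 k))).map (chart₁ h₂ h₃ ν' ∘ ·))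
      (150 * (r.length + 5 * k.length) ^ 2) := by
  have hS := proper_slicedZeroLevel (K := (X₁.prod X₂).prod X₃)
    (h := prodHeight (prodHeight h₁ h₂) h₃)
  have hlevel : ∀ {l : ℝ → X₃.Pt}, X₃.IsLine h₃ l → ∀ x y,
      h₁ x + h₂ y + h₃ (l (-(h₁ x + h₂ y))) = 0 := fun hl x y => by rw [hl.height]; ring
  obtain ⟨μ, hμ, hμy⟩ := hlines y hy
  have hxy : (X₁.prod X₂).IsVertex (x, y) := hx.prodMk hy
  have hp : (X₁.sliced h₁).IsEdgePath x (trace prFst k) x' := isEdgePath_trace_fst hk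
  have hq : (X₂.sliced h₂).IsEdgePath y (trace prSnd k) y' := isEdgePath_trace_snd hk
  have hkk' := homotopicLE_traces hX₁ hX₂ hxy hk
  have lp : (trace (prFst (K := X₁) (L := X₂)) k).length ≤ k.length := length_trace_le _ _
  have lq : (trace (prSnd (K := X₁) (L := X₂)) k).length ≤ k.length := length_trace_le _ _
  change HomotopicLE _ _ _ _ (hpath (trace prFst k) y ++ vpath x' (trace prSnd k)) _ at hkk'
  set p := trace prFst k
  set q := trace prSnd k
  have hx' := hx.of_isEdgePath hp
  have hy' := hy.of_isEdgePath hq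
  have hph : ((X₁.prod X₂).sliced (prodHeight h₁ h₂)).IsEdgePath (x, y) (hpath p y) (x', y) :=
    isEdgePath_hpath hX₁ hy hp
  have hqv : ((X₁.prod X₂).sliced (prodHeight h₁ h₂)).IsEdgePath (x', y) (vpath x' q) (x', y') :=
    isEdgePath_vpath hX₂ hx' hq
  have hk' := hph.append hqv
  have hr' := ((isEdgePath_shadow_prod hX₁ hX₂ hl hph).revPath proper_sliced).append
    (hr.append (isEdgePath_shadow_prod hX₁ hX₂ hl' hph))
  set r' := revPath (shadow (prodHeight h₁ h₂) l 0 (hpath p y)) ++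
    (r ++ shadow (prodHeight h₁ h₂) l' 0 (hpath p y)) with hr'def
  have lr' : r'.length ≤ r.length + 2 * k.length := by
    have e1 := length_shadow_le (h := prodHeight h₁ h₂) l 0 (hpath p y)
    have e2 := length_shadow_le (h := prodHeight h₁ h₂) l' 0 (hpath p y)
    rw [length_hpath] at e1 e2
    simp only [hr'def, List.length_append, length_revPath]
    omega
  have s0 := homotopicLE_chart₃ hX₁ hX₂ hl' hkk'
  have s1 := homotopicLE_switch hX₁ hX₂ hX₃ hν hμ hx hy (hl.isVertex_neg hX₁ hX₂ hx hy) hνx hμy hr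
    (hlevel hl x y) (hlevel hl' x y)
  have s2 := homotopicLE_exchange_fst hX₁ hX₂ hX₃ hμ hl hl' hy hμy hx hp hr
    (hl.isVertex_neg hX₁ hX₂ hx hy)
  have s3 := homotopicLE_switch hX₁ hX₂ hX₃ hν' hμ hx' hy (hl.isVertex_neg hX₁ hX₂ hx' hy) hνx' hμy
    hr' (hlevel hl x' y) (hlevel hl' x' y)
  have s4 := homotopicLE_exchange_snd hX₁ hX₂ hX₃ hν' hl hl' hx' hνx' hy hq hr'
    (hl.isVertex_neg hX₁ hX₂ hx' hy)
  have b1 : (r.length + 3 * p.length) ^ 2 ≤ (r.length + 5 * k.length) ^ 2 :=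
    Nat.pow_le_pow_left (by omega) 2
  have b2 : r'.length ^ 2 ≤ (r.length + 5 * k.length) ^ 2 :=
    Nat.pow_le_pow_left (by omega) 2
  have b3 : (r'.length + 3 * q.length) ^ 2 ≤ (r.length + 5 * k.length) ^ 2 :=
    Nat.pow_le_pow_left (by omega) 2
  have b4 : 30 * r.length ^ 2 + 30 * k.length ^ 2 ≤ 30 * (r.length + 5 * k.length) ^ 2 := by
    nlinarith
  replace s2 := s2.mono (Nat.mul_le_mul_left 30 b1)
  replace s3 := s3.mono (Nat.mul_le_mul_left 30 b2)
  replace s4 := s4.mono (Nat.mul_le_mul_left 30 b3)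
  have p1 := (homotopicLE_chart₃ (n := 0) hX₁ hX₂ hl (.refl hph)).left hS
  have p2 := (homotopicLE_chart₃ (n := 0) hX₁ hX₂ hl' (.refl hqv)).left hS
  have c0 := s0.append_left (s1.left hS)
  have c1 := s1.append_right (s0.right hS)
  have c2 := s2.append_right p2
  have c3 := s3.symm.congr_mid p1 p2
  have c4 := s4.append_left p1
  -- back from `hpath p y ++ vpath x' q` to `k`, also in the shadows
  have c5 := homotopicLE_chart₃ hX₁ hX₂ hl hkk'.symm
  have c6 := ((homotopicLE_shadow_prod hX₁ hX₂ hl hx hy hk' hk).revPath proper_sliced).append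
    proper_sliced ((homotopicLE_shadow_prod hX₁ hX₂ hl' hx hy hk' hk).append_left hr)
  have c7 := homotopicLE_chart₁ hX₁ hX₂ hX₃ hν' hy' hνx' (hlevel hl x' y') (hlevel hl' x' y') c6
  have c8 := c5.append hS c7
  simp only [List.map_append, vpath_append, shadow_append, revPath_append, List.append_assoc,
    hr'def] at c0 c1 c2 c3 c4 c8 ⊢
  have c := ((((c0.trans c1).trans c2).trans c3).trans c4).trans c8
  refine c.mono ?_
  have arith : ∀ a b T : ℕ, 30 * b + 30 * a ≤ 30 * T →
      15 * a + 30 * b + 30 * T + 30 * T + 30 * T + (15 * a + (0 + 0)) ≤ 150 * T := by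
    intros
    omega
  exact arith _ _ _ b4

end

end CubeComplex

namespace CubeComplex

open TwoSkeleton

/-! ### Normal forms of edge paths in the zero level -/

section TwoFactors

variable {K : CubeComplex.{u, v}} {h : K.Pt → ℝ} {L : CubeComplex.{u₁, v₁}} {k : L.Pt → ℝ}

/-- A path in a product of two complexes is homotopic to its projection to the first factor, with
height compensated along the line `l`, followed by a path in the second factor. -/
lemma homotopicLE_lineGraph_append (hK : K.IntegralHeight h) (hL : L.IntegralHeight k)
    {l : ℝ → L.Pt} (hl : L.IsLine k l) (C : ℤ) {x x' : K.Pt} {y y' : L.Pt} (hx : K.IsVertex x)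
    (hy : L.IsVertex y) (hly : l (C - h x) = y) {P : List (I → (K.prod L).Pt)}
    (hP : ((K.prod L).sliced (prodHeight h k)).IsEdgePath (x, y) P (x', y')) :
    ((K.prod L).sliced (prodHeight h k)).HomotopicLE (x, y) (x', y') P
      ((trace prFst P).map (lineGraph h l C ∘ ·) ++
        vpath x' (revPath (shadow h l C (trace prFst P)) ++ trace prSnd P))
      (150 * P.length ^ 2) := by
  have hq : (K.sliced h).IsEdgePath x (trace prFst P) x' := isEdgePath_trace_fst hP
  have hs : (L.sliced k).IsEdgePath y (trace prSnd P) y' := isEdgePath_trace_snd hP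
  have lq : (trace (prFst (K := K) (L := L)) P).length ≤ P.length := length_trace_le _ _
  have ls : (trace (prSnd (K := K) (L := L)) P).length ≤ P.length := length_trace_le _ _
  set q := trace prFst P
  set s := trace prSnd P
  have hsh := isEdgePath_shadow hK hl C hq
  have ht := isEdgePath_lineGraph hK hl C hq
  rw [lineGraph, hly] at ht
  rw [hly] at hsh
  have hrs := (hsh.revPath proper_sliced).append hs
  have hR := ht.append (isEdgePath_vpath (h := h) hL (hx.of_isEdgePath hq) hrs)
  have lsh := length_shadow_le (h := h) l C q
  refine homotopicLE_of_traces (m := 0) (n := 0) hK hL (hx.prodMk hy) hP hR ?_ ?_ ?_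
  · rw [trace_append, trace_lineGraph_fst l C hq, trace_vpath_fst, List.append_nil]
    exact .refl hq
  · rw [trace_append, trace_lineGraph_snd, trace_vpath_snd _ hrs, ← List.append_assoc]
    exact ((homotopicLE_append_revPath proper_sliced hsh).append_right hs).symm
  · have : (q.map (lineGraph h l C ∘ ·) ++ vpath x' (revPath (shadow h l C q) ++ s)).length ≤
        3 * P.length := by
      simp only [List.length_append, List.length_map, length_vpath, length_revPath]
      omega
    have := Nat.pow_le_pow_left this 2
    linarith [mul_pow 3 P.length 2]

end TwoFactors

variable {X₁ : CubeComplex.{u₁, v₁}} {X₂ : CubeComplex.{u₂, v₂}} {X₃ : CubeComplex.{u₃, v₃}}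
  {h₁ : X₁.Pt → ℝ} {h₂ : X₂.Pt → ℝ} {h₃ : X₃.Pt → ℝ}

/-- The normal form of a path `γ` in the zero level: the projection of `γ` to the first two factors,
compensated along the line `l` in the third factor, followed by a path in the third factor which is
compensated along the line `ν` in the first factor. The line `l` passes through the third coordinate
of the start of `γ`, the line `ν` through the first coordinate of its end, and `y'` is the second
coordinate of its end. -/
noncomputable def normalForm (h₁ : X₁.Pt → ℝ) (h₂ : X₂.Pt → ℝ) (h₃ : X₃.Pt → ℝ) (l : ℝ → X₃.Pt)
    (ν : ℝ → X₁.Pt) (y' : X₂.Pt) (γ : List (I → ((X₁.prod X₂).prod X₃).Pt)) :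
    List (I → ((X₁.prod X₂).prod X₃).Pt) :=
  (trace prFst γ).map (chart₃ h₁ h₂ l ∘ ·) ++
    (vpath y' (revPath (shadow (prodHeight h₁ h₂) l 0 (trace prFst γ)) ++ trace prSnd γ)).map
      (chart₁ h₂ h₃ ν ∘ ·)

/-- Every edge in a product of three complexes is constant in at least one coordinate. -/
lemma exists_const_of_mem_edges {g : I → ((X₁.prod X₂).prod X₃).Pt}
    (hg : g ∈ (((X₁.prod X₂).prod X₃).sliced (prodHeight (prodHeight h₁ h₂) h₃)).edges) :
    (∀ t, prSnd (g t) = prSnd (g 0)) ∨ (∀ t, prFst (prFst (g t)) = prFst (prFst (g 0))) ∨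
      ∀ t, prSnd (prFst (g t)) = prSnd (prFst (g 0)) := by
  rcases mem_sliced_prod_edges hg with h | h | ⟨⟨c₁, c₂⟩, d, a, b, a', b', h1, -, -, rfl⟩
  · exact .inl h.2
  · exact .inr (.inl fun t => congrArg prFst (h.2 t))
  · obtain ⟨a₁, a₂, rfl⟩ : ∃ (a₁ : X₁.Dir c₁ → Bool) (a₂ : X₂.Dir c₂ → Bool),
        a = Sum.elim a₁ a₂ := ⟨_, _, (Sum.elim_comp_inl_inr a).symm⟩
    obtain ⟨b₁, b₂, rfl⟩ : ∃ (b₁ : X₁.Dir c₁ → Bool) (b₂ : X₂.Dir c₂ → Bool),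
        b = Sum.elim b₁ b₂ := ⟨_, _, (Sum.elim_comp_inl_inr b).symm⟩
    have := X₁.finite_dir c₁
    have := X₂.finite_dir c₂
    replace h1 := (ncard_sum (Sum.elim a₁ a₂) (Sum.elim b₁ b₂)).symm.trans h1
    by_cases h2 : {i | a₁ i ≠ b₁ i}.ncard = 0
    · obtain rfl := ncard_ne_eq_zero h2
      refine .inr (.inl fun t => ?_)
      change X₁.edge c₁ a₁ a₁ t = X₁.edge c₁ a₁ a₁ 0
      simp [edge]
    · have h3 : {i | a₂ i ≠ b₂ i}.ncard = 0 := by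
        simp only [Sum.elim_inl, Sum.elim_inr] at h1
        omega
      obtain rfl := ncard_ne_eq_zero h3
      refine .inr (.inr fun t => ?_)
      change X₂.edge c₂ a₂ a₂ t = X₂.edge c₂ a₂ a₂ 0
      simp [edge]

lemma trace_comp_injective {P Q R : Type*} {φ : P → Q} {ψ : Q → R} (hψ : Function.Injective ψ)
    (p : List (I → P)) : trace (ψ ∘ φ) p = (trace φ p).map (ψ ∘ ·) := by
  induction p with
  | nil => rfl
  | cons e p ih =>
    rw [trace_cons, ih, trace_cons φ, List.map_append]
    congr 1
    by_cases hc : ∀ t, φ (e t) = φ (e 0)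
    · rw [trace_singleton_of_const hc,
        trace_singleton_of_const (φ := ψ ∘ φ) fun t => congrArg ψ (hc t)]
      rfl
    · obtain ⟨t, ht⟩ := not_forall.1 hc
      rw [trace_singleton_of_ne ht, trace_singleton_of_ne (t := t) fun h => ht (hψ h)]
      rfl

lemma trace_singleton_congr {P Q R : Type*} {φ : P → Q} {ψ : R → Q} {e : I → P} {f : I → R}
    (h : ∀ t, φ (e t) = ψ (f t)) : trace φ [e] = trace ψ [f] := by
  have : φ ∘ e = ψ ∘ f := funext h
  simp only [trace, List.map_cons, List.map_nil, this]

lemma mem_edges_snd_snd (hX₁ : X₁.IntegralHeight h₁) (hX₂ : X₂.IntegralHeight h₂)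
    (hX₃ : X₃.IntegralHeight h₃) {g : I → ((X₁.prod X₂).prod X₃).Pt}
    (hg : g ∈ (((X₁.prod X₂).prod X₃).sliced (prodHeight (prodHeight h₁ h₂) h₃)).edges)
    (hc : ∀ t, prFst (prFst (g t)) = prFst (prFst (g 0))) :
    (fun t => (prSnd (prFst (g t)), prSnd (g t)) : I → (X₂.prod X₃).Pt) ∈
      ((X₂.prod X₃).sliced (prodHeight h₂ h₃)).edges := by
  have hm := (isMorphism_perm₁ hX₂ hX₃ hX₁).comp (isMorphism_perm₁ hX₃ hX₁ hX₂)
  refine (mem_edges_fst (hm.edges g hg)).resolve_right fun hc' => ?_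
  obtain ⟨t, ht⟩ := nonconst_sliced g hg
  have he : ((prSnd (prFst (g t)), prSnd (g t)) : X₂.Pt × X₃.Pt) =
    (prSnd (prFst (g 0)), prSnd (g 0)) := hc' t
  exact ht (Prod.ext (Prod.ext (hc t) (Prod.mk.inj he).1) (Prod.mk.inj he).2)

lemma mem_edges_fst_snd (hX₁ : X₁.IntegralHeight h₁) (hX₂ : X₂.IntegralHeight h₂)
    (hX₃ : X₃.IntegralHeight h₃) {g : I → ((X₁.prod X₂).prod X₃).Pt}
    (hg : g ∈ (((X₁.prod X₂).prod X₃).sliced (prodHeight (prodHeight h₁ h₂) h₃)).edges)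
    (hc : ∀ t, prSnd (prFst (g t)) = prSnd (prFst (g 0))) :
    (fun t => (prFst (prFst (g t)), prSnd (g t)) : I → (X₁.prod X₃).Pt) ∈
      ((X₁.prod X₃).sliced (prodHeight h₁ h₃)).edges := by
  refine (mem_edges_fst ((isMorphism_perm₂ hX₁ hX₂ hX₃).edges g hg)).resolve_right fun hc' => ?_
  obtain ⟨t, ht⟩ := nonconst_sliced g hg
  have he : ((prFst (prFst (g t)), prSnd (g t)) : X₁.Pt × X₃.Pt) =
    (prFst (prFst (g 0)), prSnd (g 0)) := hc' t
  exact ht (Prod.ext (Prod.ext (Prod.mk.inj he).1 (hc t)) (Prod.mk.inj he).2)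

variable {l : ℝ → X₃.Pt} {ν : ℝ → X₁.Pt}

/-- An edge which is constant in the first coordinate lies above the line `ν` in the first factor,
where it can be decomposed as in a product of two complexes. -/
lemma homotopicLE_normalForm_edge_snd (hX₁ : X₁.IntegralHeight h₁) (hX₂ : X₂.IntegralHeight h₂)
    (hX₃ : X₃.IntegralHeight h₃) (hl : X₃.IsLine h₃ l) (hν : X₁.IsLine h₁ ν)
    {x : X₁.Pt} {y y' : X₂.Pt} {z z' : X₃.Pt} {g : I → ((X₁.prod X₂).prod X₃).Pt}
    (hg : (((X₁.prod X₂).prod X₃).slicedZeroLevel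
      (prodHeight (prodHeight h₁ h₂) h₃)).IsEdgePath ((x, y), z) [g] ((x, y'), z'))
    (hc : ∀ t, prFst (prFst (g t)) = x) (hνx : ν (h₁ x) = x) (hlz : l (h₃ z) = z) :
    (((X₁.prod X₂).prod X₃).slicedZeroLevel (prodHeight (prodHeight h₁ h₂) h₃)).HomotopicLE
      ((x, y), z) ((x, y'), z') [g] (normalForm h₁ h₂ h₃ l ν y' [g]) 180 := by
  obtain ⟨hg1, hg2, hg3⟩ := hg
  have hgt : ∀ t, h₁ x + h₂ (prSnd (prFst (g t))) + h₃ (prSnd (g t)) = 0 := fun t => by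
    rw [← hc t]
    exact hg1.2 t
  set g' : I → (X₂.prod X₃).Pt := fun t => (prSnd (prFst (g t)), prSnd (g t)) with hg'
  have hg'm : g' ∈ _ := mem_edges_snd_snd hX₁ hX₂ hX₃ hg1.1 fun t => (hc t).trans (hc 0).symm
  have hgv := IsVertex.of_mem_edges hg1.1
  rw [hg2] at hgv
  have hx : X₁.IsVertex x := hgv.fst.fst
  have hy : X₂.IsVertex y := hgv.fst.snd
  have hz : X₃.IsVertex z := hgv.snd
  obtain ⟨n, hn⟩ := hx.exists_height_eq hX₁
  have h0 : h₁ x + h₂ y + h₃ z = 0 := by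
    have := hgt 0
    rw [hg2] at this
    exact this
  have h0' : h₁ x + h₂ y' + h₃ z' = 0 := by
    have := hgt 1
    rw [show g 1 = _ from hg3] at this
    exact this
  have hly : l ((-n : ℤ) - h₂ y) = z := by
    rw [int_sub_height hn, ← hlz]
    congr 1
    linarith
  have hP : ((X₂.prod X₃).sliced (prodHeight h₂ h₃)).IsEdgePath (y, z) [g'] (y', z') := by
    refine isEdgePath_singleton' hg'm ?_ ?_
    · simp only [hg', hg2]
      rfl
    · simp only [hg', show g 1 = _ from hg3]
      rfl
  have e := (homotopicLE_lineGraph_append hX₂ hX₃ hl (-n) hy hz hly hP).map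
    (isMorphism_chart₁ hX₁ hX₂ hX₃ hν)
  rw [chart₁_apply hνx h0, chart₁_apply hνx h0', List.map_append,
    map_chart₁_lineGraph hνx hl hn, ← shadow_vpath l hn] at e
  have t1 : trace prFst [g] = vpath x (trace prFst [g']) := by
    rw [vpath, ← trace_comp_injective (ψ := mkRight x) (fun a b hab => (Prod.mk.inj hab).2)]
    exact trace_singleton_congr fun t => Prod.ext (hc t) rfl
  have t2 : trace prSnd [g] = trace prSnd [g'] := trace_singleton_congr fun t => rfl
  have t3 : [g] = [g'].map (chart₁ h₂ h₃ ν ∘ ·) := by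
    refine congrArg (fun x => [x]) (funext fun t => ?_)
    have : g t = ((x, prSnd (prFst (g t))), prSnd (g t)) := Prod.ext (Prod.ext (hc t) rfl) rfl
    exact this.trans (chart₁_apply hνx (hgt t)).symm
  rw [normalForm, t1, t2, t3]
  exact e.mono (by norm_num)

/-- An edge which is constant in the second coordinate lies above a line in the second factor, where
it can be decomposed as in a product of two complexes. In a second step, the compensation of the
path in the third factor is moved from the second factor to the first one. -/
lemma homotopicLE_normalForm_edge_fst (hX₁ : X₁.IntegralHeight h₁) (hX₂ : X₂.IntegralHeight h₂)
    (hX₃ : X₃.IntegralHeight h₃) (hlines : X₂.HasLines h₂) (hl : X₃.IsLine h₃ l)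
    (hν : X₁.IsLine h₁ ν) {x x' : X₁.Pt} {y : X₂.Pt} {z z' : X₃.Pt}
    {g : I → ((X₁.prod X₂).prod X₃).Pt}
    (hg : (((X₁.prod X₂).prod X₃).slicedZeroLevel
      (prodHeight (prodHeight h₁ h₂) h₃)).IsEdgePath ((x, y), z) [g] ((x', y), z'))
    (hc : ∀ t, prSnd (prFst (g t)) = y) (hνx : ν (h₁ x') = x') (hlz : l (h₃ z) = z) :
    (((X₁.prod X₂).prod X₃).slicedZeroLevel (prodHeight (prodHeight h₁ h₂) h₃)).HomotopicLE
      ((x, y), z) ((x', y), z') [g] (normalForm h₁ h₂ h₃ l ν y [g]) 300 := by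
  obtain ⟨hg1, hg2, hg3⟩ := hg
  have hgt : ∀ t, h₁ (prFst (prFst (g t))) + h₂ y + h₃ (prSnd (g t)) = 0 := fun t => by
    rw [← hc t]
    exact hg1.2 t
  set g' : I → (X₁.prod X₃).Pt := fun t => (prFst (prFst (g t)), prSnd (g t)) with hg'
  have hg'm : g' ∈ _ := mem_edges_fst_snd hX₁ hX₂ hX₃ hg1.1 fun t => (hc t).trans (hc 0).symm
  have hgv := IsVertex.of_mem_edges hg1.1
  rw [hg2] at hgv
  have hx : X₁.IsVertex x := hgv.fst.fst
  have hy : X₂.IsVertex y := hgv.fst.snd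
  have hz : X₃.IsVertex z := hgv.snd
  obtain ⟨μ, hμ, hμy⟩ := hlines y hy
  obtain ⟨n, hn⟩ := hy.exists_height_eq hX₂
  have h0 : h₁ x + h₂ y + h₃ z = 0 := by
    have := hgt 0
    rw [hg2] at this
    exact this
  have h0' : h₁ x' + h₂ y + h₃ z' = 0 := by
    have := hgt 1
    rw [show g 1 = _ from hg3] at this
    exact this
  have hly : l ((-n : ℤ) - h₁ x) = z := by
    rw [int_sub_height hn, ← hlz]
    congr 1
    linarith
  have hP : ((X₁.prod X₃).sliced (prodHeight h₁ h₃)).IsEdgePath (x, z) [g'] (x', z') := by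
    refine isEdgePath_singleton' hg'm ?_ ?_
    · simp only [hg', hg2]
      rfl
    · simp only [hg', show g 1 = _ from hg3]
      rfl
  have hp : (X₁.sliced h₁).IsEdgePath x (trace prFst [g']) x' := isEdgePath_trace_fst hP
  have hs : (X₃.sliced h₃).IsEdgePath z (trace prSnd [g']) z' := isEdgePath_trace_snd hP
  have e := (homotopicLE_lineGraph_append hX₁ hX₃ hl (-n) hx hz hly hP).map
    (isMorphism_chart₂ hX₁ hX₂ hX₃ hμ)
  have hsh := isEdgePath_shadow hX₁ hl (-n) hp
  have hr := (hsh.revPath proper_sliced).append (hly ▸ hs)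
  have hx' := hx.of_isEdgePath hp
  have hvl : l ((-n : ℤ) - h₁ x') = l (-(h₁ x' + h₂ y)) := by
    rw [int_sub_height hn, add_comm]
  rw [hvl] at hr
  have hlev : h₁ x' + h₂ y + h₃ (l (-(h₁ x' + h₂ y))) = 0 := by
    rw [hl.height]
    ring
  have e2 := homotopicLE_switch hX₁ hX₂ hX₃ hν hμ hx' hy (hl.isVertex_neg hX₁ hX₂ hx' hy) hνx hμy
    hr hlev h0'
  have p1 := (isEdgePath_lineGraph hX₁ hl (-n) hp).map (isMorphism_chart₂ hX₁ hX₂ hX₃ hμ).edges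
  rw [chart₂_lineGraph hμy hl hn, chart₂_lineGraph hμy hl hn] at p1
  rw [chart₂_apply hμy h0, chart₂_apply hμy h0', List.map_append] at e
  have hzl : l (-(h₁ x + h₂ y)) = z := by rw [← hly, int_sub_height hn, add_comm]
  rw [hzl] at p1
  have e3 := e.trans (e2.symm.append_left p1)
  rw [map_chart₂_lineGraph hμy hl hn, ← shadow_hpath l hn] at e3
  have t1 : trace prFst [g] = hpath (trace prFst [g']) y := by
    rw [hpath, ← trace_comp_injective (ψ := mkLeft y) (fun a b hab => (Prod.mk.inj hab).1)]
    exact trace_singleton_congr fun t => Prod.ext rfl (hc t)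
  have t2 : trace prSnd [g] = trace prSnd [g'] := trace_singleton_congr fun t => rfl
  have t3 : [g] = [g'].map (chart₂ h₁ h₃ μ ∘ ·) := by
    refine congrArg (fun x => [x]) (funext fun t => ?_)
    have : g t = ((prFst (prFst (g t)), y), prSnd (g t)) := Prod.ext (Prod.ext rfl (hc t)) rfl
    exact this.trans (chart₂_apply hμy (hgt t)).symm
  rw [normalForm, t1, t2, t3]
  refine e3.mono ?_
  have l1 : (trace (prFst (K := X₁) (L := X₃)) [g']).length ≤ 1 := length_trace_le _ _
  have l2 : (trace (prSnd (K := X₁) (L := X₃)) [g']).length ≤ 1 := length_trace_le _ _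
  have l3 := length_shadow_le (h := prodHeight h₁ h₂) l 0 (hpath (trace prFst [g']) y)
  rw [length_hpath] at l3
  have l4 : (revPath (shadow (prodHeight h₁ h₂) l 0 (hpath (trace prFst [g']) y)) ++
      trace prSnd [g']).length ≤ 2 := by
    rw [List.length_append, length_revPath]
    omega
  have := Nat.pow_le_pow_left l4 2
  simp only [List.length_singleton]
  omega

end CubeComplex

namespace CubeComplex

open TwoSkeleton

lemma isEdgePath_sliced_of_zeroLevel {K : CubeComplex.{u, v}} {h : K.Pt → ℝ} {a b : K.Pt}
    {p : List (I → K.Pt)} (hp : (K.slicedZeroLevel h).IsEdgePath a p b) :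
    (K.sliced h).IsEdgePath a p b := by
  induction p generalizing a with
  | nil => exact hp
  | cons e p ih => exact ⟨hp.1.1, hp.2.1, ih hp.2.2⟩

lemma mem_zeroLevel_of_isEdgePath {K : CubeComplex.{u, v}} {h : K.Pt → ℝ} {a b : K.Pt}
    {p : List (I → K.Pt)} (hp : (K.slicedZeroLevel h).IsEdgePath a p b) (ha : h a = 0) :
    h b = 0 := by
  induction p generalizing a with
  | nil => exact (show a = b from hp) ▸ ha
  | cons e p ih => exact ih hp.2.2 (hp.1.2 1)

variable {X₁ : CubeComplex.{u₁, v₁}} {X₂ : CubeComplex.{u₂, v₂}} {X₃ : CubeComplex.{u₃, v₃}}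
  {h₁ : X₁.Pt → ℝ} {h₂ : X₂.Pt → ℝ} {h₃ : X₃.Pt → ℝ} {l : ℝ → X₃.Pt} {ν : ℝ → X₁.Pt}

/-- An edge can be brought into normal form, because it is constant in one of the three
coordinates. -/
lemma homotopicLE_normalForm_edge (hX₁ : X₁.IntegralHeight h₁) (hX₂ : X₂.IntegralHeight h₂)
    (hX₃ : X₃.IntegralHeight h₃) (hlines : X₂.HasLines h₂) (hl : X₃.IsLine h₃ l)
    (hν : X₁.IsLine h₁ ν) {x x' : X₁.Pt} {y y' : X₂.Pt} {z z' : X₃.Pt}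
    {g : I → ((X₁.prod X₂).prod X₃).Pt}
    (hg : (((X₁.prod X₂).prod X₃).slicedZeroLevel
      (prodHeight (prodHeight h₁ h₂) h₃)).IsEdgePath ((x, y), z) [g] ((x', y'), z'))
    (hνx : ν (h₁ x') = x') (hlz : l (h₃ z) = z) :
    (((X₁.prod X₂).prod X₃).slicedZeroLevel (prodHeight (prodHeight h₁ h₂) h₃)).HomotopicLE
      ((x, y), z) ((x', y'), z') [g] (normalForm h₁ h₂ h₃ l ν y' [g]) 300 := by
  have hg0 : g 0 = ((x, y), z) := hg.2.1
  have hg1 : g 1 = ((x', y'), z') := hg.2.2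
  rcases exists_const_of_mem_edges hg.1.1 with hc | hc | hc
  · have hz : ∀ t, prSnd (g t) = z := fun t => by rw [hc t, hg0]; rfl
    have hlev : ∀ t, -prodHeight h₁ h₂ (prFst (g t)) = h₃ z := fun t => by
      have : prodHeight h₁ h₂ (prFst (g t)) + h₃ (prSnd (g t)) = 0 := hg.1.2 t
      rw [hz] at this
      linarith
    have hmem : prFst ∘ g ∈ ((X₁.prod X₂).sliced (prodHeight h₁ h₂)).edges := by
      refine (mem_edges_fst hg.1.1).resolve_right fun hc' => ?_
      obtain ⟨t, ht⟩ := nonconst_sliced g hg.1.1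
      exact ht (Prod.ext (hc' t) (hc t))
    have t1 : trace prFst [g] = [prFst ∘ g] := trace_eq_map nonconst_sliced (by simpa using hmem)
    have t2 : trace prSnd [g] = [] := trace_singleton_of_const hc
    have t3 : shadow (prodHeight h₁ h₂) l 0 [prFst ∘ g] = [] := by
      refine trace_singleton_of_const fun t => ?_
      simp only [Function.comp_apply, Int.cast_zero, zero_sub, hlev]
    have t4 : chart₃ h₁ h₂ l ∘ (prFst ∘ g) = g := by
      funext t
      refine Prod.ext rfl ?_
      change l (((0 : ℤ) : ℝ) - prodHeight h₁ h₂ (prFst (g t))) = prSnd (g t)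
      rw [Int.cast_zero, zero_sub, hlev, hlz, hz]
    rw [normalForm, t1, t2, t3]
    simp only [List.map_cons, List.map_nil, t4, revPath_nil, List.append_nil, vpath_nil]
    exact (HomotopicLE.refl hg).mono (Nat.zero_le _)
  · obtain rfl : x = x' := by
      have := hc 1
      rw [hg0, hg1] at this
      exact this.symm
    exact (homotopicLE_normalForm_edge_snd hX₁ hX₂ hX₃ hl hν hg
      (fun t => by rw [hc t, hg0]; rfl) hνx hlz).mono (by norm_num)
  · obtain rfl : y = y' := by
      have := hc 1
      rw [hg0, hg1] at this
      exact this.symm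
    exact homotopicLE_normalForm_edge_fst hX₁ hX₂ hX₃ hlines hl hν hg
      (fun t => by rw [hc t, hg0]; rfl) hνx hlz

/-- Normal forms of paths which can be composed combine to the normal form of the composition. -/
lemma homotopicLE_normalForm_append (hX₁ : X₁.IntegralHeight h₁) (hX₂ : X₂.IntegralHeight h₂)
    (hX₃ : X₃.IntegralHeight h₃) (hlines : X₂.HasLines h₂) (hl : X₃.IsLine h₃ l)
    (hν : X₁.IsLine h₁ ν) {ν' : ℝ → X₁.Pt} (hν' : X₁.IsLine h₁ ν') {l' : ℝ → X₃.Pt}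
    (hl' : X₃.IsLine h₃ l') {x x' x'' : X₁.Pt} {y y' y'' : X₂.Pt} {z z' z'' : X₃.Pt}
    {γ γ' : List (I → ((X₁.prod X₂).prod X₃).Pt)}
    (hx : X₁.IsVertex x) (hy : X₂.IsVertex y)
    (h0 : h₁ x + h₂ y + h₃ z = 0) (h0' : h₁ x' + h₂ y' + h₃ z' = 0)
    (h0'' : h₁ x'' + h₂ y'' + h₃ z'' = 0)
    (hγ : (((X₁.prod X₂).prod X₃).slicedZeroLevel
      (prodHeight (prodHeight h₁ h₂) h₃)).IsEdgePath ((x, y), z) γ ((x', y'), z'))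
    (hγ' : (((X₁.prod X₂).prod X₃).slicedZeroLevel
      (prodHeight (prodHeight h₁ h₂) h₃)).IsEdgePath ((x', y'), z') γ' ((x'', y''), z''))
    (hlz : l (h₃ z) = z) (hνx : ν (h₁ x') = x') (hlz' : l' (h₃ z') = z')
    (hνx' : ν' (h₁ x'') = x'') :
    (((X₁.prod X₂).prod X₃).slicedZeroLevel (prodHeight (prodHeight h₁ h₂) h₃)).HomotopicLE
      ((x, y), z) ((x'', y''), z'')
      (normalForm h₁ h₂ h₃ l ν y' γ ++ normalForm h₁ h₂ h₃ l' ν' y'' γ')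
      (normalForm h₁ h₂ h₃ l ν' y'' (γ ++ γ'))
      (3750 * (γ.length + γ'.length) ^ 2) := by
  have hlevel : ∀ {l : ℝ → X₃.Pt}, X₃.IsLine h₃ l → ∀ x y,
      h₁ x + h₂ y + h₃ (l (-(h₁ x + h₂ y))) = 0 := fun hl x y => by rw [hl.height]; ring
  obtain rfl : z = l (-(h₁ x + h₂ y)) := by
    rw [← hlz]; congr 1; linarith
  obtain rfl : z' = l' (-(h₁ x' + h₂ y')) := by
    rw [← hlz']; congr 1; linarith
  have hq : ((X₁.prod X₂).sliced (prodHeight h₁ h₂)).IsEdgePath (x, y) (trace prFst γ) (x', y') :=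
    isEdgePath_trace_fst (isEdgePath_sliced_of_zeroLevel hγ)
  have hq' : ((X₁.prod X₂).sliced (prodHeight h₁ h₂)).IsEdgePath (x', y') (trace prFst γ')
    (x'', y'') := isEdgePath_trace_fst (isEdgePath_sliced_of_zeroLevel hγ')
  have hs : (X₃.sliced h₃).IsEdgePath (l (-(h₁ x + h₂ y))) (trace prSnd γ)
    (l' (-(h₁ x' + h₂ y'))) := isEdgePath_trace_snd (isEdgePath_sliced_of_zeroLevel hγ)
  have hs' : (X₃.sliced h₃).IsEdgePath (l' (-(h₁ x' + h₂ y'))) (trace prSnd γ') z'' :=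
    isEdgePath_trace_snd (isEdgePath_sliced_of_zeroLevel hγ')
  have lq : (trace (prFst (K := X₁.prod X₂) (L := X₃)) γ).length ≤ γ.length := length_trace_le _ _
  have lq' : (trace (prFst (K := X₁.prod X₂) (L := X₃)) γ').length ≤ γ'.length :=
    length_trace_le _ _
  have ls : (trace (prSnd (K := X₁.prod X₂) (L := X₃)) γ).length ≤ γ.length := length_trace_le _ _
  have hxy' := (hx.prodMk hy).of_isEdgePath hq
  have hxy'' := hxy'.of_isEdgePath hq'
  have hx' : X₁.IsVertex x' := hxy'.fst
  have hy' : X₂.IsVertex y' := hxy'.snd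
  have hx'' : X₁.IsVertex x'' := hxy''.fst
  have hy'' : X₂.IsVertex y'' := hxy''.snd
  simp only [normalForm, trace_append]
  set q := trace prFst γ
  set q' := trace prFst γ'
  set s := trace prSnd γ
  set s' := trace prSnd γ'
  have sh := isEdgePath_shadow_prod hX₁ hX₂ hl hq
  have sh₂ := isEdgePath_shadow_prod hX₁ hX₂ hl hq'
  have sh₂' := isEdgePath_shadow_prod hX₁ hX₂ hl' hq'
  have hr := (sh.revPath proper_sliced).append hs
  have lr : (revPath (shadow (prodHeight h₁ h₂) l 0 q) ++ s).length ≤ 2 * γ.length := by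
    have := length_shadow_le (h := prodHeight h₁ h₂) l 0 q
    rw [List.length_append, length_revPath]
    omega
  set r := revPath (shadow (prodHeight h₁ h₂) l 0 q) ++ s with hrdef
  have e1 := homotopicLE_exchange_prod hX₁ hX₂ hX₃ hlines hν hν' hl hl' hx' hy' hνx hνx' hq' hr
  have hr' := (sh₂'.revPath proper_sliced).append hs'
  have p0 := hq.map (isMorphism_chart₃ hX₁ hX₂ hl).edges
  have p1 := hq'.map (isMorphism_chart₃ hX₁ hX₂ hl).edges
  rw [chart₃_apply, chart₃_apply] at p0 p1
  have p2 := isEdgePath_chart₁ hX₁ hX₂ hX₃ hν' hy'' hνx' (hlevel hl' x'' y'') h0'' hr'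
  -- the shadows of `q'` along the line `l'` cancel
  have e2 := ((homotopicLE_append_revPath proper_sliced sh₂').append_right hs').append_left
    ((sh₂.revPath proper_sliced).append hr)
  have e3 := (homotopicLE_chart₁ hX₁ hX₂ hX₃ hν' hy'' hνx' (hlevel hl x'' y'') h0'' e2).append_left
    (p0.append p1)
  have e4 := (e1.append_right p2).append_left p0
  simp only [hrdef, List.map_append, vpath_append, shadow_append, revPath_append,
    List.append_assoc, List.nil_append] at e3 e4 ⊢
  refine (e4.trans e3).mono ?_
  rw [← hrdef]
  have := Nat.pow_le_pow_left
    (show r.length + 5 * q'.length ≤ 5 * (γ.length + γ'.length) by omega) 2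
  rw [mul_pow] at this
  omega

/-- Every path in the zero level can be brought into normal form, with quadratic area. The two
halves of the path are brought into normal form first, and then combined at quadratic cost; as the
length is halved in every step of the recursion, the sum of the costs is quadratic. -/
theorem homotopicLE_normalForm (hX₁ : X₁.IntegralHeight h₁) (hX₂ : X₂.IntegralHeight h₂)
    (hX₃ : X₃.IntegralHeight h₃) (hlines₁ : X₁.HasLines h₁) (hlines₂ : X₂.HasLines h₂)
    (hlines₃ : X₃.HasLines h₃) (hl : X₃.IsLine h₃ l)
    (hν : X₁.IsLine h₁ ν) {x x' : X₁.Pt} {y y' : X₂.Pt} {z z' : X₃.Pt}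
    {γ : List (I → ((X₁.prod X₂).prod X₃).Pt)}
    (hx : X₁.IsVertex x) (hy : X₂.IsVertex y) (hz : X₃.IsVertex z)
    (h0 : h₁ x + h₂ y + h₃ z = 0)
    (hγ : (((X₁.prod X₂).prod X₃).slicedZeroLevel
      (prodHeight (prodHeight h₁ h₂) h₃)).IsEdgePath ((x, y), z) γ ((x', y'), z'))
    (hlz : l (h₃ z) = z) (hνx : ν (h₁ x') = x') :
    (((X₁.prod X₂).prod X₃).slicedZeroLevel (prodHeight (prodHeight h₁ h₂) h₃)).HomotopicLE
      ((x, y), z) ((x', y'), z') γ (normalForm h₁ h₂ h₃ l ν y' γ) (11250 * γ.length ^ 2) := by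
  generalize hN : γ.length = N
  induction N using Nat.strong_induction_on generalizing γ l ν x x' y y' z z' with
  | _ N ih =>
  rcases Nat.lt_or_ge N 2 with h2 | h2
  · match γ, hN with
    | [], _ => exact (HomotopicLE.refl hγ).mono (Nat.zero_le _)
    | [g], hN =>
      subst hN
      exact (homotopicLE_normalForm_edge hX₁ hX₂ hX₃ hlines₂ hl hν hγ hνx hlz).mono (by norm_num)
    | g :: g' :: γ', hN =>
      simp only [List.length_cons] at hN
      omega
  -- cut the path in the middle
  have hcut := List.take_append_drop (N / 2) γ
  have n1 : (γ.take (N / 2)).length = N / 2 := by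
    rw [List.length_take]
    omega
  have n2 : (γ.drop (N / 2)).length = N - N / 2 := by rw [List.length_drop, hN]
  set γ₁ := γ.take (N / 2)
  set γ₂ := γ.drop (N / 2)
  rw [← hcut] at hγ ⊢
  obtain ⟨⟨⟨x'', y''⟩, z''⟩, hγ₁, hγ₂⟩ := isEdgePath_append.1 hγ
  have hv := ((hx.prodMk hy).prodMk hz).of_isEdgePath (isEdgePath_sliced_of_zeroLevel hγ₁)
  have hx'' : X₁.IsVertex x'' := hv.fst.fst
  have hy'' : X₂.IsVertex y'' := hv.fst.snd
  have hz'' : X₃.IsVertex z'' := hv.snd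
  have h0'' : h₁ x'' + h₂ y'' + h₃ z'' = 0 := mem_zeroLevel_of_isEdgePath hγ₁ h0
  have h0' : h₁ x' + h₂ y' + h₃ z' = 0 := mem_zeroLevel_of_isEdgePath hγ h0
  obtain ⟨ν'', hν'', hνx''⟩ := hlines₁ x'' hx''
  obtain ⟨l'', hl'', hlz''⟩ := hlines₃ z'' hz''
  have e1 := ih (N / 2) (by omega) hl hν'' hx hy hz h0 hγ₁ hlz hνx'' n1
  have e2 := ih (N - N / 2) (by omega) hl'' hν hx'' hy'' hz'' h0'' hγ₂ hlz'' hνx n2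
  have e3 := homotopicLE_normalForm_append hX₁ hX₂ hX₃ hlines₂ hl hν'' hν hl'' hx hy h0 h0'' h0'
    hγ₁ hγ₂ hlz hνx'' hlz'' hνx
  refine ((e1.append proper_slicedZeroLevel e2).trans e3).mono ?_
  rw [n1, n2]
  obtain ⟨a, ha⟩ : ∃ a, a = N / 2 := ⟨_, rfl⟩
  obtain ⟨b, hb⟩ : ∃ b, b = N - N / 2 := ⟨_, rfl⟩
  rw [← hb, ← ha]
  have hab : N = a + b := by omega
  have h3 : a ≤ b := by omega
  have h4 : b ≤ 2 * a := by omega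
  rw [hab]
  -- `a ≤ b ≤ 2 * a` implies `(a + b) ^ 2 ≤ 6 * a * b`, hence
  -- `11250 * (a ^ 2 + b ^ 2) + 3750 * (a + b) ^ 2 ≤ 11250 * (a + b) ^ 2`
  nlinarith [Nat.mul_le_mul h3 (le_refl a), Nat.mul_le_mul h4 (le_refl b)]

/-- A closed path in the zero level can be filled by fillings of its projections to the three
factors and a number of triangles which is quadratic in its length. -/
theorem homotopicLE_nil_of_traces (hX₁ : X₁.IntegralHeight h₁) (hX₂ : X₂.IntegralHeight h₂)
    (hX₃ : X₃.IntegralHeight h₃) (hlines₁ : X₁.HasLines h₁) (hlines₂ : X₂.HasLines h₂)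
    (hlines₃ : X₃.HasLines h₃) {x : X₁.Pt} {y : X₂.Pt} {z : X₃.Pt}
    {γ : List (I → ((X₁.prod X₂).prod X₃).Pt)}
    (hx : X₁.IsVertex x) (hy : X₂.IsVertex y) (hz : X₃.IsVertex z)
    (h0 : h₁ x + h₂ y + h₃ z = 0)
    (hγ : (((X₁.prod X₂).prod X₃).slicedZeroLevel
      (prodHeight (prodHeight h₁ h₂) h₃)).IsEdgePath ((x, y), z) γ ((x, y), z)) {n₁ n₂ n₃ : ℕ}
    (hn₁ : (X₁.sliced h₁).HomotopicLE x x (trace prFst (trace prFst γ)) [] n₁)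
    (hn₂ : (X₂.sliced h₂).HomotopicLE y y (trace prSnd (trace prFst γ)) [] n₂)
    (hn₃ : (X₃.sliced h₃).HomotopicLE z z (trace prSnd γ) [] n₃) :
    (((X₁.prod X₂).prod X₃).slicedZeroLevel (prodHeight (prodHeight h₁ h₂) h₃)).HomotopicLE
      ((x, y), z) ((x, y), z) γ [] (11265 * γ.length ^ 2 + n₁ + n₂ + n₃) := by
  obtain ⟨ν, hν, hνx⟩ := hlines₁ x hx
  obtain ⟨l, hl, hlz⟩ := hlines₃ z hz
  have e1 := homotopicLE_normalForm hX₁ hX₂ hX₃ hlines₁ hlines₂ hlines₃ hl hν hx hy hz h0 hγ hlz hνx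
  have hq : ((X₁.prod X₂).sliced (prodHeight h₁ h₂)).IsEdgePath (x, y) (trace prFst γ) (x, y) :=
    isEdgePath_trace_fst (isEdgePath_sliced_of_zeroLevel hγ)
  have lq : (trace (prFst (K := X₁.prod X₂) (L := X₃)) γ).length ≤ γ.length := length_trace_le _ _
  have hnil : ((X₁.prod X₂).sliced (prodHeight h₁ h₂)).IsEdgePath (x, y) [] (x, y) := rfl
  have e2 : ((X₁.prod X₂).sliced (prodHeight h₁ h₂)).HomotopicLE (x, y) (x, y) (trace prFst γ) []
      (15 * γ.length ^ 2 + n₁ + n₂) := by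
    refine homotopicLE_of_traces hX₁ hX₂ (hx.prodMk hy) hq hnil hn₁ hn₂ ?_
    have := Nat.pow_le_pow_left lq 2
    simp only [List.length_nil]
    omega
  obtain rfl : z = l (-(h₁ x + h₂ y)) := by
    rw [← hlz]; congr 1; linarith
  have e3 := homotopicLE_chart₃ hX₁ hX₂ hl e2
  have e4 := ((homotopicLE_shadow_prod hX₁ hX₂ hl hx hy hq hnil).revPath proper_sliced).append
    proper_sliced hn₃
  have e5 := homotopicLE_chart₁ hX₁ hX₂ hX₃ hν hy hνx h0 h0 e4
  exact (e1.trans (e3.append proper_slicedZeroLevel e5)).mono (by omega)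

end CubeComplex

/-! ### The Dehn function of the zero level -/

namespace TwoSkeleton

variable {P : Type u} {S : TwoSkeleton P} {a : P} {p : List (I → P)}

lemma HomotopicLE.fillingArea_le {n : ℕ} (h : S.HomotopicLE a a p [] n) :
    S.fillingArea a p ≤ n := by
  obtain ⟨m, hm, h⟩ := h
  exact (iInf₂_le m h).trans (by exact_mod_cast hm)

lemma homotopicLE_of_fillingArea_le {n : ℕ} (h : S.fillingArea a p ≤ n) :
    S.HomotopicLE a a p [] n := by
  have h1 : S.fillingArea a p < (n + 1 : ℕ) := h.trans_lt (by exact_mod_cast Nat.lt_succ_self n)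
  simp only [fillingArea, iInf_lt_iff] at h1
  obtain ⟨m, hm, hmn⟩ := h1
  exact ⟨m, Nat.lt_succ_iff.1 (by exact_mod_cast hmn), hm⟩

lemma homotopicLE_of_dehn_ne_top {n : ℕ} (hfin : S.dehn n ≠ ⊤) (hp : S.IsEdgePath a p a)
    (hn : p.length ≤ n) : S.HomotopicLE a a p [] (S.dehn n).toNat := by
  refine homotopicLE_of_fillingArea_le ?_
  rw [ENat.natCast_toNat hfin]
  exact le_iSup_of_le a (le_iSup₂_of_le p ⟨hp, hn⟩ le_rfl)

end TwoSkeleton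

namespace CubeComplex

open TwoSkeleton

variable {X₁ : CubeComplex.{u₁, v₁}} {X₂ : CubeComplex.{u₂, v₂}} {X₃ : CubeComplex.{u₃, v₃}}
  {h₁ : X₁.Pt → ℝ} {h₂ : X₂.Pt → ℝ} {h₃ : X₃.Pt → ℝ}

/-- Closed edge paths in the zero level are contractible, with control on the area. -/
theorem homotopicLE_nil (hX₁ : X₁.IntegralHeight h₁) (hX₂ : X₂.IntegralHeight h₂)
    (hX₃ : X₃.IntegralHeight h₃) (hlines₁ : X₁.HasLines h₁) (hlines₂ : X₂.HasLines h₂)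
    (hlines₃ : X₃.HasLines h₃) (hfin₁ : ∀ n, (X₁.sliced h₁).dehn n ≠ ⊤)
    (hfin₂ : ∀ n, (X₂.sliced h₂).dehn n ≠ ⊤) (hfin₃ : ∀ n, (X₃.sliced h₃).dehn n ≠ ⊤)
    {p : ((X₁.prod X₂).prod X₃).Pt} {γ : List (I → ((X₁.prod X₂).prod X₃).Pt)} {n : ℕ}
    (hγ : (((X₁.prod X₂).prod X₃).slicedZeroLevel
      (prodHeight (prodHeight h₁ h₂) h₃)).IsEdgePath p γ p) (hn : γ.length ≤ n) :
    (((X₁.prod X₂).prod X₃).slicedZeroLevel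
      (prodHeight (prodHeight h₁ h₂) h₃)).HomotopicLE p p γ [] (11265 * n ^ 2 +
        ((X₁.sliced h₁).dehn n).toNat + ((X₂.sliced h₂).dehn n).toNat +
        ((X₃.sliced h₃).dehn n).toNat) := by
  cases γ with
  | nil => exact (HomotopicLE.refl hγ).mono (Nat.zero_le _)
  | cons e γ =>
    have hv := IsVertex.of_mem_edges hγ.1.1
    have h0 := hγ.1.2 0
    rw [hγ.2.1] at hv h0
    obtain ⟨⟨x, y⟩, z⟩ := p
    have hk := isEdgePath_trace_fst (isEdgePath_sliced_of_zeroLevel hγ)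
    have lk : (trace (prFst (K := X₁.prod X₂) (L := X₃)) (e :: γ)).length ≤ n :=
      (length_trace_le _ _).trans hn
    refine (homotopicLE_nil_of_traces hX₁ hX₂ hX₃ hlines₁ hlines₂ hlines₃ hv.fst.fst hv.fst.snd
      hv.snd h0 hγ
      (homotopicLE_of_dehn_ne_top (hfin₁ n) (isEdgePath_trace_fst hk)
        ((length_trace_le _ _).trans lk))
      (homotopicLE_of_dehn_ne_top (hfin₂ n) (isEdgePath_trace_snd hk)
        ((length_trace_le _ _).trans lk))
      (homotopicLE_of_dehn_ne_top (hfin₃ n)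
        (isEdgePath_trace_snd (isEdgePath_sliced_of_zeroLevel hγ))
        ((length_trace_le _ _).trans hn))).mono ?_
    have := Nat.pow_le_pow_left hn 2
    omega

/-- The three Dehn functions and the quadratic term are bounded by `n ^ α` with a common constant.
-/
theorem dehnLE_slicedZeroLevel {α : ℝ} (hα : 2 ≤ α) (hX₁ : X₁.IntegralHeight h₁)
    (hX₂ : X₂.IntegralHeight h₂)
    (hX₃ : X₃.IntegralHeight h₃) (hlines₁ : X₁.HasLines h₁) (hlines₂ : X₂.HasLines h₂)
    (hlines₃ : X₃.HasLines h₃) (hfin₁ : ∀ n, (X₁.sliced h₁).dehn n ≠ ⊤)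
    (hfin₂ : ∀ n, (X₂.sliced h₂).dehn n ≠ ⊤) (hfin₃ : ∀ n, (X₃.sliced h₃).dehn n ≠ ⊤)
    (hd₁ : DehnLE (X₁.sliced h₁).dehn (fun n => (n : ℝ≥0∞) ^ α))
    (hd₂ : DehnLE (X₂.sliced h₂).dehn (fun n => (n : ℝ≥0∞) ^ α))
    (hd₃ : DehnLE (X₃.sliced h₃).dehn (fun n => (n : ℝ≥0∞) ^ α)) :
    DehnLE (((X₁.prod X₂).prod X₃).slicedZeroLevel (prodHeight (prodHeight h₁ h₂) h₃)).dehn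
      (fun n => (n : ℝ≥0∞) ^ α) := by
  obtain ⟨C₁, hC₁⟩ := hd₁
  obtain ⟨C₂, hC₂⟩ := hd₂
  obtain ⟨C₃, hC₃⟩ := hd₃
  obtain ⟨C, hC⟩ : ∃ C, C = C₁ + C₂ + C₃ + 11265 := ⟨_, rfl⟩
  refine ⟨C, fun n => ?_⟩
  have h1 : (((X₁.prod X₂).prod X₃).slicedZeroLevel (prodHeight (prodHeight h₁ h₂) h₃)).dehn n ≤
      ((11265 * n ^ 2 : ℕ) : ℕ∞) + (X₁.sliced h₁).dehn n + (X₂.sliced h₂).dehn n +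
        (X₃.sliced h₃).dehn n := by
    refine iSup_le fun p => iSup₂_le fun γ hγ => ?_
    have := (homotopicLE_nil hX₁ hX₂ hX₃ hlines₁ hlines₂ hlines₃ hfin₁ hfin₂ hfin₃ hγ.1
      hγ.2).fillingArea_le
    rw [Nat.cast_add, Nat.cast_add, Nat.cast_add, ENat.natCast_toNat (hfin₁ n),
      ENat.natCast_toNat (hfin₂ n), ENat.natCast_toNat (hfin₃ n)] at this
    exact this
  have h2 := ENat.toENNReal_mono h1
  rw [ENat.toENNReal_add, ENat.toENNReal_add, ENat.toENNReal_add, ENat.toENNReal_coe] at h2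
  have hmono : ∀ {D : ℕ}, D ≤ C →
      ((D * n + D : ℕ) : ℝ≥0∞) ^ α ≤ ((C * n + C : ℕ) : ℝ≥0∞) ^ α :=
    fun hD => ENNReal.rpow_le_rpow (by exact_mod_cast Nat.add_le_add (Nat.mul_le_mul_right n hD) hD)
      (by linarith)
  have hsq : ((11265 * n ^ 2 : ℕ) : ℝ≥0∞) ≤ 11265 * ((C * n + C : ℕ) : ℝ≥0∞) ^ α := by
    have h3 : ((C * n + C : ℕ) : ℝ≥0∞) ^ (2 : ℝ) ≤ ((C * n + C : ℕ) : ℝ≥0∞) ^ α :=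
      ENNReal.rpow_le_rpow_of_exponent_le (by exact_mod_cast (by omega : 1 ≤ C * n + C)) hα
    rw [Nat.cast_mul, Nat.cast_ofNat]
    refine mul_le_mul_right (le_trans ?_ h3) _
    rw [ENNReal.rpow_two]
    have : n ≤ C * n + C := by nlinarith
    exact_mod_cast Nat.pow_le_pow_left this 2
  have hb : ∀ {D : ℕ} {d : ℝ≥0∞}, D ≤ C →
      d ≤ D * ((D * n + D : ℕ) : ℝ≥0∞) ^ α + D * n + D →
      d ≤ D * ((C * n + C : ℕ) : ℝ≥0∞) ^ α + D * n + D := fun hD hd =>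
    hd.trans (by gcongr 1; gcongr 1; exact mul_le_mul_right (hmono hD) _)
  have b1 := hb (by omega) (hC₁ n)
  have b2 := hb (by omega) (hC₂ n)
  have b3 := hb (by omega) (hC₃ n)
  beta_reduce
  refine h2.trans ((add_le_add (add_le_add (add_le_add hsq b1) b2) b3).trans ?_)
  generalize ((C * n + C : ℕ) : ℝ≥0∞) ^ α = T
  rw [hC]
  push_cast
  calc _ = (C₁ + C₂ + C₃ + 11265 : ℝ≥0∞) * T + (C₁ + C₂ + C₃ : ℝ≥0∞) * n + (C₁ + C₂ + C₃) := by ring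
    _ ≤ _ := add_le_add (add_le_add le_rfl (mul_le_mul_left le_self_add _)) le_self_add

end CubeComplex

/-! ### Corners of cubes in the zero level -/

namespace CubeComplex

open TwoSkeleton

variable {K : CubeComplex.{u, v}} {h : K.Pt → ℝ}

section

variable {ι : Type} [DecidableEq ι] (a b : ι → Bool)

lemma ncard_ne_update {i : ι} (hi : a i ≠ b i) :
    {j | a j ≠ Function.update a i (b i) j}.ncard = 1 := by
  rw [Set.ncard_eq_one]
  refine ⟨i, Set.ext fun j => ?_⟩
  by_cases hj : j = i
  · subst hj
    simp [hi]
  · simp [hj]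

lemma ncard_update_ne_lt [Finite ι] {i : ι} (hi : a i ≠ b i) :
    {j | Function.update a i (b i) j ≠ b j}.ncard < {j | a j ≠ b j}.ncard := by
  refine Set.ncard_lt_ncard ⟨fun j hj => ?_, fun hsub => ?_⟩ (Set.toFinite _)
  · by_cases hji : j = i
    · subst hji
      simp at hj
    · simpa [hji] using hj
  · have := hsub (show i ∈ {j | a j ≠ b j} from hi)
    simp at this

end

/-- Any two corners of a cube are connected by an edge path. -/
lemma exists_isEdgePath_corner (h : K.Pt → ℝ) (c : K.Cube) (a b : K.Dir c → Bool) :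
    ∃ p, (K.sliced h).IsEdgePath (K.charMap c (corner a)) p (K.charMap c (corner b)) := by
  classical
  have := K.finite_dir c
  induction hn : {i | a i ≠ b i}.ncard using Nat.strong_induction_on generalizing a with
  | _ n ih =>
  subst hn
  by_cases hab : ∃ i, a i ≠ b i
  · obtain ⟨i, hi⟩ := hab
    obtain ⟨p, hp⟩ := ih _ (ncard_update_ne_lt a b hi) _ rfl
    refine ⟨K.edge c a (Function.update a i (b i)) :: p, ?_, edge_zero _ _ _, ?_⟩
    · exact ⟨c, a, _, .inl (ncard_ne_update a b hi), rfl⟩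
    · rwa [edge_one]
  · obtain rfl : a = b := funext fun i => by
      by_contra hi
      exact hab ⟨i, hi⟩
    exact ⟨[], rfl⟩

/-- A cube which meets the zero level has a corner in the zero level. -/
lemma IntegralHeight.exists_corner (hK : K.IntegralHeight h) {c : K.Cube} {x : K.Dir c → I}
    (hx : h (K.charMap c x) = 0) : ∃ a, h (K.charMap c (corner a)) = 0 := by
  classical
  obtain ⟨n, ρ, hρ1, hρ⟩ := hK c
  have := K.finite_dir c
  have := Fintype.ofFinite (K.Dir c)
  -- the height of the lowest corner is `n - N`
  obtain ⟨N, hN⟩ : ∃ N : ℕ, (N : ℤ) = ∑ i, if ρ i = 1 then 0 else 1 :=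
    ⟨∑ i, if ρ i = 1 then 0 else 1, by push_cast; rfl⟩
  have hNR : (N : ℝ) = ∑ i, if ρ i = 1 then (0 : ℝ) else 1 := by
    have := congrArg (fun k : ℤ => (k : ℝ)) hN
    push_cast at this
    exact this
  rw [hρ, finsum_eq_sum_of_fintype] at hx
  have h1 : -(N : ℝ) ≤ ∑ i, (ρ i : ℝ) * x i := by
    rw [hNR, ← Finset.sum_neg_distrib]
    refine Finset.sum_le_sum fun i _ => ?_
    have := (x i).2
    simp only [Set.mem_Icc] at this
    rcases hρ1 i with h1 | h1 <;> rw [h1] <;> norm_num <;> linarith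
  have h2 : ∑ i, (ρ i : ℝ) * x i ≤ Fintype.card (K.Dir c) - (N : ℝ) := by
    have : (Fintype.card (K.Dir c) : ℝ) = ∑ _i : K.Dir c, (1 : ℝ) := by simp
    rw [hNR, this, ← Finset.sum_sub_distrib]
    refine Finset.sum_le_sum fun i _ => ?_
    have := (x i).2
    simp only [Set.mem_Icc] at this
    rcases hρ1 i with h1 | h1 <;> rw [h1] <;> norm_num <;> linarith
  have h3 : n ≤ N := by exact_mod_cast (by linarith : (n : ℝ) ≤ N)
  have h4 : (N : ℤ) - n ≤ Fintype.card (K.Dir c) := by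
    exact_mod_cast (by push_cast; linarith :
      (((N : ℤ) - n : ℤ) : ℝ) ≤ ((Fintype.card (K.Dir c) : ℤ) : ℝ))
  obtain ⟨s, -, hs⟩ := Finset.exists_subset_card_eq
    (show ((N : ℤ) - n).toNat ≤ (Finset.univ : Finset (K.Dir c)).card by
      rw [Finset.card_univ]; omega)
  -- raise the lowest corner in the directions of `s`
  refine ⟨fun i => if i ∈ s then decide (ρ i = 1) else decide (ρ i ≠ 1), ?_⟩
  rw [hρ, finsum_eq_sum_of_fintype]
  have h5 : ∀ i, (ρ i : ℝ) * corner (fun i => if i ∈ s then decide (ρ i = 1) else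
      decide (ρ i ≠ 1)) i = (if i ∈ s then 1 else 0) - if ρ i = 1 then (0 : ℝ) else 1 := by
    intro i
    rw [corner_apply]
    rcases hρ1 i with h1 | h1 <;> by_cases his : i ∈ s <;> simp [h1, his]
  have hsR : (s.card : ℝ) = N - n := by
    have : (s.card : ℤ) = N - n := by omega
    exact_mod_cast this
  rw [Finset.sum_congr rfl fun i _ => h5 i, Finset.sum_sub_distrib, ← hNR]
  simp [hsR]

/-- Two different corners of a cube in the zero level have a common neighbour in the zero level,
namely the first one flipped in two of the directions in which they differ. -/
lemma IntegralHeight.exists_slicedAdj (hK : K.IntegralHeight h) {c : K.Cube} {a b : K.Dir c → Bool}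
    (ha : h (K.charMap c (corner a)) = 0) (hb : h (K.charMap c (corner b)) = 0) (hab : a ≠ b) :
    ∃ a', K.SlicedAdj h c a a' ∧ h (K.charMap c (corner a')) = 0 ∧
      {i | a' i ≠ b i}.ncard < {i | a i ≠ b i}.ncard := by
  classical
  obtain ⟨n, ρ, hρ1, hρ⟩ := hK c
  have := K.finite_dir c
  have := Fintype.ofFinite (K.Dir c)
  let w : K.Dir c → ℝ := fun i => (ρ i : ℝ) * corner b i - (ρ i : ℝ) * corner a i
  have hw : ∀ i, w i = if a i = b i then 0 else if (b i = true ↔ ρ i = 1) then 1 else -1 := by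
    intro i
    simp only [w, corner_apply]
    rcases hρ1 i with h1 | h1 <;> rw [h1] <;> cases a i <;> cases b i <;> norm_num
  have hsum : ∑ i, w i = 0 := by
    rw [Finset.sum_sub_distrib]
    rw [hρ, finsum_eq_sum_of_fintype] at ha hb
    linarith
  obtain ⟨k, hk⟩ : ∃ k, a k ≠ b k := Function.ne_iff.1 hab
  have hk0 : w k ≠ 0 := by
    rw [hw, if_neg hk]
    split_ifs <;> norm_num
  obtain ⟨i, -, hi⟩ := Finset.exists_pos_of_sum_zero_of_exists_nonzero w hsum
    ⟨k, Finset.mem_univ _, hk0⟩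
  obtain ⟨j, -, hj⟩ := Finset.exists_pos_of_sum_zero_of_exists_nonzero (fun i => -w i)
    (by rw [Finset.sum_neg_distrib, hsum, neg_zero]) ⟨k, Finset.mem_univ _, neg_ne_zero.2 hk0⟩
  have hwi : a i ≠ b i ∧ w i = 1 := by
    have := hw i
    split_ifs at this with h1 h2
    · linarith
    · exact ⟨h1, this⟩
    · linarith
  have hwj : a j ≠ b j ∧ w j = -1 := by
    have := hw j
    split_ifs at this with h1 h2
    · linarith
    · linarith
    · exact ⟨h1, this⟩
  have hij : i ≠ j := by
    rintro rfl
    linarith [hwi.2, hwj.2]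
  have hcorner : ∀ (a : K.Dir c → Bool) i, h (K.charMap c (corner (Function.update a i (b i)))) =
      h (K.charMap c (corner a)) + ((ρ i : ℝ) * corner b i - (ρ i : ℝ) * corner a i) := by
    intro a i
    have h1 : ∀ l, (ρ l : ℝ) * corner (Function.update a i (b i)) l = (ρ l : ℝ) * corner a l +
        if l = i then ((ρ i : ℝ) * corner b i - (ρ i : ℝ) * corner a i) else 0 := by
      intro l
      by_cases hl : l = i
      · subst hl
        simp [corner_apply]
      · simp [corner_apply, hl]
    rw [hρ, hρ, finsum_eq_sum_of_fintype, finsum_eq_sum_of_fintype,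
      Finset.sum_congr rfl fun l _ => h1 l, Finset.sum_add_distrib]
    simp [add_assoc]
  set a₁ := Function.update a i (b i) with ha₁
  have hj₁ : a₁ j = a j := by rw [ha₁, Function.update_of_ne hij.symm]
  have hj₁' : a₁ j ≠ b j := by rw [hj₁]; exact hwj.1
  have h0 : h (K.charMap c (corner (Function.update a₁ j (b j)))) = 0 := by
    rw [hcorner, ha₁, hcorner, ha, ← ha₁]
    have e1 : corner a₁ j = corner a j := by rw [corner_apply, corner_apply, hj₁]
    rw [e1]
    have e2 : w i = 1 := hwi.2
    have e3 : w j = -1 := hwj.2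
    simp only [w] at e2 e3
    linarith
  refine ⟨Function.update a₁ j (b j), slicedAdj_iff.2 (.inr ⟨?_, by rw [ha, h0]⟩), h0,
    (ncard_update_ne_lt a₁ b hj₁').trans (ncard_update_ne_lt a b hwi.1)⟩
  have : {l | a l ≠ Function.update a₁ j (b j) l} = {i, j} := by
    ext l
    by_cases hlj : l = j
    · subst hlj
      simp [hwj.1]
    · by_cases hli : l = i
      · subst hli
        simp [ha₁, hwi.1, hlj]
      · simp [ha₁, hlj, hli]
  rw [this, Set.ncard_pair hij]

lemma edge_mem_slicedZeroLevel (hK : K.IntegralHeight h) {c : K.Cube} {a b : K.Dir c → Bool}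
    (hab : K.SlicedAdj h c a b) (ha : h (K.charMap c (corner a)) = 0)
    (hb : h (K.charMap c (corner b)) = 0) : K.edge c a b ∈ (K.slicedZeroLevel h).edges := by
  refine ⟨⟨c, a, b, hab, rfl⟩, fun t => ?_⟩
  change h (K.charMap c (seg a b t)) = 0
  rw [hK.height_seg, ha, hb]
  ring

/-! ### Connectedness by edge paths -/

/-- In a connected complex, any two vertices are connected by an edge path. -/
theorem exists_isEdgePath [ConnectedSpace K.Pt] (h : K.Pt → ℝ) {p q : K.Pt} (hp : K.IsVertex p)
    (hq : K.IsVertex q) : ∃ l, (K.sliced h).IsEdgePath p l q := by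
  -- the union of the cubes with corners that can be reached from `p` is open and closed
  let W : Set K.Pt := {r | ∃ c x, K.charMap c x = r ∧
    ∀ a, ∃ l, (K.sliced h).IsEdgePath p l (K.charMap c (corner a))}
  have hW : ∀ c a, (∃ l, (K.sliced h).IsEdgePath p l (K.charMap c (corner a))) →
      ∀ b, ∃ l, (K.sliced h).IsEdgePath p l (K.charMap c (corner b)) := by
    rintro c a ⟨l, hl⟩ b
    obtain ⟨l', hl'⟩ := exists_isEdgePath_corner h c a b
    exact ⟨l ++ l', hl.append hl'⟩
  have hall : ∀ d y, K.charMap d y ∈ W →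
      ∀ b, ∃ l, (K.sliced h).IsEdgePath p l (K.charMap d (corner b)) := by
    rintro d y ⟨c, x, hxy, ha⟩
    obtain ⟨C⟩ := K.nonempty_carrier c x
    obtain ⟨D⟩ := K.nonempty_carrier d y
    rw [← C.charMap_pull fun _ _ => rfl, ← D.charMap_pull fun _ _ => rfl] at hxy
    have hCD := K.open_disjoint _ _ _ _ C.pull_mem_Ioo D.pull_mem_Ioo hxy
    obtain ⟨a₁, ha₁⟩ := C.exists_push_corner fun _ => false
    obtain ⟨b₁, hb₁⟩ := D.exists_push_corner fun _ => false
    refine hW d b₁ ?_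
    have := ha a₁
    rw [← ha₁, C.charMap_push] at this
    rw [← hb₁, D.charMap_push]
    rwa [show K.charMap C.cell (corner fun _ => false) = K.charMap D.cell (corner fun _ => false)
      by rw [hCD]] at this
  have hpre : ∀ d, K.charMap d ⁻¹' W = ∅ ∨ K.charMap d ⁻¹' W = Set.univ := by
    intro d
    by_cases hd : ∃ y, K.charMap d y ∈ W
    · obtain ⟨y, hy⟩ := hd
      exact .inr (Set.eq_univ_of_forall fun y' => ⟨d, y', rfl, hall d y hy⟩)
    · exact .inl (Set.eq_empty_of_forall_notMem fun y hy => hd ⟨y, hy⟩)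
  have hclopen : IsClopen W := by
    refine ⟨isClosed_iff.2 fun d => ?_, isOpen_iff.2 fun d => ?_⟩ <;>
      rcases hpre d with h1 | h1 <;> rw [h1] <;> simp
  have hpW : p ∈ W := by
    obtain ⟨c, a, rfl⟩ := hp.exists_corner
    exact ⟨c, _, rfl, hW c a ⟨[], rfl⟩⟩
  have huniv := hclopen.eq_univ ⟨p, hpW⟩
  obtain ⟨d, b, rfl⟩ := hq.exists_corner
  exact hall d (corner b) (huniv ▸ Set.mem_univ _) b

lemma exists_isVertex (K : CubeComplex.{u, v}) [hne : Nonempty K.Pt] : ∃ p, K.IsVertex p := by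
  obtain ⟨p⟩ := hne
  obtain ⟨c, -⟩ := K.exists_open p
  exact ⟨_, isVertex_corner c fun _ => false⟩

variable {X₁ : CubeComplex.{u₁, v₁}} {X₂ : CubeComplex.{u₂, v₂}} {X₃ : CubeComplex.{u₃, v₃}}
  {h₁ : X₁.Pt → ℝ} {h₂ : X₂.Pt → ℝ} {h₃ : X₃.Pt → ℝ}

/-- The zero level of a product of three connected complexes is connected by edge paths. -/
theorem exists_isEdgePath_zeroLevel [ConnectedSpace X₁.Pt] [ConnectedSpace X₂.Pt]
    [ConnectedSpace X₃.Pt] (hX₁ : X₁.IntegralHeight h₁) (hX₂ : X₂.IntegralHeight h₂)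
    (hX₃ : X₃.IntegralHeight h₃) (hlines₁ : X₁.HasLines h₁) (hlines₃ : X₃.HasLines h₃)
    {p q : ((X₁.prod X₂).prod X₃).Pt} (hp : ((X₁.prod X₂).prod X₃).IsVertex p)
    (hq : ((X₁.prod X₂).prod X₃).IsVertex q)
    (hp0 : prodHeight (prodHeight h₁ h₂) h₃ p = 0) (hq0 : prodHeight (prodHeight h₁ h₂) h₃ q = 0) :
    ∃ γ, (((X₁.prod X₂).prod X₃).slicedZeroLevel
      (prodHeight (prodHeight h₁ h₂) h₃)).IsEdgePath p γ q := by
  obtain ⟨⟨x, y⟩, z⟩ := p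
  obtain ⟨⟨x', y'⟩, z'⟩ := q
  replace hp0 : h₁ x + h₂ y + h₃ z = 0 := hp0
  replace hq0 : h₁ x' + h₂ y' + h₃ z' = 0 := hq0
  have hx : X₁.IsVertex x := hp.fst.fst
  have hy : X₂.IsVertex y := hp.fst.snd
  have hz : X₃.IsVertex z := hp.snd
  have hx' : X₁.IsVertex x' := hq.fst.fst
  have hy' : X₂.IsVertex y' := hq.fst.snd
  have hz' : X₃.IsVertex z' := hq.snd
  obtain ⟨ν, hν, hνx⟩ := hlines₁ x' hx'
  obtain ⟨l, hl, hlz⟩ := hlines₃ z hz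
  obtain rfl : z = l (-(h₁ x + h₂ y)) := by
    rw [← hlz]; congr 1; linarith
  obtain ⟨s, hs⟩ := exists_isEdgePath h₁ hx hx'
  obtain ⟨t, ht⟩ := exists_isEdgePath h₂ hy hy'
  obtain ⟨r, hr⟩ := exists_isEdgePath h₃ (hl.isVertex_neg hX₁ hX₂ hx' hy') hz'
  have h1 := ((isEdgePath_hpath (k := h₂) hX₁ hy hs).append
    (isEdgePath_vpath (h := h₁) hX₂ hx' ht)).map (isMorphism_chart₃ hX₁ hX₂ hl).edges
  rw [chart₃_apply, chart₃_apply] at h1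
  have h2 := isEdgePath_chart₁ hX₁ hX₂ hX₃ hν hy' hνx (by rw [hl.height]; ring) hq0 hr
  exact ⟨_, h1.append h2⟩

lemma exists_isVertex_zeroLevel [Nonempty X₁.Pt] [Nonempty X₂.Pt] [Nonempty X₃.Pt]
    (hX₁ : X₁.IntegralHeight h₁) (hX₂ : X₂.IntegralHeight h₂) (hlines₃ : X₃.HasLines h₃) :
    ∃ p, ((X₁.prod X₂).prod X₃).IsVertex p ∧ prodHeight (prodHeight h₁ h₂) h₃ p = 0 := by
  obtain ⟨x, hx⟩ := X₁.exists_isVertex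
  obtain ⟨y, hy⟩ := X₂.exists_isVertex
  obtain ⟨z, hz⟩ := X₃.exists_isVertex
  obtain ⟨l, hl, -⟩ := hlines₃ z hz
  refine ⟨((x, y), l (-(h₁ x + h₂ y))), (hx.prodMk hy).prodMk (hl.isVertex_neg hX₁ hX₂ hx hy), ?_⟩
  change h₁ x + h₂ y + h₃ _ = 0
  rw [hl.height]
  ring

end CubeComplex

/-! ### Homotopy classes of edge paths in the zero level -/

namespace CubeComplex

open TwoSkeleton

variable {K : CubeComplex.{u, v}} {h : K.Pt → ℝ} {p q r s : K.zeroLevel h}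

lemma continuous_lerp_comp {X : Type*} [TopologicalSpace X] {ι : Type} {f g : X → ι → I} {t : X → I}
    (hf : Continuous f) (hg : Continuous g) (ht : Continuous t) :
    Continuous fun x => lerp (f x) (g x) (t x) :=
  continuous_lerp.comp (hf.prodMk (hg.prodMk ht))

/-- Paths in the zero level which lift to the same cube, with equal ends, are homotopic, because the
part of the cube in the zero level is convex. -/
lemma homotopic_of_lift (hK : K.IntegralHeight h) {γ γ' : Path p q} {c : K.Cube}
    {f g : C(I, K.Dir c → I)} (hf : ∀ t, K.charMap c (f t) = γ t)
    (hg : ∀ t, K.charMap c (g t) = γ' t) (h0 : f 0 = g 0) (h1 : f 1 = g 1) :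
    γ.Homotopic γ' := by
  have hlev : ∀ s t, K.charMap c (lerp (f t) (g t) s) ∈ K.zeroLevel h := fun s t => by
    change h _ = 0
    rw [hK.height_lerp, hf, hg, (γ t).2, (γ' t).2]
    ring
  refine ⟨⟨⟨⟨fun x => ⟨_, hlev x.1 x.2⟩, ?_⟩, fun t => ?_, fun t => ?_⟩, ?_⟩⟩
  · exact ((K.continuous_charMap c).comp (continuous_lerp_comp (f.continuous.comp continuous_snd)
      (g.continuous.comp continuous_snd) continuous_fst)).subtype_mk _
  · exact Subtype.ext (by simp [hf])
  · exact Subtype.ext (by simp [hg])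
  · rintro s t (rfl | rfl)
    · exact Subtype.ext (by simp only [ContinuousMap.coe_mk, ← h0, lerp_self, hf]; rfl)
    · exact Subtype.ext (by simp only [ContinuousMap.coe_mk, ← h1, lerp_self, hf]; rfl)

/-- The straight segment from `x` to `y` in the cube `c`. -/
def segPath (hK : K.IntegralHeight h) (c : K.Cube) (x y : K.Dir c → I) (hx : K.charMap c x = p)
    (hy : K.charMap c y = q) : Path p q where
  toFun t := ⟨K.charMap c (lerp x y t), by
    change h _ = 0
    rw [hK.height_lerp, hx, hy, p.2, q.2]
    ring⟩
  continuous_toFun := by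
    exact ((K.continuous_charMap c).comp (continuous_lerp_comp continuous_const continuous_const
      continuous_id)).subtype_mk _
  source' := Subtype.ext (by simp [hx])
  target' := Subtype.ext (by simp [hy])

/-- The class of the straight segment from `x` to `y` in the cube `c`. -/
noncomputable def segClass (hK : K.IntegralHeight h) (c : K.Cube) (x y : K.Dir c → I)
    (hx : K.charMap c x = p) (hy : K.charMap c y = q) : Path.Homotopic.Quotient p q :=
  Path.Homotopic.Quotient.mk (segPath hK c x y hx hy)

/-- The straight segment from `x` to `y` in a cube of parameters. -/
def lerpPath {ι : Type} (x y : ι → I) : Path x y where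
  toFun := lerp x y
  continuous_toFun := continuous_lerp_comp continuous_const continuous_const continuous_id
  source' := lerp_zero x y
  target' := lerp_one x y

lemma segClass_trans (hK : K.IntegralHeight h) {c : K.Cube} {x y z : K.Dir c → I}
    (hx : K.charMap c x = p) (hy : K.charMap c y = q) (hz : K.charMap c z = r) :
    (segClass hK c x y hx hy).trans (segClass hK c y z hy hz) = segClass hK c x z hx hz := by
  rw [segClass, segClass, segClass, ← Path.Homotopic.Quotient.mk_trans, Path.Homotopic.Quotient.eq]
  refine homotopic_of_lift hK (f := ((lerpPath x y).trans (lerpPath y z)).toContinuousMap)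
    (g := (lerpPath x z).toContinuousMap) (fun t => ?_) (fun t => rfl) (by simp) (by simp)
  change K.charMap c (((lerpPath x y).trans (lerpPath y z)) t) = _
  rw [Path.trans_apply, Path.trans_apply]
  split_ifs <;> rfl

lemma segClass_self (hK : K.IntegralHeight h) {c : K.Cube} {x : K.Dir c → I}
    (hx : K.charMap c x = p) : segClass hK c x x hx hx = Path.Homotopic.Quotient.refl p := by
  rw [segClass, ← Path.Homotopic.Quotient.mk_refl, Path.Homotopic.Quotient.eq]
  exact homotopic_of_lift hK (f := .const _ x) (g := .const _ x) (fun t => by simp [segPath])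
    (fun t => by simp [hx]) rfl rfl

/-- An edge of the zero level, as a path. -/
def edgePath {e : I → K.Pt} (he : e ∈ (K.slicedZeroLevel h).edges) (h0 : e 0 = p) (h1 : e 1 = q) :
    Path p q where
  toFun t := ⟨e t, he.2 t⟩
  continuous_toFun := by
    obtain ⟨c, a, b, -, rfl⟩ := he.1
    refine Continuous.subtype_mk ((K.continuous_charMap c).comp ?_) _
    rw [show seg a b = lerp (corner a) (corner b) from funext (seg_eq_lerp a b)]
    exact continuous_lerp_comp continuous_const continuous_const continuous_id
  source' := Subtype.ext h0
  target' := Subtype.ext h1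

/-- The homotopy class of an edge path in the zero level. -/
noncomputable def pathClass : ∀ (l : List (I → K.Pt)) (p q : K.zeroLevel h),
    (K.slicedZeroLevel h).IsEdgePath p l q → Path.Homotopic.Quotient p q
  | [], p, _, hl => (Path.Homotopic.Quotient.refl p).cast rfl (Subtype.ext hl).symm
  | e :: l, _, q, hl =>
    (Path.Homotopic.Quotient.mk (edgePath (q := ⟨e 1, hl.1.2 1⟩) hl.1 hl.2.1 rfl)).trans
      (pathClass l ⟨e 1, hl.1.2 1⟩ q hl.2.2)

lemma pathClass_nil (hl : (K.slicedZeroLevel h).IsEdgePath (p : K.Pt) [] p) :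
    pathClass [] p p hl = Path.Homotopic.Quotient.refl p := rfl

lemma pathClass_append {l l' : List (I → K.Pt)}
    (hl : (K.slicedZeroLevel h).IsEdgePath (p : K.Pt) l q)
    (hl' : (K.slicedZeroLevel h).IsEdgePath (q : K.Pt) l' r)
    (hll' : (K.slicedZeroLevel h).IsEdgePath (p : K.Pt) (l ++ l') r) :
    pathClass (l ++ l') p r hll' = (pathClass l p q hl).trans (pathClass l' q r hl') := by
  induction l generalizing p with
  | nil =>
    obtain rfl : p = q := Subtype.ext hl
    rw [pathClass_nil, Path.Homotopic.Quotient.refl_trans]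
    rfl
  | cons e l ih =>
    simp only [List.cons_append, pathClass]
    rw [Path.Homotopic.Quotient.trans_assoc, ih hl.2.2]

lemma pathClass_singleton {e : I → K.Pt} (he : e ∈ (K.slicedZeroLevel h).edges) (h0 : e 0 = p)
    (h1 : e 1 = q) (hl : (K.slicedZeroLevel h).IsEdgePath (p : K.Pt) [e] q) :
    pathClass [e] p q hl = Path.Homotopic.Quotient.mk (edgePath he h0 h1) := by
  obtain rfl : q = ⟨e 1, he.2 1⟩ := Subtype.ext h1.symm
  change Path.Homotopic.Quotient.trans _ (Path.Homotopic.Quotient.refl _) = _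
  rw [Path.Homotopic.Quotient.trans_refl]

lemma pathClass_edge (hK : K.IntegralHeight h) {c : K.Cube} {a b : K.Dir c → Bool}
    (ha : K.charMap c (corner a) = p) (hb : K.charMap c (corner b) = q)
    (hl : (K.slicedZeroLevel h).IsEdgePath (p : K.Pt) [K.edge c a b] q) :
    pathClass [K.edge c a b] p q hl = segClass hK c (corner a) (corner b) ha hb := by
  rw [pathClass_singleton hl.1 hl.2.1 hl.2.2, segClass]
  congr 1
  refine Path.ext (funext fun t => Subtype.ext ?_)
  change K.charMap c (seg a b t) = K.charMap c (lerp _ _ t)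
  rw [seg_eq_lerp]

/-- Combinatorially homotopic paths are homotopic. -/
theorem pathClass_eq_of_homotopic (hK : K.IntegralHeight h) {a b : K.Pt} {l l' : List (I → K.Pt)}
    {n : ℕ} (hll' : (K.slicedZeroLevel h).Homotopic a b l l' n) (ha : a = p) (hb : b = q)
    (hl : (K.slicedZeroLevel h).IsEdgePath (p : K.Pt) l q)
    (hl' : (K.slicedZeroLevel h).IsEdgePath (p : K.Pt) l' q) :
    pathClass l p q hl = pathClass l' p q hl' := by
  have hinsert : ∀ {u w m : List (I → K.Pt)},
      (∀ (r : K.zeroLevel h) (hm : (K.slicedZeroLevel h).IsEdgePath (r : K.Pt) m r),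
        pathClass m r r hm = Path.Homotopic.Quotient.refl r) →
      (∀ x y, (K.slicedZeroLevel h).IsEdgePath x m y → x = y) →
      ∀ (h1 : (K.slicedZeroLevel h).IsEdgePath (p : K.Pt) (u ++ w) q)
        (h2 : (K.slicedZeroLevel h).IsEdgePath (p : K.Pt) (u ++ (m ++ w)) q),
      pathClass (u ++ w) p q h1 = pathClass (u ++ (m ++ w)) p q h2 := by
    intro u w m hm hcl h1 h2
    obtain ⟨x, hu, hmw⟩ := isEdgePath_append.1 h2
    obtain ⟨y, hm', hw⟩ := isEdgePath_append.1 hmw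
    obtain rfl := hcl _ _ hm'
    have hx := mem_zeroLevel_of_isEdgePath hu p.2
    rw [pathClass_append (q := ⟨x, hx⟩) hu hw, pathClass_append (q := ⟨x, hx⟩) hu hmw,
      pathClass_append (q := ⟨x, hx⟩) hm' hw, hm ⟨x, hx⟩, Path.Homotopic.Quotient.refl_trans]
  induction hll' with
  | refl => rfl
  | backtrack u w e hu =>
    refine hinsert (m := [e, rev e]) (fun r hm => ?_) ?_ _ _
    · obtain ⟨⟨c, d, d', -, rfl⟩, -⟩ := hm.1
      have h0 := hm.2.1
      change K.edge c d d' 0 = _ at h0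
      rw [edge_zero] at h0
      have hm' := hm
      change (K.slicedZeroLevel h).IsEdgePath (r : K.Pt) ([K.edge c d d'] ++ [rev (K.edge c d d')])
        r at hm'
      have hm'' := hm'
      rw [rev_edge] at hm'
      obtain ⟨y, hm1, hm2⟩ := isEdgePath_append.1 hm'
      have hy := mem_zeroLevel_of_isEdgePath hm1 r.2
      have h1 : K.charMap c (corner d') = y := by
        rw [← edge_one c d]
        exact hm1.2.2
      change pathClass ([K.edge c d d'] ++ [rev (K.edge c d d')]) r r hm'' = _
      simp only [rev_edge]
      rw [pathClass_append (q := ⟨y, hy⟩) hm1 hm2, pathClass_edge hK h0 h1, pathClass_edge hK h1 h0,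
        segClass_trans, segClass_self]
    · rintro x y ⟨-, h0, -, -, h1⟩
      rw [← h0, ← rev_one e, h1]
  | face u m w hm hu =>
    have hproper := proper_slicedZeroLevel (K := K) (h := h)
    simp only [List.append_assoc]
    refine hinsert (m := m) (fun r hr => ?_) (fun x y hxy => hproper.closed m hm x y hxy) _ _
    obtain ⟨⟨c, d, d', d'', -, -, -, rfl⟩, -⟩ := hm
    have h0 : K.charMap c (corner d) = r := by
      rw [← edge_zero c d d']
      exact hr.2.1
    have h1 : K.charMap c (corner d') ∈ K.zeroLevel h := by
      rw [← edge_one c d d']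
      exact hr.1.2 1
    have h2 : K.charMap c (corner d'') ∈ K.zeroLevel h := by
      rw [← edge_one c d' d'']
      exact hr.2.2.1.2 1
    have hr' : (K.slicedZeroLevel h).IsEdgePath (r : K.Pt)
      ([K.edge c d d'] ++ ([K.edge c d' d''] ++ [K.edge c d'' d])) r := hr
    have e1 : (K.slicedZeroLevel h).IsEdgePath (r : K.Pt) [K.edge c d d']
      (K.charMap c (corner d')) := isEdgePath_singleton' hr.1 hr.2.1 (edge_one _ _ _)
    have e2 : (K.slicedZeroLevel h).IsEdgePath (K.charMap c (corner d')) [K.edge c d' d'']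
      (K.charMap c (corner d'')) :=
        isEdgePath_singleton' hr.2.2.1 (edge_zero _ _ _) (edge_one _ _ _)
    have e3 : (K.slicedZeroLevel h).IsEdgePath (K.charMap c (corner d'')) [K.edge c d'' d] r :=
        isEdgePath_singleton' hr.2.2.2.2.1 (edge_zero _ _ _) ((edge_one _ _ _).trans h0)
    change pathClass ([K.edge c d d'] ++ ([K.edge c d' d''] ++ [K.edge c d'' d])) r r hr' = _
    rw [pathClass_append (q := ⟨_, h1⟩) e1 (e2.append e3),
      pathClass_append (p := ⟨_, h1⟩) (q := ⟨_, h2⟩) e2 e3,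
      pathClass_edge (q := ⟨_, h1⟩) hK h0 rfl,
      pathClass_edge (p := ⟨_, h1⟩) (q := ⟨_, h2⟩) hK rfl rfl,
      pathClass_edge (p := ⟨_, h2⟩) hK rfl h0, segClass_trans, segClass_trans, segClass_self]
  | symm _ ih => exact (ih hl' hl).symm
  | trans hab hbc ih1 ih2 =>
    subst ha hb
    have hmid := (hab.isEdgePath proper_slicedZeroLevel).2
    exact (ih1 hl hmid).trans (ih2 hmid hl')

end CubeComplex

/-! ### Classes of paths from a base vertex to arbitrary points of the zero level -/

namespace CubeComplex

open TwoSkeleton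

variable {K : CubeComplex.{u, v}} {h : K.Pt → ℝ} {v p q r s : K.zeroLevel h}

/-- Every closed edge path in the zero level is combinatorially contractible. -/
def Fillable (K : CubeComplex.{u, v}) (h : K.Pt → ℝ) : Prop :=
  ∀ p l, (K.slicedZeroLevel h).IsEdgePath p l p → ∃ n, (K.slicedZeroLevel h).HomotopicLE p p l [] n

lemma Fillable.pathClass_eq (hf : K.Fillable h) (hK : K.IntegralHeight h) {l l' : List (I → K.Pt)}
    (hl : (K.slicedZeroLevel h).IsEdgePath (p : K.Pt) l q)
    (hl' : (K.slicedZeroLevel h).IsEdgePath (p : K.Pt) l' q) :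
    pathClass l p q hl = pathClass l' p q hl' := by
  have hS := proper_slicedZeroLevel (K := K) (h := h)
  obtain ⟨n, hn⟩ := hf _ _ (hl.append (hl'.revPath hS))
  have h1 := (homotopicLE_revPath_append hS hl').append_left hl
  have h2 := hn.append_right hl'
  rw [List.append_assoc] at h2
  rw [List.append_nil] at h1
  obtain ⟨m, -, hm⟩ := h1.symm.trans h2
  exact pathClass_eq_of_homotopic hK hm rfl rfl hl hl'

/-- Corners of a cube in the zero level are connected by an edge path which is homotopic to the
straight segment. -/
lemma exists_pathClass_eq_segClass (hK : K.IntegralHeight h) {c : K.Cube} {a b : K.Dir c → Bool}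
    (ha : K.charMap c (corner a) = p) (hb : K.charMap c (corner b) = q) :
    ∃ l, ∃ hl : (K.slicedZeroLevel h).IsEdgePath (p : K.Pt) l q,
      pathClass l p q hl = segClass hK c (corner a) (corner b) ha hb := by
  induction hn : {i | a i ≠ b i}.ncard using Nat.strong_induction_on generalizing a p with
  | _ n ih =>
  subst hn
  by_cases hab : a = b
  · subst hab
    obtain rfl : p = q := Subtype.ext (ha.symm.trans hb)
    exact ⟨[], rfl, by rw [segClass_self]; rfl⟩
  · have ha0 : h (K.charMap c (corner a)) = 0 := ha ▸ p.2
    have hb0 : h (K.charMap c (corner b)) = 0 := hb ▸ q.2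
    obtain ⟨a', hadj, h0, hlt⟩ := hK.exists_slicedAdj ha0 hb0 hab
    obtain ⟨l, hl, hcl⟩ := ih _ hlt (p := ⟨_, h0⟩) rfl rfl
    have he : (K.slicedZeroLevel h).IsEdgePath (p : K.Pt) [K.edge c a a']
        (K.charMap c (corner a')) :=
      isEdgePath_singleton' (edge_mem_slicedZeroLevel hK hadj ha0 h0)
        ((edge_zero _ _ _).trans ha) (edge_one _ _ _)
    refine ⟨[K.edge c a a'] ++ l, he.append hl, ?_⟩
    rw [pathClass_append (q := ⟨_, h0⟩) he hl, pathClass_edge (q := ⟨_, h0⟩) hK ha rfl, hcl,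
      segClass_trans]

/-- The class `ξ` from the base point `v` to `q` is represented by an edge path to a corner of a
cube `c` which contains `q`, followed by a straight segment in the cube. -/
def IsClass (hK : K.IntegralHeight h) (v q : K.zeroLevel h) (ξ : Path.Homotopic.Quotient v q) :
    Prop :=
  ∃ (c : K.Cube) (x : K.Dir c → I) (a : K.Dir c → Bool) (l : List (I → K.Pt))
    (ha : K.charMap c (corner a) ∈ K.zeroLevel h) (hx : K.charMap c x = q)
    (hl : (K.slicedZeroLevel h).IsEdgePath (v : K.Pt) l (K.charMap c (corner a))),
    ξ = (pathClass l v ⟨_, ha⟩ hl).trans (segClass hK c (corner a) x rfl hx)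

lemma segClass_congr (hK : K.IntegralHeight h) {c d : K.Cube} {x y : K.Dir c → I}
    {x' y' : K.Dir d → I} (hx : K.charMap c x = p) (hy : K.charMap c y = q)
    (hx' : K.charMap d x' = p) (hy' : K.charMap d y' = q)
    (hlerp : ∀ t, K.charMap c (lerp x y t) = K.charMap d (lerp x' y' t)) :
    segClass hK c x y hx hy = segClass hK d x' y' hx' hy' := by
  rw [segClass, segClass]
  congr 1
  exact Path.ext (funext fun t => Subtype.ext (hlerp t))

/-- Passage from a cube which contains `q` to the cube which contains `q` in its interior. -/
lemma IsClass.eq_of_carrier (hf : K.Fillable h) (hK : K.IntegralHeight h) {c : K.Cube}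
    {x : K.Dir c → I} {a : K.Dir c → Bool} {l : List (I → K.Pt)}
    (ha : K.charMap c (corner a) = p) (hx : K.charMap c x = q)
    (hl : (K.slicedZeroLevel h).IsEdgePath (v : K.Pt) l p) (C : K.Carrier c x)
    {a' : K.Dir C.cell → Bool} {l' : List (I → K.Pt)} (ha' : K.charMap C.cell (corner a') = r)
    (hx' : K.charMap C.cell (C.pull x) = q)
    (hl' : (K.slicedZeroLevel h).IsEdgePath (v : K.Pt) l' r) :
    (pathClass l v p hl).trans (segClass hK c (corner a) x ha hx) =
      (pathClass l' v r hl').trans (segClass hK C.cell (corner a') (C.pull x) ha' hx') := by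
  obtain ⟨b, hb⟩ := C.exists_push_corner a'
  have hbr : K.charMap c (corner b) = r := by rw [← hb, C.charMap_push, ha']
  obtain ⟨m, hm, hcl⟩ := exists_pathClass_eq_segClass hK ha hbr
  have e1 : segClass hK C.cell (corner a') (C.pull x) ha' hx' =
      segClass hK c (corner b) x hbr hx := by
    refine segClass_congr hK _ _ _ _ fun t => ?_
    rw [← C.charMap_push, C.push_lerp, C.push_pull fun _ _ => rfl, hb]
  rw [e1, hf.pathClass_eq hK hl' (hl.append hm), pathClass_append hl hm, hcl,
    Path.Homotopic.Quotient.trans_assoc, segClass_trans]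

/-- The class depends only on the point: in the cube which contains `q` in its interior, two corners
in the zero level are connected by an edge path homotopic to the straight segment, and closed edge
paths are contractible. -/
theorem IsClass.unique (hf : K.Fillable h) (hK : K.IntegralHeight h)
    {ξ ξ' : Path.Homotopic.Quotient v q} (hξ : IsClass hK v q ξ) (hξ' : IsClass hK v q ξ') :
    ξ = ξ' := by
  obtain ⟨c, x, a, l, ha, hx, hl, rfl⟩ := hξ
  obtain ⟨d, y, b, l', hb, hy, hl', rfl⟩ := hξ'
  obtain ⟨C⟩ := K.nonempty_carrier c x
  obtain ⟨D⟩ := K.nonempty_carrier d y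
  have hCx : K.charMap C.cell (C.pull x) = q := (C.charMap_pull fun _ _ => rfl).trans hx
  have hDy : K.charMap D.cell (D.pull y) = q := (D.charMap_pull fun _ _ => rfl).trans hy
  have hCD := K.open_disjoint _ _ _ _ C.pull_mem_Ioo D.pull_mem_Ioo (hCx.trans hDy.symm)
  obtain ⟨a', ha'⟩ := hK.exists_corner (show h (K.charMap C.cell (C.pull x)) = 0 from hCx ▸ q.2)
  -- an edge path to the new corner, through the cube `c`
  obtain ⟨a₁, ha₁⟩ := C.exists_push_corner a'
  have hr : K.charMap c (corner a₁) = (⟨_, ha'⟩ : K.zeroLevel h) := by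
    rw [← ha₁, C.charMap_push]
  obtain ⟨m, hm, -⟩ := exists_pathClass_eq_segClass hK (p := ⟨_, ha⟩) rfl hr
  rw [IsClass.eq_of_carrier hf hK (p := ⟨_, ha⟩) rfl hx hl C (r := ⟨_, ha'⟩) rfl hCx
    (hl.append hm)]
  have key : ∀ (e : K.Cube) (he : C.cell = e) (w : K.Dir e → I) (hw : ∀ i, 0 < w i ∧ w i < 1)
      (hwq : K.charMap e w = q), ∃ b' : K.Dir e → Bool, ∃ (hb' : K.charMap e (corner b') =
      (⟨_, ha'⟩ : K.zeroLevel h)),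
      segClass hK C.cell (corner a') (C.pull x) rfl hCx = segClass hK e (corner b') w hb' hwq := by
    rintro e rfl w hw hwq
    obtain rfl := K.open_injective _ _ _ hw C.pull_mem_Ioo (hwq.trans hCx.symm)
    exact ⟨a', rfl, rfl⟩
  obtain ⟨b', hb', hseg⟩ := key _ hCD _ D.pull_mem_Ioo hDy
  rw [hseg]
  exact (IsClass.eq_of_carrier hf hK (p := ⟨_, hb⟩) rfl hy hl' D (r := ⟨_, ha'⟩) hb' hDy
    (hl.append hm)).symm

/-- Moving along a straight segment in a cube. -/
lemma IsClass.trans_segClass (hf : K.Fillable h) (hK : K.IntegralHeight h)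
    {ξ : Path.Homotopic.Quotient v q} (hξ : IsClass hK v q ξ) {c : K.Cube} {x y : K.Dir c → I}
    (hx : K.charMap c x = q) (hy : K.charMap c y = r) :
    IsClass hK v r (ξ.trans (segClass hK c x y hx hy)) := by
  have hξ' := hξ
  obtain ⟨d, z, b, l, hb, hz, hl, rfl⟩ := hξ
  -- a representation of the same class in the cube `c`
  obtain ⟨C⟩ := K.nonempty_carrier c x
  obtain ⟨D⟩ := K.nonempty_carrier d z
  have hCx : K.charMap C.cell (C.pull x) = q := (C.charMap_pull fun _ _ => rfl).trans hx
  have hDz : K.charMap D.cell (D.pull z) = q := (D.charMap_pull fun _ _ => rfl).trans hz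
  have hCD := K.open_disjoint _ _ _ _ D.pull_mem_Ioo C.pull_mem_Ioo (hDz.trans hCx.symm)
  obtain ⟨a', ha'⟩ := hK.exists_corner (show h (K.charMap D.cell (D.pull z)) = 0 from hDz ▸ q.2)
  obtain ⟨b₁, hb₁⟩ := D.exists_push_corner a'
  have hr : K.charMap d (corner b₁) = (⟨_, ha'⟩ : K.zeroLevel h) := by
    rw [← hb₁, D.charMap_push]
  obtain ⟨m, hm, -⟩ := exists_pathClass_eq_segClass hK (p := ⟨_, hb⟩) rfl hr
  obtain ⟨a, ha⟩ : ∃ a, K.charMap c (corner a) = (⟨_, ha'⟩ : K.zeroLevel h) := by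
    have key : ∀ e, D.cell = e → ∃ b' : K.Dir e → Bool,
        K.charMap e (corner b') = (⟨_, ha'⟩ : K.zeroLevel h) := by
      rintro e rfl
      exact ⟨a', rfl⟩
    obtain ⟨b', hb'⟩ := key _ hCD
    obtain ⟨a, ha⟩ := C.exists_push_corner b'
    exact ⟨a, by rw [← ha, C.charMap_push, hb']⟩
  have hl' : (K.slicedZeroLevel h).IsEdgePath (v : K.Pt) (l ++ m) (K.charMap c (corner a)) := by
    rw [ha]
    exact hl.append hm
  have ha0 : K.charMap c (corner a) ∈ K.zeroLevel h := ha ▸ ha'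
  rw [IsClass.unique hf hK hξ' ⟨c, x, a, l ++ m, ha0, hx, hl', rfl⟩,
    Path.Homotopic.Quotient.trans_assoc, segClass_trans]
  exact ⟨c, y, a, l ++ m, ha0, hy, hl', rfl⟩

lemma exists_isClass (hK : K.IntegralHeight h)
    (hconn : ∀ w, K.IsVertex w → h w = 0 → ∃ l, (K.slicedZeroLevel h).IsEdgePath (v : K.Pt) l w)
    (q : K.zeroLevel h) : ∃ ξ, IsClass hK v q ξ := by
  obtain ⟨c, x, -, hx⟩ := K.exists_open q
  obtain ⟨a, ha⟩ := hK.exists_corner (show h (K.charMap c x) = 0 from hx ▸ q.2)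
  obtain ⟨l, hl⟩ := hconn _ (isVertex_corner c a) ha
  exact ⟨_, c, x, a, l, ha, hx, hl, rfl⟩

end CubeComplex

/-! ### Conical neighbourhoods of points -/

lemma dist_flipIf (b : Bool) (s t : I) : dist (flipIf b s) (flipIf b t) = dist s t := by
  cases b
  · rfl
  · rw [Subtype.dist_eq, Subtype.dist_eq, coe_flipIf, coe_flipIf, if_pos rfl, if_pos rfl,
      dist_sub_left]

namespace CubeComplex

variable {K : CubeComplex.{u, v}} {h : K.Pt → ℝ} {p : K.Pt} {ε : ℝ}

/-- The positive number `ε` is so small that different coordinates of preimages of `p` in the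
cubes, including `0` and `1`, have distance at least `2 * ε`. -/
def IsGap (K : CubeComplex.{u, v}) (p : K.Pt) (ε : ℝ) : Prop :=
  0 < ε ∧ ∃ F : Set I, 0 ∈ F ∧ 1 ∈ F ∧
    (∀ c (x : K.Dir c → I), K.charMap c x = p → ∀ i, x i ∈ F) ∧
    ∀ s ∈ F, ∀ t ∈ F, dist s t < 2 * ε → s = t

/-- The coordinates of the preimages of `p` are `0`, `1` and, up to reflection, those of its
preimage in an open cube. These are finitely many numbers. -/
lemma exists_isGap (K : CubeComplex.{u, v}) (p : K.Pt) : ∃ ε, K.IsGap p ε := by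
  obtain ⟨e, z, hz, rfl⟩ := K.exists_open p
  have := K.finite_dir e
  let F : Set I := {0, 1} ∪ (Set.range z ∪ Set.range fun k => unitInterval.symm (z k))
  have hF : F.Finite := (Set.toFinite _).union ((Set.finite_range _).union (Set.finite_range _))
  have h0 : (0 : I) ∈ F := by simp [F]
  have h1 : (1 : I) ∈ F := by simp [F]
  have hpos : 0 < F.infsep :=
    (hF.infsep_pos_iff_nontrivial).2 ⟨0, h0, 1, h1, zero_ne_one⟩
  refine ⟨F.infsep / 2, half_pos hpos, F, h0, h1, fun c x hx i => ?_, fun s hs t ht hst => ?_⟩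
  · by_cases hi : 0 < x i ∧ x i < 1
    · obtain ⟨C⟩ := K.nonempty_carrier c x
      have hx' := (C.charMap_pull fun _ _ => rfl).trans hx
      have hmem : ∀ k, C.pull x k ∈ Set.range z := by
        have key : ∀ (d : K.Cube) (hd : d = e) (w : K.Dir d → I) (hw : ∀ i, 0 < w i ∧ w i < 1)
            (hwz : K.charMap d w = K.charMap e z) (k : K.Dir d), w k ∈ Set.range z := by
          rintro d rfl w hw hwz k
          obtain rfl := K.open_injective _ _ _ hw hz hwz
          exact ⟨k, rfl⟩
        exact key _ (K.open_disjoint _ _ _ _ C.pull_mem_Ioo hz hx') _ C.pull_mem_Ioo hx'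
      obtain ⟨k, rfl⟩ := (C.mem_range_dir i).2 hi
      obtain ⟨m, hm⟩ := hmem k
      rw [Carrier.pull] at hm
      right
      cases hb : C.flip k
      · left
        exact ⟨m, by rw [hm, hb]; rfl⟩
      · right
        refine ⟨m, ?_⟩
        simp only [hm, hb, flipIf, if_true, unitInterval.symm_symm]
    · left
      rcases eq_or_ne (x i) 0 with h | h
      · exact .inl h
      · refine .inr (le_antisymm (x i).2.2 (not_lt.1 fun h' => hi ⟨?_, h'⟩))
        exact unitInterval.pos_iff_ne_zero.2 h
  · by_contra hne
    have := Set.infsep_le_dist_of_mem hs ht hne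
    linarith

/-- The point `x` of the cube `c` is `ε`-close to the preimage `y` of `p`. -/
structure Near (K : CubeComplex.{u, v}) (p : K.Pt) (ε : ℝ) (c : K.Cube) (x y : K.Dir c → I) :
    Prop where
  charMap_eq : K.charMap c y = p
  dist_lt : ∀ i, dist (x i) (y i) < ε

namespace Near

variable {c d : K.Cube} {x y : K.Dir c → I}

lemma eq_of_not_mem_Ioo (hn : K.Near p ε c x y) (hε : K.IsGap p ε) {i : K.Dir c}
    (hi : ¬(0 < x i ∧ x i < 1)) : y i = x i := by
  obtain ⟨hpos, F, h0, h1, hF, hgap⟩ := hε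
  refine (hgap _ ?_ _ (hF c y hn.charMap_eq i) (by linarith [hn.dist_lt i])).symm
  rcases eq_or_ne (x i) 0 with h | h
  · rwa [h]
  · have h' : x i = 1 := le_antisymm unitInterval.le_one'
      (not_lt.1 fun h' => hi ⟨unitInterval.pos_iff_ne_zero.2 h, h'⟩)
    rwa [h']

lemma pull (hn : K.Near p ε c x y) (hε : K.IsGap p ε) (C : K.Carrier c x) :
    K.Near p ε C.cell (C.pull x) (C.pull y) where
  charMap_eq := by
    rw [C.charMap_pull fun i hi => hn.eq_of_not_mem_Ioo hε hi, hn.charMap_eq]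
  dist_lt k := by
    rw [Carrier.pull, Carrier.pull, dist_flipIf]
    exact hn.dist_lt _

lemma charMap_lerp_pull (hn : K.Near p ε c x y) (hε : K.IsGap p ε) (C : K.Carrier c x) (t : I) :
    K.charMap C.cell (lerp (C.pull x) (C.pull y) t) = K.charMap c (lerp x y t) := by
  rw [← C.charMap_push, C.push_lerp, C.push_pull fun _ _ => rfl,
    C.push_pull fun i hi => hn.eq_of_not_mem_Ioo hε hi]

lemma push (hpos : 0 < ε) {C : K.Carrier c x} {z : K.Dir C.cell → I}
    (hn : K.Near p ε C.cell (C.pull x) z) : K.Near p ε c x (C.push z) where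
  charMap_eq := by rw [C.charMap_push, hn.charMap_eq]
  dist_lt i := by
    by_cases hi : 0 < x i ∧ x i < 1
    · obtain ⟨k, rfl⟩ := (C.mem_range_dir i).2 hi
      have := hn.dist_lt k
      rwa [Carrier.pull, ← dist_flipIf (C.flip k), flipIf_self, ← C.push_dir] at this
    · rw [C.push_of_not _ hi, dist_self]
      exact hpos

lemma eq (hε : K.IsGap p ε) {y' : K.Dir c → I} (hn : K.Near p ε c x y)
    (hn' : K.Near p ε c x y') : y = y' := by
  obtain ⟨hpos, F, h0, h1, hF, hgap⟩ := hε
  funext i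
  refine hgap _ (hF c y hn.charMap_eq i) _ (hF c y' hn'.charMap_eq i) ?_
  have := dist_triangle_left (y i) (y' i) (x i)
  linarith [hn.dist_lt i, hn'.dist_lt i]

/-- The segments from the given point to `p` agree in all cubes which contain the point. -/
lemma charMap_lerp_eq (hε : K.IsGap p ε) (hn : K.Near p ε c x y) {x' y' : K.Dir d → I}
    (hn' : K.Near p ε d x' y') (hxx' : K.charMap c x = K.charMap d x') (t : I) :
    K.charMap c (lerp x y t) = K.charMap d (lerp x' y' t) := by
  obtain ⟨C⟩ := K.nonempty_carrier c x
  obtain ⟨D⟩ := K.nonempty_carrier d x'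
  rw [← hn.charMap_lerp_pull hε C, ← hn'.charMap_lerp_pull hε D]
  have h1 := hn.pull hε C
  have h2 := hn'.pull hε D
  have key : ∀ (e e' : K.Cube) (he : e = e') (w z : K.Dir e → I) (w' z' : K.Dir e' → I)
      (hw : ∀ i, 0 < w i ∧ w i < 1) (hw' : ∀ i, 0 < w' i ∧ w' i < 1)
      (hww' : K.charMap e w = K.charMap e' w') (hz : K.Near p ε e w z)
      (hz' : K.Near p ε e' w' z'), K.charMap e (lerp w z t) = K.charMap e' (lerp w' z' t) := by
    rintro e e' rfl w z w' z' hw hw' hww' hz hz'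
    obtain rfl := K.open_injective _ _ _ hw hw' hww'
    rw [hz.eq hε hz']
  have hww' : K.charMap C.cell (C.pull x) = K.charMap D.cell (D.pull x') := by
    rw [C.charMap_pull fun _ _ => rfl, D.charMap_pull fun _ _ => rfl, hxx']
  exact key _ _ (K.open_disjoint _ _ _ _ C.pull_mem_Ioo D.pull_mem_Ioo hww') _ _ _ _
    C.pull_mem_Ioo D.pull_mem_Ioo hww' h1 h2

/-- Closeness to a preimage of `p` does not depend on the choice of the cube. -/
lemma exists_near (hε : K.IsGap p ε) (hn : K.Near p ε c x y) {x' : K.Dir d → I}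
    (hxx' : K.charMap c x = K.charMap d x') : ∃ y', K.Near p ε d x' y' := by
  obtain ⟨C⟩ := K.nonempty_carrier c x
  obtain ⟨D⟩ := K.nonempty_carrier d x'
  have h1 := hn.pull hε C
  have key : ∀ (e e' : K.Cube) (he : e = e') (w z : K.Dir e → I) (w' : K.Dir e' → I)
      (hw : ∀ i, 0 < w i ∧ w i < 1) (hw' : ∀ i, 0 < w' i ∧ w' i < 1)
      (hww' : K.charMap e w = K.charMap e' w') (hz : K.Near p ε e w z),
      ∃ z', K.Near p ε e' w' z' := by
    rintro e e' rfl w z w' hw hw' hww' hz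
    obtain rfl := K.open_injective _ _ _ hw hw' hww'
    exact ⟨z, hz⟩
  have hww' : K.charMap C.cell (C.pull x) = K.charMap D.cell (D.pull x') := by
    rw [C.charMap_pull fun _ _ => rfl, D.charMap_pull fun _ _ => rfl, hxx']
  obtain ⟨z', hz'⟩ := key _ _ (K.open_disjoint _ _ _ _ C.pull_mem_Ioo D.pull_mem_Ioo hww') _ _ _
    C.pull_mem_Ioo D.pull_mem_Ioo hww' h1
  exact ⟨_, Near.push hε.1 hz'⟩

end Near

/-- The union of the `ε`-neighbourhoods of the preimages of `p` in all cubes. -/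
def star (K : CubeComplex.{u, v}) (p : K.Pt) (ε : ℝ) : Set K.Pt :=
  {q | ∃ c x y, K.charMap c x = q ∧ K.Near p ε c x y}

lemma mem_star_self (hε : 0 < ε) : p ∈ K.star p ε := by
  obtain ⟨c, x, -, hx⟩ := K.exists_open p
  exact ⟨c, x, x, hx, hx, fun i => by rwa [dist_self]⟩

lemma charMap_mem_star (hε : K.IsGap p ε) {c : K.Cube} {x : K.Dir c → I} :
    K.charMap c x ∈ K.star p ε ↔ ∃ y, K.Near p ε c x y := by
  constructor
  · rintro ⟨d, x', y', hx, hn⟩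
    exact hn.exists_near hε hx
  · rintro ⟨y, hn⟩
    exact ⟨c, x, y, rfl, hn⟩

lemma isOpen_near (c : K.Cube) (y : K.Dir c → I) : IsOpen {x | K.Near p ε c x y} := by
  have := K.finite_dir c
  by_cases hy : K.charMap c y = p
  · have : {x | K.Near p ε c x y} = ⋂ i, {x | dist (x i) (y i) < ε} := by
      ext x
      simp only [Set.mem_ofPred_eq, Set.mem_iInter]
      exact ⟨fun h => h.dist_lt, fun h => ⟨hy, h⟩⟩
    rw [this]
    refine isOpen_iInter_of_finite fun i => isOpen_lt ?_ continuous_const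
    fun_prop
  · convert isOpen_empty
    exact Set.eq_empty_of_forall_notMem fun x hx => hy hx.charMap_eq

lemma isOpen_star (hε : K.IsGap p ε) : IsOpen (K.star p ε) := by
  refine isOpen_iff.2 fun c => ?_
  have : K.charMap c ⁻¹' K.star p ε = ⋃ y, {x | K.Near p ε c x y} := by
    ext x
    simp only [Set.mem_preimage, charMap_mem_star hε, Set.mem_iUnion, Set.mem_ofPred_eq]
  rw [this]
  exact isOpen_iUnion fun y => isOpen_near c y

/-- The straight segment from `x` to `y` in the cube `c`, as a continuous map. -/
def cubeSegment (c : K.Cube) (x y : K.Dir c → I) : C(I, K.Pt) where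
  toFun t := K.charMap c (lerp x y t)
  continuous_toFun := (K.continuous_charMap c).comp
    (continuous_lerp_comp continuous_const continuous_const continuous_id)

open Classical in
/-- The segment from a point `q` of the star to the centre `p`. -/
noncomputable def track (K : CubeComplex.{u, v}) (p : K.Pt) (ε : ℝ) (q : K.Pt) : C(I, K.Pt) :=
  if h : q ∈ K.star p ε then cubeSegment h.choose h.choose_spec.choose
    h.choose_spec.choose_spec.choose else .const _ p

lemma track_charMap (hε : K.IsGap p ε) {c : K.Cube} {x y : K.Dir c → I}
    (hn : K.Near p ε c x y) : K.track p ε (K.charMap c x) = cubeSegment c x y := by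
  have hmem : K.charMap c x ∈ K.star p ε := ⟨c, x, y, rfl, hn⟩
  rw [track, dif_pos hmem]
  have hspec := hmem.choose_spec.choose_spec.choose_spec
  exact ContinuousMap.ext fun t => hspec.2.charMap_lerp_eq hε hn hspec.1 t

/-- The segments to the centre of the star depend continuously on the starting point. As the
topology of the complex is the weak one, it is enough to look at the cubes one by one, and in
a cube the end of the segment is locally constant. -/
theorem continuousOn_track (hε : K.IsGap p ε) : ContinuousOn (K.track p ε) (K.star p ε) := by
  refine (continuousOn_open_iff (isOpen_star hε)).2 fun V hV => isOpen_iff.2 fun c => ?_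
  have : K.charMap c ⁻¹' (K.star p ε ∩ K.track p ε ⁻¹' V) =
      ⋃ y, {x | K.Near p ε c x y} ∩ (fun x => cubeSegment c x y) ⁻¹' V := by
    ext x
    simp only [Set.mem_preimage, Set.mem_inter_iff, charMap_mem_star hε, Set.mem_iUnion,
      Set.mem_ofPred_eq]
    constructor
    · rintro ⟨⟨y, hn⟩, hV⟩
      exact ⟨y, hn, by rwa [← track_charMap hε hn]⟩
    · rintro ⟨y, hn, hV⟩
      exact ⟨⟨y, hn⟩, by rwa [track_charMap hε hn]⟩
  rw [this]
  refine isOpen_iUnion fun y => (isOpen_near c y).inter (hV.preimage ?_)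
  refine ContinuousMap.continuous_of_continuous_uncurry _ ?_
  exact (K.continuous_charMap c).comp
    (continuous_lerp_comp continuous_fst continuous_const continuous_snd)

end CubeComplex

/-! ### Simple connectivity of the zero level -/

namespace CubeComplex

open TwoSkeleton

variable {K : CubeComplex.{u, v}} {h : K.Pt → ℝ} {v p q r : K.zeroLevel h} {ε : ℝ}

lemma track_mem_zeroLevel (hK : K.IntegralHeight h) (hε : K.IsGap p ε) {w : K.Pt}
    (hw : w ∈ K.zeroLevel h) (hw' : w ∈ K.star p ε) (t : I) :
    K.track p ε w t ∈ K.zeroLevel h := by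
  obtain ⟨c, x, y, rfl, hn⟩ := hw'
  rw [track_charMap hε hn]
  change h (K.charMap c (lerp x y t)) = 0
  rw [hK.height_lerp, hn.charMap_eq, p.2, hw]
  ring

/-- The contraction of the part of a star in the zero level to the centre. -/
noncomputable def contraction (hK : K.IntegralHeight h) (hε : K.IsGap p ε) :
    ContinuousMap.Homotopy
      (⟨Subtype.val, continuous_subtype_val⟩ :
        C({w : K.zeroLevel h // (w : K.Pt) ∈ K.star p ε}, K.zeroLevel h))
      (.const _ p) where
  toFun x := ⟨K.track p ε x.2.1 x.1, track_mem_zeroLevel hK hε x.2.1.2 x.2.2 x.1⟩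
  continuous_toFun := by
    refine Continuous.subtype_mk ?_ _
    have h1 : Continuous fun w : {w : K.zeroLevel h // (w : K.Pt) ∈ K.star p ε} =>
        K.track p ε w.1 :=
      (continuousOn_track hε).comp_continuous
        (continuous_subtype_val.comp continuous_subtype_val) fun w => w.2
    exact (h1.comp continuous_snd).eval continuous_fst
  map_zero_left w := by
    obtain ⟨c, x, y, hx, hn⟩ := w.2
    refine Subtype.ext ?_
    change K.track p ε w.1 0 = w.1
    rw [← hx, track_charMap hε hn]
    change K.charMap c (lerp x y 0) = _
    rw [lerp_zero]
  map_one_left w := by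
    obtain ⟨c, x, y, hx, hn⟩ := w.2
    refine Subtype.ext ?_
    change K.track p ε w.1 1 = p
    rw [← hx, track_charMap hε hn]
    change K.charMap c (lerp x y 1) = _
    rw [lerp_one, hn.charMap_eq]

lemma IsClass.trans_evalAt (hf : K.Fillable h) (hK : K.IntegralHeight h) (hε : K.IsGap p ε)
    (w : {w : K.zeroLevel h // (w : K.Pt) ∈ K.star p ε}) {ξ : Path.Homotopic.Quotient v w.1}
    (hξ : IsClass hK v w.1 ξ) :
    IsClass hK v p (ξ.trans (.mk ((contraction hK hε).evalAt w))) := by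
  obtain ⟨c, x, y, hx, hn⟩ := w.2
  have := hξ.trans_segClass hf hK hx hn.charMap_eq
  convert this using 2
  rw [segClass]
  congr 1
  refine Path.ext (funext fun t => Subtype.ext ?_)
  change K.track p ε w.1 t = K.charMap c (lerp x y t)
  rw [← hx, track_charMap hε hn]
  rfl

/-- The classes are compatible with paths in a star, since the star can be contracted along
segments, which are compatible with the classes. -/
lemma IsClass.trans_of_mem_star (hf : K.Fillable h) (hK : K.IntegralHeight h) (hε : K.IsGap p ε)
    (δ : Path q r) (hδ : ∀ t, (δ t : K.Pt) ∈ K.star p ε) {ξ : Path.Homotopic.Quotient v q}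
    {ξ' : Path.Homotopic.Quotient v r} (hξ : IsClass hK v q ξ) (hξ' : IsClass hK v r ξ') :
    ξ.trans (.mk δ) = ξ' := by
  have hq : (q : K.Pt) ∈ K.star p ε := by simpa using hδ 0
  have hr : (r : K.Pt) ∈ K.star p ε := by simpa using hδ 1
  let q' : {w : K.zeroLevel h // (w : K.Pt) ∈ K.star p ε} := ⟨q, hq⟩
  let r' : {w : K.zeroLevel h // (w : K.Pt) ∈ K.star p ε} := ⟨r, hr⟩
  let δ' : Path q' r' :=
    { toFun := fun t => ⟨δ t, hδ t⟩
      continuous_toFun := δ.continuous.subtype_mk _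
      source' := Subtype.ext δ.source
      target' := Subtype.ext δ.target }
  let Tq : Path q p := (contraction hK hε).evalAt q'
  let Tr : Path r p := (contraction hK hε).evalAt r'
  have h1 : (Path.Homotopic.Quotient.mk δ).trans (.mk Tr) =
      (Path.Homotopic.Quotient.mk Tq).trans (.mk (Path.refl p)) :=
    Path.Homotopic.Quotient.eq.2 (Path.Homotopic.map_trans_evalAt (contraction hK hε) δ')
  have h2 : ξ.trans (.mk Tq) = ξ'.trans (.mk Tr) :=
    (IsClass.trans_evalAt hf hK hε q' hξ).unique hf hK (IsClass.trans_evalAt hf hK hε r' hξ')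
  rw [Path.Homotopic.Quotient.mk_refl, Path.Homotopic.Quotient.trans_refl] at h1
  rw [← h1, ← Path.Homotopic.Quotient.trans_assoc] at h2
  have h3 := congrArg (fun ζ => ζ.trans (Path.Homotopic.Quotient.mk Tr).symm) h2
  simp only [Path.Homotopic.Quotient.trans_assoc, Path.Homotopic.Quotient.trans_symm,
    Path.Homotopic.Quotient.trans_refl] at h3
  exact h3

/-- The classes are compatible with all paths, since a path is a finite composition of paths in
stars. -/
theorem IsClass.trans (hf : K.Fillable h) (hK : K.IntegralHeight h)
    (hex : ∀ q, ∃ ξ, IsClass hK v q ξ) (δ : Path q r) {ξ : Path.Homotopic.Quotient v q}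
    {ξ' : Path.Homotopic.Quotient v r} (hξ : IsClass hK v q ξ) (hξ' : IsClass hK v r ξ') :
    ξ.trans (.mk δ) = ξ' := by
  choose ε hε using fun p : K.zeroLevel h => K.exists_isGap p
  obtain ⟨t, ht0, hmono, ⟨n, hn⟩, ht⟩ := exists_monotone_Icc_subset_open_cover_unitInterval
    (c := fun p : K.zeroLevel h => {s | (δ s : K.Pt) ∈ K.star p (ε p)})
    (fun p => (isOpen_star (hε p)).preimage (continuous_subtype_val.comp δ.continuous))
    (fun s _ => Set.mem_iUnion.2 ⟨δ s, mem_star_self (hε _).1⟩)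
  choose η hη using fun s : I => hex (δ s)
  have key : ∀ m, (η 0).trans (.mk (δ.subpath 0 (t m))) = η (t m) := by
    intro m
    induction m with
    | zero =>
      rw [ht0, Path.subpath_self, Path.Homotopic.Quotient.mk_refl,
        Path.Homotopic.Quotient.trans_refl]
    | succ m ih =>
      obtain ⟨p, hp⟩ := ht m
      have h1 := IsClass.trans_of_mem_star hf hK (hε p) (δ.subpath (t m) (t (m + 1)))
        (fun s => by
          have : δ.subpath (t m) (t (m + 1)) s ∈ Set.range (δ.subpath (t m) (t (m + 1))) := ⟨s, rfl⟩
          rw [Path.range_subpath_of_le _ _ _ (hmono (Nat.le_succ m))] at this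
          obtain ⟨s', hs', heq⟩ := this
          rw [← heq]
          exact hp hs') (hη (t m)) (hη (t (m + 1)))
      rw [← h1, ← ih, Path.Homotopic.Quotient.trans_assoc, ← Path.Homotopic.Quotient.mk_trans,
        Path.Homotopic.Quotient.eq.2 ⟨Path.Homotopy.subpathTransSubpath δ 0 (t m) (t (m + 1))⟩]
  have h1 := key n
  rw [hn n le_rfl, Path.subpath_zero_one, Path.Homotopic.Quotient.mk_cast] at h1
  have key' : ∀ (a b : K.zeroLevel h) (ha : a = q) (hb : b = r) (ζ : Path.Homotopic.Quotient v a)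
      (ζ' : Path.Homotopic.Quotient v b), IsClass hK v a ζ → IsClass hK v b ζ' →
      ζ.trans ((Path.Homotopic.Quotient.mk δ).cast ha hb) = ζ' → ξ.trans (.mk δ) = ξ' := by
    rintro a b rfl rfl ζ ζ' hζ hζ' heq
    rw [Path.Homotopic.Quotient.cast_rfl_rfl] at heq
    rw [hξ.unique hf hK hζ, hξ'.unique hf hK hζ', heq]
  exact key' _ _ δ.source δ.target _ _ (hη 0) (hη 1) h1

/-- If the sliced zero level is combinatorially connected and simply connected, then it is simply
connected as a topological space. -/
theorem simplyConnectedSpace_zeroLevel (hf : K.Fillable h) (hK : K.IntegralHeight h)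
    {v : K.Pt} (hv : h v = 0)
    (hconn : ∀ w, K.IsVertex w → h w = 0 → ∃ l, (K.slicedZeroLevel h).IsEdgePath v l w) :
    SimplyConnectedSpace (K.zeroLevel h) := by
  have hex := exists_isClass (v := ⟨v, hv⟩) hK hconn
  rw [simply_connected_iff_paths_homotopic']
  refine ⟨⟨⟨⟨v, hv⟩⟩, fun q r => ?_⟩, fun {q r} δ δ' => ?_⟩
  · obtain ⟨ξ, -⟩ := hex q
    obtain ⟨ξ', -⟩ := hex r
    induction ξ using Path.Homotopic.Quotient.ind with | mk γ =>
    induction ξ' using Path.Homotopic.Quotient.ind with | mk γ' =>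
    exact ⟨γ.symm.trans γ'⟩
  · obtain ⟨ξ, hξ⟩ := hex q
    obtain ⟨ξ', hξ'⟩ := hex r
    have h1 := (hξ.trans hf hK hex δ hξ').trans (hξ.trans hf hK hex δ' hξ').symm
    have h2 := congrArg (fun ζ => ξ.symm.trans ζ) h1
    simp only [← Path.Homotopic.Quotient.trans_assoc, Path.Homotopic.Quotient.symm_trans,
      Path.Homotopic.Quotient.refl_trans] at h2
    exact Path.Homotopic.Quotient.eq.1 h2

end CubeComplex

/-! ### The zero level of a product of three complexes -/

theorem theorem4p2 (α : ℝ) (hα : 2 ≤ α)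
    (X₁ : CubeComplex.{u₁, v₁}) (X₂ : CubeComplex.{u₂, v₂}) (X₃ : CubeComplex.{u₃, v₃})
    (h₁ : X₁.Pt → ℝ) (h₂ : X₂.Pt → ℝ) (h₃ : X₃.Pt → ℝ)
    (hh₁ : X₁.IsHeightFunction h₁) (hh₂ : X₂.IsHeightFunction h₂) (hh₃ : X₃.IsHeightFunction h₃)
    (hsc₁ : SimplyConnectedSpace X₁.Pt) (hsc₂ : SimplyConnectedSpace X₂.Pt)
    (hsc₃ : SimplyConnectedSpace X₃.Pt)
    (ha₁ : X₁.Admissible h₁) (ha₂ : X₂.Admissible h₂) (ha₃ : X₃.Admissible h₃)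
    (hfin₁ : ∀ n, (X₁.sliced h₁).dehn n ≠ ⊤) (hfin₂ : ∀ n, (X₂.sliced h₂).dehn n ≠ ⊤)
    (hfin₃ : ∀ n, (X₃.sliced h₃).dehn n ≠ ⊤)
    (hd₁ : DehnLE (X₁.sliced h₁).dehn (fun n => (n : ℝ≥0∞) ^ α))
    (hd₂ : DehnLE (X₂.sliced h₂).dehn (fun n => (n : ℝ≥0∞) ^ α))
    (hd₃ : DehnLE (X₃.sliced h₃).dehn (fun n => (n : ℝ≥0∞) ^ α)) :
    SimplyConnectedSpace
      (((X₁.prod X₂).prod X₃).zeroLevel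
        (CubeComplex.prodHeight (CubeComplex.prodHeight h₁ h₂) h₃)) ∧
    DehnLE
      (((X₁.prod X₂).prod X₃).slicedZeroLevel
        (CubeComplex.prodHeight (CubeComplex.prodHeight h₁ h₂) h₃)).dehn
      (fun n => (n : ℝ≥0∞) ^ α) := by
  have hX₁ := hh₁.integralHeight ha₁
  have hX₂ := hh₂.integralHeight ha₂
  have hX₃ := hh₃.integralHeight ha₃
  have hlines₁ : X₁.HasLines h₁ := fun p hp => ha₁.exists_isLine hh₁ hp
  have hlines₂ : X₂.HasLines h₂ := fun p hp => ha₂.exists_isLine hh₂ hp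
  have hlines₃ : X₃.HasLines h₃ := fun p hp => ha₃.exists_isLine hh₃ hp
  obtain ⟨p, hp, hp0⟩ := CubeComplex.exists_isVertex_zeroLevel hX₁ hX₂ hlines₃
  exact ⟨CubeComplex.simplyConnectedSpace_zeroLevel
      (fun _ _ hγ => ⟨_, CubeComplex.homotopicLE_nil hX₁ hX₂ hX₃ hlines₁ hlines₂ hlines₃
        hfin₁ hfin₂ hfin₃ hγ le_rfl⟩)
      ((hX₁.prod hX₂).prod hX₃) hp0
      (fun _ hq hq0 => CubeComplex.exists_isEdgePath_zeroLevel hX₁ hX₂ hX₃ hlines₁ hlines₃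
        hp hq hp0 hq0),
    CubeComplex.dehnLE_slicedZeroLevel hα hX₁ hX₂ hX₃ hlines₁ hlines₂ hlines₃
      hfin₁ hfin₂ hfin₃ hd₁ hd₂ hd₃⟩
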